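/- **Setting.** A signature $\Sigma$ has finitely many (at least one) sorts, each an agent sort or a data sort, finitely many constant symbols, and finitely many relation symbols $\mathcal R=\mathcal R_{wf}\uplus\mathcal R_{high}$ (workflow relations and high inputs). The arity of each relation is a nonempty sequence of sorts that begins with an agent sort. FOLTL formulas are built from atoms $t=t'$ and $R(\bar t)$ with $\neg,\lor,\exists x{:}s,\bigcirc$ (next), $\mathcal U$ (until); all formulas are well-sorted. A *workflow* is given by $w::= b\mid b\;w\mid \mathbf{loop}\{w\}\mid\mathbf{choose}\;w\;\mathbf{or}\;w$. A block $b$ is $\mathbf{forall}\;\bar x\,[\mathbf{may}].\ \theta_1\to R_1\pm\!\!=\bar u_1;\dots;\theta_n\to R_n\pm\!\!=\bar u_n$ with $n\ge 1$, $R_i\in\mathcal R_{wf}$, first-order guards $\theta_i$ over $\Sigma$, and $\mathrm{fv}(\theta_i)\cup \mathrm{fv}(\bar u_i)\subseteq\bar x$. Each $\mathbf{may}$ block number $j$ has an additional relation $aux_j$ (a *low input*) whose arity is the sequence of sorts of $\bar x$; this arity is also nonempty and begins with an agent sort. The workflow is *non-omitting* if $\mathrm{fv}(\bar u_i)=\bar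 x$ and $\theta_i$ is quantifier-free for every statement of every block. The control flow graph of $w$ has every block on exactly one edge, all other edges labelled $id$, at most one edge between two nodes in each direction, and a final node whose only outgoing edge is an $id$ self-loop. Each iteration of a loop starts and ends at the node where the loop is entered, and an $id$ edge leaves the loop. (A loop that is itself the whole body of a loop first gets a node of its own, and each branch of a choice gets its own start node, by $id$ edges.) $\Sigma'$ extends $\Sigma$ by the $aux_j$ and by a proposition for each node. A temporal structure over $\Sigma'$ is an infinite sequence of structures with the same nonempty (finite or infinite) universes $U_s$ and the same constants. It belongs to $[\![w]\!]$ if: at each time at most one node holds; initially exactly the entry node holds and all workflow relations are empty; from each node the next one is a successor; and each step along an edge replaces the workflow relations according to the edge's block ($id$ changes nothing). A statement $\theta\to R\pm\!\!=\bar u$ of block number $j$ adds to (deletes from) $R$ all tuples $\bar u(\bar x)$ for which $\theta(\bar x)$ holds before the block, and, for a $\mathbf{may}$ block, $aux_j(\bar x)$ holds too. Several updates of the same relation in one block are applied in sequence. For temporal structures $\pi,\pi'\in[\![w]\!]$ with the same universes and constants, and an agent $a$ (an element of an agent sort's universe), let $\mathrm{low}(a)$ say, at a time point, that $aux_\pi(a,\bar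 x)\leftrightarrow aux_{\pi'}(a,\bar x)$ for all low inputs $aux$ and all $\bar x$; let $\mathrm{obs}(a)$ say the same for all $R\in\mathcal R_{wf}$. The agent $a$ is *stubborn* if $\mathbf G\,\mathrm{low}(a)$, and *causal* if $\mathrm{low}(a)\ \mathcal W\ \neg\mathrm{obs}(a)$, where $\mathbf G$ is "always" and $\mathcal W$ is weak until. For each $O\in\mathcal R_{high}$ (and each agent sort of $a$) an FOLTL formula $\varphi_O(a,\bar y)$ over $\Sigma'$ with free variables among $a,\bar y$ is given, the *declassification condition*. For $k\ge 0$, $w$ satisfies *Non-interference with Declassification* for at most $k$ causal agents if for all such $\pi,\pi'$ the following holds. Suppose there are agents $a_1,\dots,a_k$ that are causal while all other agents, of which there may be any number, are stubborn, and suppose the same node holds in $\pi$ and $\pi'$ at every time. Then for every agent $a$, $$\Big(\mathbf G\,\mathrm{low}(a)\ \land\ \mathbf G\bigwedge_{O\in\mathcal R_{high}}\forall\bar y.\,\big(\varphi_{O,\pi}(a,\bar y)\lor\varphi_{O,\pi'}(a,\bar y)\big)\to\big(O_\pi(\bar y)\leftrightarrow O_{\pi'}(\bar y)\big)\Big)\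 \to\ \mathbf G\,\mathrm{obs}(a).$$ **Theorem.** There is an algorithm that, given a signature $\Sigma$, a non-omitting workflow $w$ over $\Sigma$, declassification conditions $\varphi_O$ such that the negation normal form of each $\neg\varphi_O$ contains no existential quantifier, and a number $k\in\mathbb N$, decides whether $w$ satisfies Non-interference with Declassification for at most $k$ causal agents, all other agents being stubborn. -/

import Mathlib

namespace MultiAgent

/-! ### Signatures, terms and formulas -/

/-- Finite many-sorted signatures of workflows. The sorts are `0, …, numAgentSorts + numDataSorts - 1`;
those below `numAgentSorts` are the agent sorts, the others are the data sorts.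
`constSorts` lists the sorts of the constant symbols, `wfRels` and `highRels` list the arities
(sequences of sorts) of the workflow relations and of the high-input relations. -/
structure Signature where
  numAgentSorts : ℕ
  numDataSorts : ℕ
  constSorts : List ℕ
  wfRels : List (List ℕ)
  highRels : List (List ℕ)

/-- Variables carry their sort; every sort has countably many of them. -/
structure Var where
  sort : ℕ
  idx : ℕ
  deriving DecidableEq

inductive Term where
  | var (v : Var)
  | const (c : ℕ)

/-- Predicate symbols over the extended signature of a workflow: workflow relations, high inputs,
the low input `low j` that records the choices made in the `may` block number `j`,
and one proposition for every node of the control flow graph. -/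
inductive Pred where
  | wf (i : ℕ)
  | high (i : ℕ)
  | low (j : ℕ)
  | node (n : ℕ)

/-- FOLTL formulas. -/
inductive Formula where
  | eq (t t' : Term)
  | rel (P : Pred) (ts : List Term)
  | not (φ : Formula)
  | or (φ ψ : Formula)
  | ex (v : Var) (φ : Formula)
  | next (φ : Formula)
  | untl (φ ψ : Formula)

namespace Signature

def numSorts (S : Signature) : ℕ := S.numAgentSorts + S.numDataSorts

/-- The arities of the symbols of the (unextended) signature. -/
def arity (S : Signature) : Pred → Option (List ℕ)
  | .wf i => S.wfRels[i]?
  | .high i => S.highRels[i]?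
  | .low _ => none
  | .node _ => none

/-- An arity over `S` that is not nullary and whose first sort is an agent sort. -/
def AgentFirst (S : Signature) (l : List ℕ) : Prop :=
  (∀ s ∈ l, s < S.numSorts) ∧ ∃ s, l.head? = some s ∧ s < S.numAgentSorts

structure WellFormed (S : Signature) : Prop where
  sorts : 0 < S.numSorts
  consts : ∀ s ∈ S.constSorts, s < S.numSorts
  wfRels : ∀ l ∈ S.wfRels, S.AgentFirst l
  highRels : ∀ l ∈ S.highRels, S.AgentFirst l

def termSort (S : Signature) : Term → Option ℕ
  | .var v => if v.sort < S.numSorts then some v.sort else none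
  | .const c => S.constSorts[c]?

end Signature

def Term.fv : Term → Set Var
  | .var v => {v}
  | .const _ => ∅

namespace Formula

def fv : Formula → Set Var
  | eq t t' => t.fv ∪ t'.fv
  | rel _ ts => {v | ∃ t ∈ ts, v ∈ t.fv}
  | not φ => φ.fv
  | or φ ψ => φ.fv ∪ ψ.fv
  | ex v φ => φ.fv \ {v}
  | next φ => φ.fv
  | untl φ ψ => φ.fv ∪ ψ.fv

/-- Well-sortedness, where `ar P` is the arity of the symbol `P`, if `P` may be used at all. -/
def WellSorted (S : Signature) (ar : Pred → Option (List ℕ)) : Formula → Prop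
  | eq t t' => ∃ s, S.termSort t = some s ∧ S.termSort t' = some s
  | rel P ts => ∃ l, ar P = some l ∧ ts.map S.termSort = l.map some
  | not φ => φ.WellSorted S ar
  | or φ ψ => φ.WellSorted S ar ∧ ψ.WellSorted S ar
  | ex v φ => v.sort < S.numSorts ∧ φ.WellSorted S ar
  | next φ => φ.WellSorted S ar
  | untl φ ψ => φ.WellSorted S ar ∧ ψ.WellSorted S ar

def FirstOrder : Formula → Prop
  | eq _ _ => True
  | rel _ _ => True
  | not φ => φ.FirstOrder
  | or φ ψ => φ.FirstOrder ∧ ψ.FirstOrder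
  | ex _ φ => φ.FirstOrder
  | next _ => False
  | untl _ _ => False

def QuantifierFree : Formula → Prop
  | eq _ _ => True
  | rel _ _ => True
  | not φ => φ.QuantifierFree
  | or φ ψ => φ.QuantifierFree ∧ ψ.QuantifierFree
  | ex _ _ => False
  | next φ => φ.QuantifierFree
  | untl φ ψ => φ.QuantifierFree ∧ ψ.QuantifierFree

end Formula

/-- Formulas in negation normal form; `pos = false` marks a negated atom. -/
inductive NNF where
  | eq (pos : Bool) (t t' : Term)
  | rel (pos : Bool) (P : Pred) (ts : List Term)
  | and (φ ψ : NNF)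
  | or (φ ψ : NNF)
  | ex (v : Var) (φ : NNF)
  | all (v : Var) (φ : NNF)
  | next (φ : NNF)
  | untl (φ ψ : NNF)
  | release (φ ψ : NNF)

/-- `φ.nnf true` is the negation normal form of `φ`, `φ.nnf false` that of its negation. -/
def Formula.nnf : Formula → Bool → NNF
  | eq t t', p => .eq p t t'
  | rel P ts, p => .rel p P ts
  | not φ, p => φ.nnf (!p)
  | or φ ψ, true => .or (φ.nnf true) (ψ.nnf true)
  | or φ ψ, false => .and (φ.nnf false) (ψ.nnf false)
  | ex v φ, true => .ex v (φ.nnf true)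
  | ex v φ, false => .all v (φ.nnf false)
  | next φ, p => .next (φ.nnf p)
  | untl φ ψ, true => .untl (φ.nnf true) (ψ.nnf true)
  | untl φ ψ, false => .release (φ.nnf false) (ψ.nnf false)

def NNF.NoExists : NNF → Prop
  | eq _ _ _ => True
  | rel _ _ _ => True
  | and φ ψ => φ.NoExists ∧ ψ.NoExists
  | or φ ψ => φ.NoExists ∧ ψ.NoExists
  | ex _ _ => False
  | all _ φ => φ.NoExists
  | next φ => φ.NoExists
  | untl φ ψ => φ.NoExists ∧ ψ.NoExists
  | release φ ψ => φ.NoExists ∧ ψ.NoExists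

/-! ### Workflows -/

/-- `θ → R += ū` (if `add = true`) or `θ → R -= ū` (if `add = false`), for the workflow
relation `R` with number `rel`. -/
structure Stmt where
  guard : Formula
  rel : ℕ
  add : Bool
  args : List Term

/-- `forall x̄. stmts` or, if `may = true`, `forall x̄ may. stmts`. -/
structure Block where
  may : Bool
  vars : List Var
  stmts : List Stmt

inductive Workflow where
  | block (b : Block)
  | seq (b : Block) (w : Workflow)
  | loop (w : Workflow)
  | choice (w w' : Workflow)

def Stmt.argVars (st : Stmt) : Set Var := {v | ∃ t ∈ st.args, v ∈ t.fv}

def Block.varSet (b : Block) : Set Var := {v | v ∈ b.vars}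

structure Stmt.WellFormed (S : Signature) (b : Block) (st : Stmt) : Prop where
  guard_fo : st.guard.FirstOrder
  guard_sorted : st.guard.WellSorted S S.arity
  args_sorted : ∃ l, S.wfRels[st.rel]? = some l ∧ st.args.map S.termSort = l.map some
  guard_fv : st.guard.fv ⊆ b.varSet
  args_fv : st.argVars ⊆ b.varSet

structure Block.WellFormed (S : Signature) (b : Block) : Prop where
  vars_sorted : ∀ v ∈ b.vars, v.sort < S.numSorts
  nonempty : b.stmts ≠ []
  stmts : ∀ st ∈ b.stmts, st.WellFormed S b
  /-- The low input relation of a `may` block has an agent as its first argument. -/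
  low : b.may = true → S.AgentFirst (b.vars.map Var.sort)

namespace Workflow

/-- The linearisation of a workflow. -/
def blocks : Workflow → List Block
  | block b => [b]
  | seq b w => b :: w.blocks
  | loop w => w.blocks
  | choice w w' => w.blocks ++ w'.blocks

def WellFormed (S : Signature) (w : Workflow) : Prop := ∀ b ∈ w.blocks, b.WellFormed S

def NonOmitting (w : Workflow) : Prop :=
  ∀ b ∈ w.blocks, ∀ st ∈ b.stmts, st.argVars = b.varSet ∧ st.guard.QuantifierFree

/-- An edge of the control flow graph. The label is `some (j, b)` for the block `b` with number `j`
in the linearisation, and `none` for an edge labelled `id`. -/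
structure Edge where
  src : ℕ
  dst : ℕ
  label : Option (ℕ × Block)

/-- The edges of the part of the control flow graph that belongs to `w` and leads from node `s` to
node `t`, where `m` is the next fresh node and `j` the number of the next block;
the new values of `m` and `j` are returned as well. A loop starts and ends each iteration in the node
in which it is entered, and is left by an `id` edge. There are never two edges with the
same source and target. The case `s = t` for `loop` arises for a loop whose
body is again a loop: the inner loop then gets a node of its own. -/
def build : Workflow → (s t : ℕ) → (m j : ℕ) → List Edge × ℕ × ℕ
  | block b, s, t, m, j => ([⟨s, t, some (j, b)⟩], m, j + 1)
  | seq b w, s, t, m, j =>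
      let r := w.build m t (m + 1) (j + 1)
      (⟨s, m, some (j, b)⟩ :: r.1, r.2)
  | loop w, s, t, m, j =>
      if s = t then
        let r := w.build m m (m + 1) j
        (⟨s, m, none⟩ :: ⟨m, s, none⟩ :: r.1, r.2)
      else
        let r := w.build s s m j
        (⟨s, t, none⟩ :: r.1, r.2)
  | choice w w', s, t, m, j =>
      let r := w.build m t (m + 2) j
      let r' := w'.build (m + 1) t r.2.1 r.2.2
      (⟨s, m, none⟩ :: ⟨s, m + 1, none⟩ :: (r.1 ++ r'.1), r'.2)

def entry : ℕ := 0

def final : ℕ := 1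

/-- The edges of the control flow graph, with the looping edge of the final node. -/
def edges (w : Workflow) : List Edge :=
  ⟨final, final, none⟩ :: (w.build entry final 2 0).1

def nodes (w : Workflow) : Set ℕ := {n | ∃ e ∈ w.edges, n = e.src ∨ n = e.dst}

open Classical in
/-- The arities of the symbols of the signature extended with the low inputs and the nodes of `w`. -/
noncomputable def arity (S : Signature) (w : Workflow) : Pred → Option (List ℕ)
  | .wf i => S.arity (.wf i)
  | .high i => S.arity (.high i)
  | .low j => (w.blocks[j]?).bind
      fun b => if b.may = true then some (b.vars.map Var.sort) else none
  | .node n => if n ∈ w.nodes then some [] else none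

end Workflow

/-! ### Semantics -/

/-- The parts shared by all structures of a temporal structure, and by all traces that a
hyperproperty compares: the universes (nonempty, finite or infinite) and the rigid constants. -/
structure Carrier (S : Signature) where
  U : ℕ → Type
  nonempty : ∀ s, Nonempty (U s)
  const : ℕ → Σ s, U s
  const_sort : ∀ c s, S.constSorts[c]? = some s → (const c).1 = s

variable {S : Signature} {w : Workflow}

/-- The elements of the universes, together with their sorts. -/
abbrev Carrier.Elem (K : Carrier S) : Type := Σ s, K.U s

abbrev Carrier.Valuation (K : Carrier S) : Type := (v : Var) → K.U v.sort

def Carrier.val (K : Carrier S) (ν : K.Valuation) : Term → K.Elem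
  | .var v => ⟨v.sort, ν v⟩
  | .const c => K.const c

/-- A temporal structure with carrier `K` over the signature extended by the low inputs and
control flow nodes of `w`: `rel i P` is the interpretation of `P` at time `i`. -/
structure Trace (w : Workflow) (K : Carrier S) where
  rel : ℕ → Pred → Set (List K.Elem)
  sorted : ∀ i P x, x ∈ rel i P → w.arity S P = some (x.map Sigma.fst)

/-- `π.sat φ i ν`: the formula `φ` holds at time `i`, i.e. in the suffix of `π` from `i` on. -/
def Trace.sat {K : Carrier S} (π : Trace w K) : Formula → ℕ → K.Valuation → Prop
  | .eq t t', _, ν => K.val ν t = K.val ν t'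
  | .rel P ts, i, ν => ts.map (K.val ν) ∈ π.rel i P
  | .not φ, i, ν => ¬ π.sat φ i ν
  | .or φ ψ, i, ν => π.sat φ i ν ∨ π.sat ψ i ν
  | .ex v φ, i, ν => ∃ d : K.U v.sort, π.sat φ i (Function.update ν v d)
  | .next φ, i, ν => π.sat φ (i + 1) ν
  | .untl φ ψ, i, ν => ∃ j, i ≤ j ∧ π.sat ψ j ν ∧ ∀ l, i ≤ l → l < j → π.sat φ l ν

namespace Trace

variable {K : Carrier S} (π π' : Trace w K)

/-- The node `n` is the current one at time `i`. -/
def AtNode (i n : ℕ) : Prop := [] ∈ π.rel i (.node n)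

/-- The tuples `ū` that the statement `st` of the block `b` with number `j` adds or deletes
at time `i`: those for which there is `x̄` such that the guard holds and, if
the block is a `may` block, `x̄` is in the low input relation of the block. -/
def updates (i j : ℕ) (b : Block) (st : Stmt) : Set (List K.Elem) :=
  {y | ∃ ν : K.Valuation, π.sat st.guard i ν ∧
    (b.may = true → (b.vars.map fun v => (⟨v.sort, ν v⟩ : K.Elem)) ∈ π.rel i (.low j)) ∧
    y = st.args.map (K.val ν)}

open Classical in
/-- The interpretation of the workflow relation `R` after executing the edge label `lab` at time `i`:
guards are evaluated before the block is executed, and if `R` is updated by several statements of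
the block, then these updates are applied one after the other. -/
noncomputable def post (i : ℕ) (lab : Option (ℕ × Block)) (R : ℕ) : Set (List K.Elem) :=
  match lab with
  | none => π.rel i (.wf R)
  | some (j, b) =>
      b.stmts.foldl
        (fun X st =>
          if st.rel = R then
            if st.add = true then X ∪ π.updates i j b st else X \ π.updates i j b st
          else X)
        (π.rel i (.wf R))

/-- `π` is in the semantics of the workflow `w`. -/
structure IsExecution : Prop where
  cfg : ∀ i, ∀ n ∈ w.nodes, π.AtNode i n →
    ∃ e ∈ w.edges, e.src = n ∧ π.AtNode (i + 1) e.dst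
  sanity : ∀ i, ∀ n ∈ w.nodes, ∀ n' ∈ w.nodes, n ≠ n' → ¬ (π.AtNode i n ∧ π.AtNode i n')
  init_node : π.AtNode 0 Workflow.entry ∧
    ∀ n ∈ w.nodes, n ≠ Workflow.entry → ¬ π.AtNode 0 n
  init_rel : ∀ R, π.rel 0 (.wf R) = ∅
  exec : ∀ i, ∀ e ∈ w.edges, π.AtNode i e.src → π.AtNode (i + 1) e.dst →
    ∀ R, R < S.wfRels.length → π.rel (i + 1) (.wf R) = π.post i e.label R

/-- At time `i` the low inputs of `a` are the same on both traces.
(Lists that are not tuples of the sorts in the arity are in neither relation.) -/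
def LowInputs (a : K.Elem) (i : ℕ) : Prop :=
  ∀ j, ∀ x : List K.Elem, a :: x ∈ π.rel i (.low j) ↔ a :: x ∈ π'.rel i (.low j)

/-- At time `i` the observations of `a` are the same on both traces. -/
def LowOutputs (a : K.Elem) (i : ℕ) : Prop :=
  ∀ R, ∀ x : List K.Elem, a :: x ∈ π.rel i (.wf R) ↔ a :: x ∈ π'.rel i (.wf R)

def Stubborn (a : K.Elem) : Prop := ∀ i, LowInputs π π' a i

/-- `LowInputs` holds weakly until `LowOutputs` fails. -/
def Causal (a : K.Elem) : Prop :=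
  (∃ j, ¬ LowOutputs π π' a j ∧ ∀ i < j, LowInputs π π' a i) ∨ ∀ i, LowInputs π π' a i

def SameCfg : Prop := ∀ i, ∀ n ∈ w.nodes, π.AtNode i n ↔ π'.AtNode i n

end Trace

/-- Declassification conditions: `φ[O][s]` is the condition for the high relation `O` and for agents
of sort `s`. Its free variables are the agent variable `a = ⟨s, 0⟩` and the variables
`y₁ = ⟨s₁, 1⟩, …, yₙ = ⟨sₙ, n⟩`, where `s₁, …, sₙ` is the arity of `O`. -/
abbrev Declassification : Type := List (List Formula)

namespace Declassification

def agentVar (s : ℕ) : Var := ⟨s, 0⟩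

def tupleVars (l : List ℕ) : List Var := l.mapIdx fun i s => ⟨s, i + 1⟩

/-- `φ.Cond O s ψ`: the condition for the relation `O` and agents of sort `s` is `ψ`. -/
def Cond (φ : Declassification) (O s : ℕ) (ψ : Formula) : Prop :=
  ∃ row, φ[O]? = some row ∧ row[s]? = some ψ

structure WellFormed (S : Signature) (w : Workflow) (φ : Declassification) : Prop where
  rows : φ.length = S.highRels.length
  cols : ∀ row ∈ φ, row.length = S.numAgentSorts
  sorted : ∀ O s ψ, φ.Cond O s ψ → ψ.WellSorted S (w.arity S)
  fv : ∀ O s ψ l, φ.Cond O s ψ → S.highRels[O]? = some l →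
    ∀ v ∈ ψ.fv, v = agentVar s ∨ v ∈ tupleVars l

/-- The negation normal form of the negation of each condition has no existential quantifier. -/
def NegationsUniversal (φ : Declassification) : Prop :=
  ∀ O s ψ, φ.Cond O s ψ → (ψ.nnf false).NoExists

end Declassification

/-- At all times, the high inputs that are declassified for `a` are the same on both traces. The
valuation `ν` supplies the tuple `ȳ`. -/
def Trace.HighInputs {K : Carrier S} (φ : Declassification) (π π' : Trace w K) (a : K.Elem) : Prop :=
  ∀ i O l ψ, S.highRels[O]? = some l → φ.Cond O a.1 ψ →
    ∀ ν : K.Valuation, ν (Declassification.agentVar a.1) = a.2 →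
      (π.sat ψ i ν ∨ π'.sat ψ i ν) →
      (((Declassification.tupleVars l).map fun v => (⟨v.sort, ν v⟩ : K.Elem)) ∈ π.rel i (.high O) ↔
        ((Declassification.tupleVars l).map fun v => (⟨v.sort, ν v⟩ : K.Elem)) ∈ π'.rel i (.high O))

/-- The agents are the elements of agent sorts. -/
abbrev Carrier.Agent (K : Carrier S) : Type := {a : K.Elem // a.1 < S.numAgentSorts}

/-- Non-interference with Declassification for at most `k` causal agents, all other agents
being stubborn. -/
def NonInterference (S : Signature) (w : Workflow) (φ : Declassification) (k : ℕ) : Prop :=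
  ∀ (K : Carrier S) (π π' : Trace w K), π.IsExecution → π'.IsExecution →
    (∃ c : Fin k → K.Agent, (∀ i, Trace.Causal π π' (c i).1) ∧
      ∀ a : K.Agent, (∀ i, a ≠ c i) → Trace.Stubborn π π' a.1) →
    Trace.SameCfg π π' →
    ∀ a : K.Agent,
      (∀ i, Trace.LowInputs π π' a.1 i) → Trace.HighInputs φ π π' a.1 →
      ∀ i, Trace.LowOutputs π π' a.1 i

/-! ### Input of algorithms: an explicit numbering -/

def Var.code (v : Var) : ℕ := Nat.pair v.sort v.idx

def Term.code : Term → ℕ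
  | .var v => Nat.pair 0 v.code
  | .const c => Nat.pair 1 c

def Pred.code : Pred → ℕ
  | .wf i => Nat.pair 0 i
  | .high i => Nat.pair 1 i
  | .low j => Nat.pair 2 j
  | .node n => Nat.pair 3 n

def Formula.code : Formula → ℕ
  | eq t t' => Nat.pair 0 (Nat.pair t.code t'.code)
  | rel P ts => Nat.pair 1 (Nat.pair P.code (Encodable.encode (ts.map Term.code)))
  | not φ => Nat.pair 2 φ.code
  | or φ ψ => Nat.pair 3 (Nat.pair φ.code ψ.code)
  | ex v φ => Nat.pair 4 (Nat.pair v.code φ.code)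
  | next φ => Nat.pair 5 φ.code
  | untl φ ψ => Nat.pair 6 (Nat.pair φ.code ψ.code)

def Stmt.code (st : Stmt) : ℕ :=
  Encodable.encode (st.guard.code, st.rel, st.add, st.args.map Term.code)

def Block.code (b : Block) : ℕ :=
  Encodable.encode (b.may, b.vars.map Var.code, b.stmts.map Stmt.code)

def Workflow.code : Workflow → ℕ
  | block b => Nat.pair 0 b.code
  | seq b w => Nat.pair 1 (Nat.pair b.code w.code)
  | loop w => Nat.pair 2 w.code
  | choice w w' => Nat.pair 3 (Nat.pair w.code w'.code)

def Signature.code (S : Signature) : ℕ :=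
  Encodable.encode (S.numAgentSorts, S.numDataSorts, S.constSorts, S.wfRels, S.highRels)

def Declassification.code (φ : Declassification) : ℕ :=
  Encodable.encode (List.map (List.map Formula.code) φ)

/-- The code of a signature, a workflow, declassification conditions and a number of causal agents. -/
def inputCode (S : Signature) (w : Workflow) (φ : Declassification) (k : ℕ) : ℕ :=
  Encodable.encode (S.code, w.code, φ.code, k)

theorem Var.code_injective : Function.Injective Var.code := by
  rintro ⟨a, b⟩ ⟨c, d⟩ h
  simpa [Var.code, Nat.pair_eq_pair] using h

theorem Term.code_injective : Function.Injective Term.code := by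
  rintro (v | c) (v' | c') h <;> simp [Term.code, Nat.pair_eq_pair] at h
  · rw [Var.code_injective h]
  · rw [h]

theorem Pred.code_injective : Function.Injective Pred.code := by
  rintro (a | a | a | a) (b | b | b | b) h <;> simp [Pred.code, Nat.pair_eq_pair] at h <;> rw [h]

theorem Formula.code_injective : Function.Injective Formula.code := by
  intro φ
  induction φ with
  | eq t t' =>
    rintro (_ | _ | _ | _ | _ | _ | _) h <;> simp [Formula.code, Nat.pair_eq_pair] at h
    rw [Term.code_injective h.1, Term.code_injective h.2]
  | rel P ts =>
    rintro (_ | _ | _ | _ | _ | _ | _) h <;> simp [Formula.code, Nat.pair_eq_pair] at h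
    rw [Pred.code_injective h.1, Term.code_injective.list_map h.2]
  | not φ ih =>
    rintro (_ | _ | _ | _ | _ | _ | _) h <;> simp [Formula.code, Nat.pair_eq_pair] at h
    rw [ih h]
  | or φ ψ ih ih' =>
    rintro (_ | _ | _ | _ | _ | _ | _) h <;> simp [Formula.code, Nat.pair_eq_pair] at h
    rw [ih h.1, ih' h.2]
  | ex v φ ih =>
    rintro (_ | _ | _ | _ | _ | _ | _) h <;> simp [Formula.code, Nat.pair_eq_pair] at h
    rw [Var.code_injective h.1, ih h.2]
  | next φ ih =>
    rintro (_ | _ | _ | _ | _ | _ | _) h <;> simp [Formula.code, Nat.pair_eq_pair] at h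
    rw [ih h]
  | untl φ ψ ih ih' =>
    rintro (_ | _ | _ | _ | _ | _ | _) h <;> simp [Formula.code, Nat.pair_eq_pair] at h
    rw [ih h.1, ih' h.2]

theorem Stmt.code_injective : Function.Injective Stmt.code := by
  rintro ⟨a, b, c, d⟩ ⟨a', b', c', d'⟩ h
  have h := Encodable.encode_injective h
  simp only [Prod.mk.injEq] at h
  obtain ⟨h1, rfl, rfl, h4⟩ := h
  rw [Formula.code_injective h1, Term.code_injective.list_map h4]

theorem Block.code_injective : Function.Injective Block.code := by
  rintro ⟨a, b, c⟩ ⟨a', b', c'⟩ h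
  have h := Encodable.encode_injective h
  simp only [Prod.mk.injEq] at h
  obtain ⟨rfl, h2, h3⟩ := h
  rw [Var.code_injective.list_map h2, Stmt.code_injective.list_map h3]

theorem Workflow.code_injective : Function.Injective Workflow.code := by
  intro w
  induction w with
  | block b =>
    rintro (_ | _ | _ | _) h <;> simp [Workflow.code, Nat.pair_eq_pair] at h
    rw [Block.code_injective h]
  | seq b w ih =>
    rintro (_ | _ | _ | _) h <;> simp [Workflow.code, Nat.pair_eq_pair] at h
    rw [Block.code_injective h.1, ih h.2]
  | loop w ih =>
    rintro (_ | _ | _ | _) h <;> simp [Workflow.code, Nat.pair_eq_pair] at h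
    rw [ih h]
  | choice w w' ih ih' =>
    rintro (_ | _ | _ | _) h <;> simp [Workflow.code, Nat.pair_eq_pair] at h
    rw [ih h.1, ih' h.2]

theorem Signature.code_injective : Function.Injective Signature.code := by
  rintro ⟨a, b, c, d, e⟩ ⟨a', b', c', d', e'⟩ h
  have h := Encodable.encode_injective h
  simp only [Prod.mk.injEq] at h
  obtain ⟨rfl, rfl, rfl, rfl, rfl⟩ := h
  rfl

/-- Different inputs have different codes. -/
theorem inputCode_injective {S S' : Signature} {w w' : Workflow} {φ φ' : Declassification} {k k' : ℕ}
    (h : inputCode S w φ k = inputCode S' w' φ' k') : S = S' ∧ w = w' ∧ φ = φ' ∧ k = k' := by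
  have h := Encodable.encode_injective h
  simp only [Prod.mk.injEq] at h
  exact ⟨Signature.code_injective h.1, Workflow.code_injective h.2.1,
    Formula.code_injective.list_map.list_map (Encodable.encode_injective h.2.2.1), h.2.2.2⟩

end MultiAgent

namespace MultiAgent

/-! ### Primitive recursive predicates -/

section PrimrecTools

variable {α β γ δ : Type} [Primcodable α] [Primcodable β] [Primcodable γ] [Primcodable δ]

-- With closure rules for pairs, lists, conditionals and bounded quantifiers registered, `fun_prop`
-- certifies each predicate of the search procedure directly from its definition.
attribute [fun_prop] Primrec PrimrecPred

/-! Non-interference is refuted by a pair of executions, and such a refutation survives restriction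
to a substructure of bounded size. From a counterexample keep the constants, the observer, the
causal agents, the other entries of one tuple on which the observer's two views differ, and, for
each causal agent whose low inputs do not agree forever, the other entries of one tuple whose
difference ends its obligation (`Trace.Violates.exists_witnesses`).

Everything else passes to the restricted traces `H.pull π` (`violates_pull`). In a non-omitting
workflow all variables of a block occur in each updated tuple; so if the tuple lies in the
substructure, the valuation causing the update does too on these variables, and quantifier-free
guards keep their truth value (`mem_updates_pull`). Hence restricted executions are executions.
Agreement of low inputs is a universal statement and is inherited by every remaining agent. A
declassification condition is existential apart from temporal operators, so if it holds in the
substructure it already held in the large structure, where it forces the high inputs to agree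
(`sat_pull_of_noExists`).

Over a fixed finite carrier a pair of traces is an infinite word over a finite alphabet, and the
tableau method for linear temporal logic applies. A state is a set of facts: truth values of the
relevant formulas under all valuations, the tuples in the relations, and a flag for each causal
agent that has seen a difference. The semantics becomes a local relation `Ctx.Trans` between
successive states, together with the demand that every until formula is eventually fulfilled. The
structure `Rep.Agrees` links traces and states; `violates_of_isRun` and `isRun_stateSeq` give the
two translations. As there are finitely many states, an infinite run exists iff there is a lasso
(`violation_iff_exists_isRun`).

Carrier size, codes and states are bounded by numbers computed from the input, so `HasViolation`
uses bounded quantifiers only and is primitive recursive; the algorithm answers its negation. The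
control flow graph is recomputed from the code of the workflow by a stack machine (`mem_edgesOf`).
-/

@[fun_prop] theorem primrec_id' : Primrec (fun x : α => x) := Primrec.id

@[fun_prop] theorem primrec_const' (c : β) : Primrec (fun _ : α => c) := Primrec.const c

@[fun_prop] theorem primrec_comp {f : β → γ} {g : α → β} (hf : Primrec f) (hg : Primrec g) :
    Primrec fun a => f (g a) := hf.comp hg

@[fun_prop] theorem primrec_fst {f : α → β × γ} (hf : Primrec f) : Primrec fun a => (f a).1 :=
  Primrec.fst.comp hf

@[fun_prop] theorem primrec_snd {f : α → β × γ} (hf : Primrec f) : Primrec fun a => (f a).2 :=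
  Primrec.snd.comp hf

@[fun_prop] theorem primrec_mk {f : α → β} {g : α → γ} (hf : Primrec f) (hg : Primrec g) :
    Primrec fun a => (f a, g a) := hf.pair hg

@[fun_prop] theorem primrec_add {f g : α → ℕ} (hf : Primrec f) (hg : Primrec g) :
    Primrec fun a => f a + g a := Primrec.nat_add.comp hf hg

@[fun_prop] theorem primrec_mul {f g : α → ℕ} (hf : Primrec f) (hg : Primrec g) :
    Primrec fun a => f a * g a := Primrec.nat_mul.comp hf hg

@[fun_prop] theorem primrec_sub {f g : α → ℕ} (hf : Primrec f) (hg : Primrec g) :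
    Primrec fun a => f a - g a := Primrec.nat_sub.comp hf hg

@[fun_prop] theorem primrec_natPair {f g : α → ℕ} (hf : Primrec f) (hg : Primrec g) :
    Primrec fun a => Nat.pair (f a) (g a) := Primrec₂.natPair.comp hf hg

@[fun_prop] theorem primrec_unpair {f : α → ℕ} (hf : Primrec f) :
    Primrec fun a => (f a).unpair := Primrec.unpair.comp hf

/-- The object with a given code, or a default value. -/
def decodeD (β : Type) [Primcodable β] [Inhabited β] (n : ℕ) : β :=
  (Encodable.decode n : Option β).getD default

@[simp] theorem decodeD_encode [Inhabited β] (x : β) : decodeD β (Encodable.encode x) = x := by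
  simp [decodeD]

@[fun_prop] theorem primrec_decodeD [Inhabited β] {f : α → ℕ} (hf : Primrec f) :
    Primrec fun a => decodeD β (f a) :=
  (Primrec.option_getD.comp Primrec.decode (Primrec.const default)).comp hf

@[fun_prop] theorem primrec_range {f : α → ℕ} (hf : Primrec f) :
    Primrec fun a => List.range (f a) := Primrec.list_range.comp hf

@[fun_prop] theorem primrec_length {f : α → List β} (hf : Primrec f) :
    Primrec fun a => (f a).length := Primrec.list_length.comp hf

@[fun_prop] theorem primrec_cons {f : α → β} {g : α → List β} (hf : Primrec f) (hg : Primrec g) :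
    Primrec fun a => f a :: g a := Primrec.list_cons.comp hf hg

@[fun_prop] theorem primrec_append {f g : α → List β} (hf : Primrec f) (hg : Primrec g) :
    Primrec fun a => f a ++ g a := Primrec.list_append.comp hf hg

@[fun_prop] theorem primrec_getD {f : α → List β} {g : α → ℕ} (hf : Primrec f) (hg : Primrec g)
    (d : β) : Primrec fun a => (f a).getD (g a) d := (Primrec.list_getD d).comp hf hg

@[fun_prop] theorem primrec_set {f : α → List β} {g : α → ℕ} {h : α → β} (hf : Primrec f)
    (hg : Primrec g) (hh : Primrec h) : Primrec fun a => (f a).set (g a) (h a) :=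
  Primrec.list_set.comp hf (hg.pair hh)

@[fun_prop] theorem primrec_map {f : α → List β} {g : α → β → γ} (hf : Primrec f)
    (hg : Primrec fun z : α × β => g z.1 z.2) : Primrec fun a => (f a).map (g a) :=
  Primrec.list_map hf hg

@[fun_prop] theorem primrec_flatMap {f : α → List β} {g : α → β → List γ} (hf : Primrec f)
    (hg : Primrec fun z : α × β => g z.1 z.2) : Primrec fun a => (f a).flatMap (g a) :=
  Primrec.list_flatMap hf hg

@[fun_prop] theorem primrec_foldr {f : α → List β} {g : α → γ} {h : α → β → γ → γ}
    (hf : Primrec f) (hg : Primrec g) (hh : Primrec fun z : α × β × γ => h z.1 z.2.1 z.2.2) :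
    Primrec fun a => (f a).foldr (h a) (g a) :=
  Primrec.list_foldr (h := fun a z => h a z.1 z.2) hf hg hh

@[fun_prop] theorem primrec_foldl {f : α → List β} {g : α → γ} {h : α → γ → β → γ}
    (hf : Primrec f) (hg : Primrec g) (hh : Primrec fun z : α × γ × β => h z.1 z.2.1 z.2.2) :
    Primrec fun a => (f a).foldl (h a) (g a) :=
  Primrec.list_foldl (h := fun a z => h a z.1 z.2) hf hg hh

@[fun_prop] theorem primrec_ite {p : α → Prop} [DecidablePred p] {f g : α → β}
    (hp : PrimrecPred p) (hf : Primrec f) (hg : Primrec g) :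
    Primrec fun a => if p a then f a else g a := Primrec.ite hp hf hg

@[fun_prop] theorem primrec_decide {p : α → Prop} [DecidablePred p] (hp : PrimrecPred p) :
    Primrec fun a => decide (p a) := hp.decide

@[fun_prop] theorem primrecPred_eq {f g : α → β} (hf : Primrec f) (hg : Primrec g) :
    PrimrecPred fun a => f a = g a := Primrec.eq.comp hf hg

@[fun_prop] theorem primrecPred_lt {f g : α → ℕ} (hf : Primrec f) (hg : Primrec g) :
    PrimrecPred fun a => f a < g a := Primrec.nat_lt.comp hf hg

@[fun_prop] theorem primrecPred_not {p : α → Prop} (hp : PrimrecPred p) :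
    PrimrecPred fun a => ¬ p a := hp.not

@[fun_prop] theorem primrecPred_ne {f g : α → β} (hf : Primrec f) (hg : Primrec g) :
    PrimrecPred fun a => f a ≠ g a := (primrecPred_eq hf hg).not

@[fun_prop] theorem primrecPred_and {p q : α → Prop} (hp : PrimrecPred p) (hq : PrimrecPred q) :
    PrimrecPred fun a => p a ∧ q a := hp.and hq

@[fun_prop] theorem primrecPred_or {p q : α → Prop} (hp : PrimrecPred p) (hq : PrimrecPred q) :
    PrimrecPred fun a => p a ∨ q a := hp.or hq

@[fun_prop] theorem primrecPred_imp {p q : α → Prop} (hp : PrimrecPred p) (hq : PrimrecPred q) :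
    PrimrecPred fun a => p a → q a :=
  (hp.not.or hq).of_eq fun _ => imp_iff_not_or.symm

@[fun_prop] theorem primrecPred_iff {p q : α → Prop} (hp : PrimrecPred p) (hq : PrimrecPred q) :
    PrimrecPred fun a => p a ↔ q a :=
  ((primrecPred_imp hp hq).and (primrecPred_imp hq hp)).of_eq fun _ => iff_def.symm

@[fun_prop] theorem primrecPred_exists_mem {f : α → List β} {p : α → β → Prop} (hf : Primrec f)
    (hp : PrimrecPred fun z : α × β => p z.1 z.2) : PrimrecPred fun a => ∃ y ∈ f a, p a y :=
  (PrimrecRel.exists_mem_list (R := fun (b : β) (a : α) => p a b)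
    (hp.comp (Primrec.snd.pair Primrec.fst))).comp hf Primrec.id

@[fun_prop] theorem primrecPred_forall_mem {f : α → List β} {p : α → β → Prop} (hf : Primrec f)
    (hp : PrimrecPred fun z : α × β => p z.1 z.2) : PrimrecPred fun a => ∀ y ∈ f a, p a y :=
  (PrimrecRel.forall_mem_list (R := fun (b : β) (a : α) => p a b)
    (hp.comp (Primrec.snd.pair Primrec.fst))).comp hf Primrec.id

@[fun_prop] theorem primrecPred_forall_lt {f : α → ℕ} {p : α → ℕ → Prop} (hf : Primrec f)
    (hp : PrimrecPred fun z : α × ℕ => p z.1 z.2) : PrimrecPred fun a => ∀ y < f a, p a y :=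
  (primrecPred_forall_mem (primrec_range hf) hp).of_eq fun a => by simp

@[fun_prop] theorem primrecPred_mem {f : α → β} {g : α → List β} (hf : Primrec f)
    (hg : Primrec g) : PrimrecPred fun a => f a ∈ g a :=
  (primrecPred_exists_mem (p := fun a y => y = f a) hg (by fun_prop)).of_eq fun a => by simp

@[fun_prop] theorem primrec_nat_rec {f : α → ℕ} {g : α → β} {h : α → ℕ → β → β}
    (hf : Primrec f) (hg : Primrec g) (hh : Primrec fun z : α × ℕ × β => h z.1 z.2.1 z.2.2) :
    Primrec fun a => (Nat.rec (g a) (h a) (f a) : β) :=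
  Primrec.nat_rec' (h := fun a z => h a z.1 z.2) hf hg hh

@[fun_prop] theorem primrec_iterate {f : α → ℕ} {g : α → β} {h : α → β → β}
    (hf : Primrec f) (hg : Primrec g) (hh : Primrec fun z : α × β => h z.1 z.2) :
    Primrec fun a => (h a)^[f a] (g a) :=
  Primrec.nat_iterate hf hg hh

@[fun_prop] theorem primrec_list_casesOn {f : α → List β} {g : α → γ} {h : α → β → List β → γ}
    (hf : Primrec f) (hg : Primrec g) (hh : Primrec fun z : α × β × List β => h z.1 z.2.1 z.2.2) :
    Primrec fun a => (List.casesOn (f a) (g a) (h a) : γ) :=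
  Primrec.list_casesOn (h := fun a z => h a z.1 z.2) hf hg hh

/-- The lists of length at most `m` over `l`. -/
def listsOver (l : List β) (m : ℕ) : List (List β) :=
  Nat.rec [[]] (fun _ r => [] :: r.flatMap fun x => l.map fun a => a :: x) m

omit [Primcodable β] in
theorem mem_listsOver {l : List β} {m : ℕ} {x : List β} :
    x ∈ listsOver l m ↔ x.length ≤ m ∧ ∀ a ∈ x, a ∈ l := by
  induction m generalizing x with
  | zero => cases x <;> simp [listsOver]
  | succ m ih =>
    have : listsOver l (m + 1) =
      [] :: (listsOver l m).flatMap fun x => l.map fun a => a :: x := rfl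
    rw [this]
    cases x with
    | nil => simp
    | cons b x =>
      simp only [List.mem_cons, reduceCtorEq, false_or, List.mem_flatMap, ih, List.mem_map,
        List.cons.injEq, List.length_cons, add_le_add_iff_right, forall_eq_or_imp]
      constructor
      · rintro ⟨y, ⟨h1, h2⟩, a, ha, rfl, rfl⟩
        exact ⟨h1, ha, h2⟩
      · rintro ⟨h1, ha, h2⟩
        exact ⟨x, ⟨h1, h2⟩, b, ha, rfl, rfl⟩

@[fun_prop] theorem primrec_listsOver {f : α → List β} {g : α → ℕ} (hf : Primrec f)
    (hg : Primrec g) : Primrec fun a => listsOver (f a) (g a) := by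
  unfold listsOver
  fun_prop

/-- The sublists of a list. -/
def sublistsOf (l : List β) : List (List β) :=
  l.foldr (fun a r => r ++ r.map fun x => a :: x) [[]]

omit [Primcodable β] in
theorem mem_sublistsOf {l x : List β} : x ∈ sublistsOf l ↔ x.Sublist l := by
  induction l generalizing x with
  | nil => simp [sublistsOf]
  | cons b l ih =>
    have : sublistsOf (b :: l) = sublistsOf l ++ (sublistsOf l).map fun x => b :: x := rfl
    simp only [this, List.mem_append, ih, List.mem_map, List.sublist_cons_iff]
    constructor
    · rintro (h | ⟨y, hy, rfl⟩)
      · exact Or.inl h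
      · exact Or.inr ⟨y, rfl, hy⟩
    · rintro (h | ⟨y, rfl, hy⟩)
      · exact Or.inl h
      · exact Or.inr ⟨y, hy, rfl⟩

@[fun_prop] theorem primrec_sublistsOf {f : α → List β} (hf : Primrec f) :
    Primrec fun a => sublistsOf (f a) := by
  unfold sublistsOf
  fun_prop

end PrimrecTools

end MultiAgent

namespace MultiAgent

/-! ### The finite search problem -/

/-- Possible facts about a pair of traces at some time. `(σ, f, ν)` with `σ < 2` says that the formula
with code `f` holds on trace `σ` for the valuation `ν`, `(σ + 2, P, x)` says that the tuple `x` is in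
the relation with code `P` on trace `σ`, and `(4, 0, [e])` says that the observations of the
agent `e` have already differed. -/
abbrev Fact : Type := ℕ × ℕ × List ℕ

/-- Pairs of structures are represented by the lists of their facts. -/
abbrev State : Type := List Fact

/-- The static data of the search: a signature, a control flow graph (with codes of blocks as
labels), declassification conditions, a bound `M` for codes, and a finite carrier
with a choice of agents. The element `d` of sort `s` is represented by `Nat.pair s d`. -/
structure Ctx where
  numAgent : ℕ
  consts : List ℕ
  wf : List (List ℕ)
  high : List (List ℕ)
  edges : List (ℕ × ℕ × ℕ × ℕ)
  cond : List (List ℕ)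
  k : ℕ
  M : ℕ
  elems : List ℕ
  forms : List ℕ
  cs : List ℕ
  ca : List ℕ
  ag : ℕ

namespace Ctx

/-- Transports the coding of nested products to `Ctx`; each field becomes a composition of
projections. -/
def equiv : Ctx ≃ ℕ × List ℕ × List (List ℕ) × List (List ℕ) × List (ℕ × ℕ × ℕ × ℕ) ×
    List (List ℕ) × ℕ × ℕ × List ℕ × List ℕ × List ℕ × List ℕ × ℕ where
  toFun c := (c.numAgent, c.consts, c.wf, c.high, c.edges, c.cond, c.k, c.M, c.elems, c.forms,
    c.cs, c.ca, c.ag)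
  invFun t := ⟨t.1, t.2.1, t.2.2.1, t.2.2.2.1, t.2.2.2.2.1, t.2.2.2.2.2.1, t.2.2.2.2.2.2.1,
    t.2.2.2.2.2.2.2.1, t.2.2.2.2.2.2.2.2.1, t.2.2.2.2.2.2.2.2.2.1, t.2.2.2.2.2.2.2.2.2.2.1,
    t.2.2.2.2.2.2.2.2.2.2.2.1, t.2.2.2.2.2.2.2.2.2.2.2.2⟩

instance : Primcodable Ctx := Primcodable.ofEquiv _ equiv

variable {α : Type} [Primcodable α]

theorem primrec_equiv : Primrec equiv := Primrec.of_equiv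

theorem primrec_field {β : Type} [Primcodable β] {g : Ctx → β}
    (h : Primrec fun t => g (equiv.symm t)) : Primrec g :=
  (h.comp primrec_equiv).of_eq fun c => by simp

@[fun_prop] theorem primrec_numAgent : Primrec numAgent :=
  primrec_field (by simp only [equiv, Equiv.coe_fn_symm_mk]; fun_prop)

@[fun_prop] theorem primrec_consts : Primrec consts :=
  primrec_field (by simp only [equiv, Equiv.coe_fn_symm_mk]; fun_prop)

@[fun_prop] theorem primrec_wf : Primrec wf :=
  primrec_field (by simp only [equiv, Equiv.coe_fn_symm_mk]; fun_prop)

@[fun_prop] theorem primrec_high : Primrec high :=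
  primrec_field (by simp only [equiv, Equiv.coe_fn_symm_mk]; fun_prop)

@[fun_prop] theorem primrec_edges : Primrec edges :=
  primrec_field (by simp only [equiv, Equiv.coe_fn_symm_mk]; fun_prop)

@[fun_prop] theorem primrec_cond : Primrec cond :=
  primrec_field (by simp only [equiv, Equiv.coe_fn_symm_mk]; fun_prop)

@[fun_prop] theorem primrec_k : Primrec k :=
  primrec_field (by simp only [equiv, Equiv.coe_fn_symm_mk]; fun_prop)

@[fun_prop] theorem primrec_M : Primrec M :=
  primrec_field (by simp only [equiv, Equiv.coe_fn_symm_mk]; fun_prop)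

@[fun_prop] theorem primrec_elems : Primrec elems :=
  primrec_field (by simp only [equiv, Equiv.coe_fn_symm_mk]; fun_prop)

@[fun_prop] theorem primrec_forms : Primrec forms :=
  primrec_field (by simp only [equiv, Equiv.coe_fn_symm_mk]; fun_prop)

@[fun_prop] theorem primrec_cs : Primrec cs :=
  primrec_field (by simp only [equiv, Equiv.coe_fn_symm_mk]; fun_prop)

@[fun_prop] theorem primrec_ca : Primrec ca :=
  primrec_field (by simp only [equiv, Equiv.coe_fn_symm_mk]; fun_prop)

@[fun_prop] theorem primrec_ag : Primrec ag :=
  primrec_field (by simp only [equiv, Equiv.coe_fn_symm_mk]; fun_prop)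

/-- The tuples that may occur in facts. -/
def lists (c : Ctx) : List (List ℕ) := listsOver c.elems c.M

@[fun_prop] theorem primrec_lists : Primrec lists := by
  unfold lists
  fun_prop

/-- Symbol and formula codes and tuple lengths are all bounded by the same `M`, which also leaves
room for valuations written as lists of length `M`. -/
def facts (c : Ctx) : List Fact :=
  (List.range 5).flatMap fun i => (List.range c.M).flatMap fun f => c.lists.map fun l => (i, f, l)

@[fun_prop] theorem primrec_facts : Primrec facts := by
  unfold facts
  fun_prop

/-- Sublists of one fixed list serve as sets of facts: filtering `facts` realises every subset. -/
def states (c : Ctx) : List State := sublistsOf c.facts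

@[fun_prop] theorem primrec_states : Primrec states := by
  unfold states
  fun_prop

def nodes (c : Ctx) : List ℕ := c.edges.flatMap fun e => [e.1, e.2.1]

@[fun_prop] theorem primrec_nodes : Primrec nodes := by
  unfold nodes
  fun_prop

/-- Lists that represent valuations: the position is the code of the variable. -/
def Valid (c : Ctx) (ν : List ℕ) : Prop :=
  ν.length = c.M ∧ ∀ v < c.M, (ν.getD v 0).unpair.1 = v.unpair.1

@[fun_prop] theorem primrecPred_valid {f : α → Ctx} {g : α → List ℕ} (hf : Primrec f)
    (hg : Primrec g) : PrimrecPred fun a => (f a).Valid (g a) := by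
  unfold Valid
  fun_prop

def termVal (c : Ctx) (ν : List ℕ) (t : ℕ) : ℕ :=
  if t.unpair.1 = 0 then ν.getD t.unpair.2 0 else c.cs.getD t.unpair.2 0

@[fun_prop] theorem primrec_termVal {f : α → Ctx} {g : α → List ℕ} {h : α → ℕ} (hf : Primrec f)
    (hg : Primrec g) (hh : Primrec h) : Primrec fun a => (f a).termVal (g a) (h a) := by
  unfold termVal
  fun_prop

/-- The truth of the formula `f` in the state `T` is as it should be, given the truth of the
immediate subformulas in `T` and in the next state `T'`. -/
def FormOK (c : Ctx) (T T' : State) (σ f : ℕ) (ν : List ℕ) : Prop :=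
  (f.unpair.1 = 0 → ((σ, f, ν) ∈ T ↔
    c.termVal ν f.unpair.2.unpair.1 = c.termVal ν f.unpair.2.unpair.2)) ∧
  (f.unpair.1 = 1 → ((σ, f, ν) ∈ T ↔ (σ + 2, f.unpair.2.unpair.1,
    (decodeD (List ℕ) f.unpair.2.unpair.2).map fun t => c.termVal ν t) ∈ T)) ∧
  (f.unpair.1 = 2 → ((σ, f, ν) ∈ T ↔ ¬ (σ, f.unpair.2, ν) ∈ T)) ∧
  (f.unpair.1 = 3 → ((σ, f, ν) ∈ T ↔
    ((σ, f.unpair.2.unpair.1, ν) ∈ T ∨ (σ, f.unpair.2.unpair.2, ν) ∈ T))) ∧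
  (f.unpair.1 = 4 → ((σ, f, ν) ∈ T ↔
    ∃ e ∈ c.elems, e.unpair.1 = f.unpair.2.unpair.1.unpair.1 ∧
      (σ, f.unpair.2.unpair.2, ν.set f.unpair.2.unpair.1 e) ∈ T)) ∧
  (f.unpair.1 = 5 → ((σ, f, ν) ∈ T ↔ (σ, f.unpair.2, ν) ∈ T')) ∧
  -- The unfolding law of until. It still permits postponing the fulfilment forever, which
  -- `IsRun.untl` excludes.
  (f.unpair.1 = 6 → ((σ, f, ν) ∈ T ↔ ((σ, f.unpair.2.unpair.2, ν) ∈ T ∨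
    ((σ, f.unpair.2.unpair.1, ν) ∈ T ∧ (σ, f, ν) ∈ T'))))

@[fun_prop] theorem primrecPred_formOK {f : α → Ctx} {T T' : α → State} {s g : α → ℕ}
    {h : α → List ℕ} (hf : Primrec f) (hT : Primrec T) (hT' : Primrec T') (hs : Primrec s)
    (hg : Primrec g) (hh : Primrec h) :
    PrimrecPred fun a => (f a).FormOK (T a) (T' a) (s a) (g a) (h a) := by
  unfold FormOK
  fun_prop

/-- The current node of the trace `σ` is `n`. -/
def At (σ n : ℕ) (T : State) : Prop := (σ + 2, Nat.pair 3 n, []) ∈ T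

@[fun_prop] theorem primrecPred_at {T : α → State} {s n : α → ℕ} (hs : Primrec s)
    (hn : Primrec n) (hT : Primrec T) : PrimrecPred fun a => At (s a) (n a) (T a) := by
  unfold At
  fun_prop

/-- The bounds on `j` and `x` lose nothing for members of `states`, whose facts obey them. -/
def Low (c : Ctx) (T : State) (a : ℕ) : Prop :=
  ∀ j < c.M, ∀ x ∈ c.lists, (2, Nat.pair 2 j, a :: x) ∈ T ↔ (3, Nat.pair 2 j, a :: x) ∈ T

@[fun_prop] theorem primrecPred_low {f : α → Ctx} {T : α → State} {s : α → ℕ} (hf : Primrec f)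
    (hT : Primrec T) (hs : Primrec s) : PrimrecPred fun a => (f a).Low (T a) (s a) := by
  unfold Low
  fun_prop

def Obs (c : Ctx) (T : State) (a : ℕ) : Prop :=
  ∀ R < c.M, ∀ x ∈ c.lists, (2, Nat.pair 0 R, a :: x) ∈ T ↔ (3, Nat.pair 0 R, a :: x) ∈ T

@[fun_prop] theorem primrecPred_obs {f : α → Ctx} {T : α → State} {s : α → ℕ} (hf : Primrec f)
    (hT : Primrec T) (hs : Primrec s) : PrimrecPred fun a => (f a).Obs (T a) (s a) := by
  unfold Obs
  fun_prop

/-- The high inputs that are declassified for the agent `c.ag` coincide. -/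
def HighOK (c : Ctx) (T : State) : Prop :=
  ∀ O < c.high.length, ∀ ν ∈ c.lists, c.Valid ν → ν.getD (Nat.pair c.ag.unpair.1 0) 0 = c.ag →
    ((0, (c.cond.getD O []).getD c.ag.unpair.1 0, ν) ∈ T ∨
      (1, (c.cond.getD O []).getD c.ag.unpair.1 0, ν) ∈ T) →
    ((2, Nat.pair 1 O, (List.range (c.high.getD O []).length).map fun i =>
        ν.getD (Nat.pair ((c.high.getD O []).getD i 0) (i + 1)) 0) ∈ T ↔
      (3, Nat.pair 1 O, (List.range (c.high.getD O []).length).map fun i =>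
        ν.getD (Nat.pair ((c.high.getD O []).getD i 0) (i + 1)) 0) ∈ T)

@[fun_prop] theorem primrecPred_highOK {f : α → Ctx} {T : α → State} (hf : Primrec f)
    (hT : Primrec T) : PrimrecPred fun a => (f a).HighOK (T a) := by
  unfold HighOK
  fun_prop

/-- The conditions on a single state. -/
def StateOK (c : Ctx) (T : State) : Prop :=
  -- Ill-sorted tuples are forbidden in workflow relations because `Obs` compares the raw facts; a
  -- spurious difference there would count as an observation.
  (∀ σ < 2, ∀ R < c.M, ∀ x ∈ c.lists, (σ + 2, Nat.pair 0 R, x) ∈ T →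
    R < c.wf.length ∧ c.wf.getD R [] = x.map fun e => e.unpair.1) ∧
  (∀ σ < 2, ∀ n ∈ c.nodes, ∀ n' ∈ c.nodes, n ≠ n' → ¬ (At σ n T ∧ At σ n' T)) ∧
  (∀ n ∈ c.nodes, At 0 n T ↔ At 1 n T) ∧
  (∀ e ∈ c.elems, e.unpair.1 < c.numAgent → ¬ e ∈ c.ca → c.Low T e) ∧
  -- Weak until: a causal agent is released from the time at which its observations first differ,
  -- that time included.
  (∀ e ∈ c.ca, (4, 0, [e]) ∈ T ∨ c.Low T e) ∧
  (c.HighOK T) ∧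
  (c.Low T c.ag)

@[fun_prop] theorem primrecPred_stateOK {f : α → Ctx} {T : α → State} (hf : Primrec f)
    (hT : Primrec T) : PrimrecPred fun a => (f a).StateOK (T a) := by
  unfold StateOK
  fun_prop

def Init (c : Ctx) (T : State) : Prop :=
  (∀ σ < 2, At σ Workflow.entry T ∧ ∀ n ∈ c.nodes, n ≠ Workflow.entry → ¬ At σ n T) ∧
  (∀ σ < 2, ∀ R < c.wf.length, ∀ x ∈ c.lists, ¬ (σ + 2, Nat.pair 0 R, x) ∈ T) ∧
  (∀ e ∈ c.ca, ¬ (4, 0, [e]) ∈ T)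

@[fun_prop] theorem primrecPred_init {f : α → Ctx} {T : α → State} (hf : Primrec f)
    (hT : Primrec T) : PrimrecPred fun a => (f a).Init (T a) := by
  unfold Init
  fun_prop

/-- The type of decoded blocks: the codes of the variables and of the statements are kept. -/
abbrev BlockCode : Type := Bool × List ℕ × List ℕ

/-- The type of decoded statements: the codes of the guard and of the terms are kept. -/
abbrev StmtCode : Type := ℕ × ℕ × Bool × List ℕ

def Upd (c : Ctx) (T : State) (σ j : ℕ) (b : BlockCode) (st : StmtCode) (y : List ℕ) : Prop :=
  ∃ ν ∈ c.lists, c.Valid ν ∧ (σ, st.1, ν) ∈ T ∧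
    (b.1 = true → (σ + 2, Nat.pair 2 j, b.2.1.map fun v => ν.getD v 0) ∈ T) ∧
    y = st.2.2.2.map fun t => c.termVal ν t

@[fun_prop] theorem primrecPred_upd {f : α → Ctx} {T : α → State} {s j : α → ℕ}
    {b : α → BlockCode} {st : α → StmtCode} {y : α → List ℕ} (hf : Primrec f) (hT : Primrec T)
    (hs : Primrec s) (hj : Primrec j) (hb : Primrec b) (hst : Primrec st) (hy : Primrec y) :
    PrimrecPred fun a => (f a).Upd (T a) (s a) (j a) (b a) (st a) (y a) := by
  unfold Upd
  fun_prop

open Classical in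
/-- `y` is in the workflow relation `R` after executing the edge `e` in state `T`. -/
noncomputable def postB (c : Ctx) (T : State) (σ : ℕ) (e : ℕ × ℕ × ℕ × ℕ) (R : ℕ) (y : List ℕ) :
    Bool :=
  if e.2.2.1 = 0 then decide ((σ + 2, Nat.pair 0 R, y) ∈ T) else
    (decodeD BlockCode e.2.2.2).2.2.foldl
      (fun acc s =>
        if (decodeD StmtCode s).2.1 = R then
          if (decodeD StmtCode s).2.2.1 = true then
            decide (acc = true ∨
              c.Upd T σ (e.2.2.1 - 1) (decodeD BlockCode e.2.2.2) (decodeD StmtCode s) y)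
          else decide (acc = true ∧
            ¬ c.Upd T σ (e.2.2.1 - 1) (decodeD BlockCode e.2.2.2) (decodeD StmtCode s) y)
        else acc)
      (decide ((σ + 2, Nat.pair 0 R, y) ∈ T))

@[fun_prop] theorem primrec_postB {f : α → Ctx} {T : α → State} {s R : α → ℕ}
    {e : α → ℕ × ℕ × ℕ × ℕ} {y : α → List ℕ} (hf : Primrec f) (hT : Primrec T)
    (hs : Primrec s) (he : Primrec e) (hR : Primrec R) (hy : Primrec y) :
    Primrec fun a => (f a).postB (T a) (s a) (e a) (R a) (y a) := by
  unfold postB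
  fun_prop

/-- `T'` may follow on `T`. -/
def Trans (c : Ctx) (T T' : State) : Prop :=
  (c.StateOK T) ∧
  (∀ σ < 2, ∀ f ∈ c.forms, ∀ ν ∈ c.lists, c.Valid ν → c.FormOK T T' σ f ν) ∧
  (∀ σ < 2, ∀ n ∈ c.nodes, At σ n T → ∃ e ∈ c.edges, e.1 = n ∧ At σ e.2.1 T') ∧
  (∀ σ < 2, ∀ e ∈ c.edges, At σ e.1 T → At σ e.2.1 T' → ∀ R < c.wf.length,
    ∀ y ∈ c.lists, (σ + 2, Nat.pair 0 R, y) ∈ T' ↔ c.postB T σ e R y = true) ∧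
  -- One direction suffices: a flag needs a difference as justification, whereas leaving it unset
  -- only makes the demand on low inputs stricter.
  (∀ e ∈ c.ca, (4, 0, [e]) ∈ T' → (4, 0, [e]) ∈ T ∨ ¬ c.Obs T' e)

@[fun_prop] theorem primrecPred_trans {f : α → Ctx} {T T' : α → State} (hf : Primrec f)
    (hT : Primrec T) (hT' : Primrec T') : PrimrecPred fun a => (f a).Trans (T a) (T' a) := by
  unfold Trans
  fun_prop

/-- The requirements on the carrier and the choice of formulas and agents. -/
def Good (c : Ctx) : Prop :=
  -- The default element `0` of each universe must be listed, so that quantifiers over `elems` reach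
  -- whole universes of sorts below `M`.
  (∀ s < c.M, Nat.pair s 0 ∈ c.elems) ∧
  (∀ f ∈ c.forms,
    (f.unpair.1 = 2 ∨ f.unpair.1 = 5 → f.unpair.2 ∈ c.forms) ∧
    (f.unpair.1 = 3 ∨ f.unpair.1 = 6 →
      f.unpair.2.unpair.1 ∈ c.forms ∧ f.unpair.2.unpair.2 ∈ c.forms) ∧
    (f.unpair.1 = 4 → f.unpair.2.unpair.2 ∈ c.forms)) ∧
  (∀ e ∈ c.edges, e.2.2.1 ≠ 0 → ∀ s ∈ (decodeD BlockCode e.2.2.2).2.2,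
    (decodeD StmtCode s).1 ∈ c.forms) ∧
  (∀ row ∈ c.cond, ∀ f ∈ row, f ∈ c.forms) ∧
  (∀ i < c.consts.length, c.cs.getD i 0 ∈ c.elems ∧
    (c.cs.getD i 0).unpair.1 = c.consts.getD i 0) ∧
  (c.ca.length = c.k ∧ ∀ e ∈ c.ca, e ∈ c.elems ∧ e.unpair.1 < c.numAgent) ∧
  (c.ag ∈ c.elems ∧ c.ag.unpair.1 < c.numAgent)

@[fun_prop] theorem primrecPred_good {f : α → Ctx} (hf : Primrec f) :
    PrimrecPred fun a => (f a).Good := by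
  unfold Good
  fun_prop

/-- `u` states that an until formula holds. -/
def IsUntil (c : Ctx) (u : Fact) : Prop :=
  u.1 < 2 ∧ u.2.1 ∈ c.forms ∧ u.2.1.unpair.1 = 6 ∧ u.2.2 ∈ c.lists ∧ c.Valid u.2.2

@[fun_prop] theorem primrecPred_isUntil {f : α → Ctx} {g : α → Fact} (hf : Primrec f)
    (hg : Primrec g) : PrimrecPred fun a => (f a).IsUntil (g a) := by
  unfold IsUntil
  fun_prop

/-- The fact that fulfils an until formula. -/
def goal (u : Fact) : Fact := (u.1, u.2.1.unpair.2.unpair.2, u.2.2)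

@[fun_prop] theorem primrec_goal {g : α → Fact} (hg : Primrec g) :
    Primrec fun a => goal (g a) := by
  unfold goal
  fun_prop

/-- `t'` can be reached from `t`. -/
def Reach (c : Ctx) (t t' : State) : Prop :=
  -- Membership in every closed set containing `t` replaces the search for a path, so that only
  -- bounded quantifiers occur.
  ∀ Y ∈ sublistsOf c.states, t ∈ Y →
    (∀ x ∈ Y, ∀ y ∈ c.states, c.Trans x y → y ∈ Y) → t' ∈ Y

@[fun_prop] theorem primrecPred_reach {f : α → Ctx} {T T' : α → State} (hf : Primrec f)
    (hT : Primrec T) (hT' : Primrec T') : PrimrecPred fun a => (f a).Reach (T a) (T' a) := by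
  unfold Reach
  fun_prop

/-- There is a lasso-shaped sequence of states which violates non-interference. -/
def Violation (c : Ctx) : Prop :=
  ∃ t₀ ∈ c.states, ∃ t₁ ∈ c.states, ∃ t ∈ c.states,
    c.Init t₀ ∧ c.Reach t₀ t₁ ∧ ¬ c.Obs t₁ c.ag ∧ c.Reach t₁ t ∧
    (∃ s ∈ c.states, c.Trans t s ∧ c.Reach s t) ∧
    -- Checking the untils that hold in `t` is enough: an until that is never fulfilled stays in all
    -- later states and so turns up in `t`. Fulfilling states must lie on a cycle through `t`.
    ∀ u ∈ t, c.IsUntil u → ∃ s ∈ c.states, goal u ∈ s ∧ c.Reach t s ∧ c.Reach s t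

@[fun_prop] theorem primrecPred_violation {f : α → Ctx} (hf : Primrec f) :
    PrimrecPred fun a => (f a).Violation := by
  unfold Violation
  fun_prop

end Ctx

end MultiAgent

namespace MultiAgent

/-! ### Lassos in finite transition systems -/

section Lasso

variable {α : Type} {r : α → α → Prop}

/-- `p` is a path of length `n` from `a` to `b`. -/
def IsPath (r : α → α → Prop) (p : ℕ → α) (n : ℕ) (a b : α) : Prop :=
  p 0 = a ∧ p n = b ∧ ∀ i < n, r (p i) (p (i + 1))

theorem IsPath.append {p q : ℕ → α} {n m : ℕ} {a b c : α} (hp : IsPath r p n a b)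
    (hq : IsPath r q m b c) :
    ∃ w, IsPath r w (n + m) a c ∧ (∀ i ≤ n, w i = p i) ∧ ∀ i, w (n + i) = q i := by
  obtain ⟨hp0, hpn, hp⟩ := hp
  obtain ⟨hq0, hqm, hq⟩ := hq
  have h1 : ∀ i ≤ n, (if i < n then p i else q (i - n)) = p i := by
    intro i hi
    rcases hi.lt_or_eq with h | rfl
    · simp [h]
    · simp [hq0, hpn]
  have h2 : ∀ i, (if n + i < n then p (n + i) else q (n + i - n)) = q i := by
    intro i
    simp
  refine ⟨fun i => if i < n then p i else q (i - n), ⟨?_, ?_, ?_⟩, h1, h2⟩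
  · rw [← hp0]
    exact h1 0 (Nat.zero_le _)
  · rw [← hqm]
    exact h2 m
  · intro i hi
    by_cases h : i < n
    · have := hp i h
      rw [← h1 i h.le, ← h1 (i + 1) h] at this
      exact this
    · obtain ⟨k, rfl⟩ := Nat.exists_eq_add_of_le (not_lt.mp h)
      have := hq k (by omega)
      rw [← h2 k, ← h2 (k + 1)] at this
      exact this

theorem exists_isPath {a b : α} (h : Relation.ReflTransGen r a b) : ∃ p n, IsPath r p n a b := by
  induction h with
  | refl => exact ⟨fun _ => a, 0, rfl, rfl, by simp⟩
  | @tail b c _ hbc ih =>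
    obtain ⟨p, n, hp⟩ := ih
    obtain ⟨w, hw, -⟩ := hp.append (q := fun i => if i = 0 then b else c) (m := 1) (c := c)
      ⟨rfl, rfl, by simpa using hbc⟩
    exact ⟨w, _, hw⟩

/-- Concatenate round trips from `t` to each listed state and back; the initial step `h₀` makes the
cycle nonempty even for an empty list. -/
theorem exists_cycle {t s₀ : α} (h₀ : r t s₀) (h₁ : Relation.ReflTransGen r s₀ t) (l : List α)
    (hl : ∀ s ∈ l, Relation.ReflTransGen r t s ∧ Relation.ReflTransGen r s t) :
    ∃ p n, 0 < n ∧ IsPath r p n t t ∧ ∀ s ∈ l, ∃ i ≤ n, p i = s := by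
  induction l with
  | nil =>
    obtain ⟨p, n, hp⟩ := exists_isPath h₁
    obtain ⟨w, hw, -⟩ := IsPath.append (p := fun i => if i = 0 then t else s₀) (n := 1)
      (a := t) ⟨rfl, rfl, by simpa using h₀⟩ hp
    exact ⟨w, _, by omega, hw, by simp⟩
  | cons s l ih =>
    obtain ⟨p, n, hn, hp, hpl⟩ := ih fun x hx => hl x (List.mem_cons_of_mem _ hx)
    obtain ⟨h2, h3⟩ := hl s List.mem_cons_self
    obtain ⟨p2, n2, hp2⟩ := exists_isPath h2
    obtain ⟨p3, n3, hp3⟩ := exists_isPath h3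
    obtain ⟨w, hw, hw1, hw2⟩ := hp.append hp2
    obtain ⟨w', hw', hw1', hw2'⟩ := hw.append hp3
    refine ⟨w', _, by omega, hw', ?_⟩
    rintro x hx
    rcases List.mem_cons.mp hx with rfl | hx
    · exact ⟨n + n2, by omega, (hw1' _ le_rfl).trans hw.2.1⟩
    · obtain ⟨i, hi, rfl⟩ := hpl x hx
      exact ⟨i, by omega, (hw1' _ (by omega)).trans (hw1 _ hi)⟩

/-- Walk from `t₀` through `t₁` to `t`, then repeat forever one cycle that visits all of `l`;
indices beyond the stem are read modulo the length of the cycle. -/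
theorem exists_run {t₀ t₁ t s₀ : α} (h01 : Relation.ReflTransGen r t₀ t₁)
    (h1 : Relation.ReflTransGen r t₁ t) (hs : r t s₀) (hst : Relation.ReflTransGen r s₀ t)
    (l : List α)
    (hl : ∀ s ∈ l, Relation.ReflTransGen r t s ∧ Relation.ReflTransGen r s t) :
    ∃ q : ℕ → α, q 0 = t₀ ∧ (∀ i, r (q i) (q (i + 1))) ∧ (∃ i, q i = t₁) ∧
      (∀ i, ∃ j ≥ i, q j = t) ∧ ∀ i, ∀ s ∈ l, ∃ j ≥ i, q j = s := by
  obtain ⟨p, n, hn, hp, hpl⟩ := exists_cycle hs hst l hl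
  obtain ⟨a, k, ha⟩ := exists_isPath h01
  obtain ⟨b, m, hb⟩ := exists_isPath h1
  obtain ⟨w, hw, hwa, -⟩ := ha.append hb
  have hper : ∀ j ≤ n, ∀ c, p ((n * c + j) % n) = p j := by
    intro j hj c
    rcases hj.lt_or_eq with h | rfl
    · simp [Nat.mod_eq_of_lt h]
    · simp [hp.1, hp.2.1]
  set N := k + m with hN
  have q1 : ∀ i ≤ N, (if i < N then w i else p ((i - N) % n)) = w i := by
    intro i hi
    rcases hi.lt_or_eq with h | rfl
    · simp [h]
    · simp [hw.2.1, hp.1]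
  -- The case `j = n` is included, since the cycle starts and ends in `t`; the step across the seam
  -- needs it.
  have q2 : ∀ c, ∀ j ≤ n, (if N + (n * c + j) < N then w (N + (n * c + j))
      else p ((N + (n * c + j) - N) % n)) = p j := by
    intro c j hj
    simpa using hper j hj c
  have hvisit : ∀ i, ∀ j ≤ n, ∃ j' ≥ i, (if j' < N then w j' else p ((j' - N) % n)) = p j := by
    intro i j hj
    refine ⟨N + (n * i + j), ?_, q2 i j hj⟩
    have : i ≤ n * i := Nat.le_mul_of_pos_left _ hn
    omega
  refine ⟨fun i => if i < N then w i else p ((i - N) % n), ?_, ?_, ⟨k, ?_⟩, ?_, ?_⟩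
  · exact (q1 0 (Nat.zero_le _)).trans hw.1
  · intro i
    by_cases h : i < N
    · have := hw.2.2 i h
      rw [← q1 i h.le, ← q1 (i + 1) h] at this
      exact this
    · obtain ⟨d, rfl⟩ := Nat.exists_eq_add_of_le (not_lt.mp h)
      have hd := Nat.div_add_mod d n
      have hlt := Nat.mod_lt d hn
      have := hp.2.2 _ hlt
      rw [← q2 (d / n) _ hlt.le, ← q2 (d / n) (d % n + 1) hlt, ← add_assoc (n * (d / n)), hd,
        ← add_assoc] at this
      exact this
  · exact (q1 k (by omega)).trans ((hwa k le_rfl).trans ha.2.1)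
  · intro i
    obtain ⟨j, hj, h⟩ := hvisit i 0 (Nat.zero_le _)
    exact ⟨j, hj, h.trans hp.1⟩
  · intro i s hsl
    obtain ⟨j, hj, rfl⟩ := hpl s hsl
    exact hvisit i j hj

/-- Infinite pigeonhole principle. -/
theorem exists_recurrent {q : ℕ → α} {V : List α} (hq : ∀ i, q i ∈ V) :
    ∃ t ∈ V, ∀ i, ∃ j > i, q j = t := by
  have : Finite {x // x ∈ V} := V.finite_toSet
  obtain ⟨⟨t, ht⟩, h⟩ := Finite.exists_infinite_fiber fun i => (⟨q i, hq i⟩ : {x // x ∈ V})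
  refine ⟨t, ht, fun i => ?_⟩
  obtain ⟨j, hj, hij⟩ := (Set.infinite_coe_iff.mp h).exists_gt i
  exact ⟨j, hij, congrArg Subtype.val hj⟩

theorem reflTransGen_of_le {q : ℕ → α} (hq : ∀ i, r (q i) (q (i + 1))) {i j : ℕ} (h : i ≤ j) :
    Relation.ReflTransGen r (q i) (q j) := by
  induction h with
  | refl => exact .refl
  | step _ ih => exact ih.tail (hq _)

end Lasso

namespace Ctx

variable {c : Ctx}

def Next (c : Ctx) (t t' : State) : Prop := t' ∈ c.states ∧ c.Trans t t'

/-- The states reachable from `t` themselves form a closed set, and conversely a closed set cannot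
be left along transitions. -/
theorem reach_iff {t t' : State} (ht : t ∈ c.states) :
    c.Reach t t' ↔ Relation.ReflTransGen c.Next t t' := by
  classical
  constructor
  · intro h
    have := h (c.states.filter fun x => Relation.ReflTransGen c.Next t x)
      (mem_sublistsOf.mpr List.filter_sublist) (by simp [ht, Relation.ReflTransGen.refl])
      (by
        intro x hx y hy hxy
        simp only [List.mem_filter, decide_eq_true_eq] at hx ⊢
        exact ⟨hy, hx.2.tail ⟨hy, hxy⟩⟩)
    simpa using (List.mem_filter.mp this).2
  · intro h Y _ htY hY
    induction h with
    | refl => exact htY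
    | tail _ hbc ih => exact hY _ ih _ hbc.1 hbc.2

/-- An infinite sequence of states which violates non-interference. -/
structure IsRun (c : Ctx) (q : ℕ → State) : Prop where
  mem : ∀ i, q i ∈ c.states
  init : c.Init (q 0)
  trans : ∀ i, c.Trans (q i) (q (i + 1))
  obs : ∃ i, ¬ c.Obs (q i) c.ag
  untl : ∀ i, ∀ u ∈ q i, c.IsUntil u → ∃ j ≥ i, goal u ∈ q j

theorem Trans.untl {t t' : State} (h : c.Trans t t') {u : Fact} (hu : c.IsUntil u) (hut : u ∈ t) :
    goal u ∈ t ∨ u ∈ t' := by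
  obtain ⟨σ, f, ν⟩ := u
  have h1 := (h.2.1 σ hu.1 f hu.2.1 ν hu.2.2.2.1 hu.2.2.2.2).2.2.2.2.2.2 hu.2.2.1
  rcases h1.mp hut with h | h
  · exact Or.inl h
  · exact Or.inr h.2

/-- A lasso unrolls to a run that visits all states strongly connected to `t` infinitely often.
Conversely, a run over finitely many states has a recurrent state, which serves as the base of the
cycle; choosing an occurrence after the observed difference places that difference on the stem. -/
theorem violation_iff_exists_isRun : c.Violation ↔ ∃ q, c.IsRun q := by
  classical
  constructor
  · rintro ⟨t₀, ht₀, t₁, ht₁, t, ht, h0, h01, h1, h1t, ⟨s, hs, hts, hst⟩, hu⟩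
    rw [reach_iff ht₀] at h01
    rw [reach_iff ht₁] at h1t
    rw [reach_iff hs] at hst
    obtain ⟨q, q0, hq, ⟨i₁, hq1⟩, hqt, hql⟩ := exists_run h01 h1t ⟨hs, hts⟩ hst
      (c.states.filter fun s => c.Reach t s ∧ c.Reach s t) (by
        intro s hs
        simp only [Bool.decide_and, List.mem_filter, Bool.and_eq_true, decide_eq_true_eq] at hs
        exact ⟨(reach_iff ht).mp hs.2.1, (reach_iff hs.1).mp hs.2.2⟩)
    refine ⟨q, ?_, q0 ▸ h0, fun i => (hq i).2, ⟨i₁, hq1 ▸ h1⟩, ?_⟩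
    · intro i
      cases i with
      | zero => exact q0 ▸ ht₀
      | succ i => exact (hq i).1
    · intro i u hui huu
      by_contra! hcon
      -- An unfulfilled until persists, hence is still pending at the next visit to `t`, and the
      -- cycle then fulfils it.
      have hall : ∀ j ≥ i, u ∈ q j := by
        intro j hj
        induction j, hj using Nat.le_induction with
        | base => exact hui
        | succ j hj ih => exact ((hq j).2.untl huu ih).resolve_left (hcon j hj)
      obtain ⟨j, hj, rfl⟩ := hqt i
      obtain ⟨s, hs, hg, h1, h2⟩ := hu u (hall j hj) huu
      obtain ⟨j', hj', rfl⟩ := hql i s (by simp [hs, h1, h2])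
      exact hcon j' hj' hg
  · rintro ⟨q, hq⟩
    obtain ⟨t, ht, hrec⟩ := exists_recurrent hq.mem
    have hn : ∀ i, c.Next (q i) (q (i + 1)) := fun i => ⟨hq.mem _, hq.trans i⟩
    have hr : ∀ {i j}, i ≤ j → c.Reach (q i) (q j) := fun h =>
      (reach_iff (hq.mem _)).mpr (reflTransGen_of_le hn h)
    obtain ⟨i₁, h1⟩ := hq.obs
    obtain ⟨i, hi, rfl⟩ := hrec i₁
    refine ⟨q 0, hq.mem _, q i₁, hq.mem _, q i, ht, hq.init, hr (Nat.zero_le _), h1, hr hi.le,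
      ⟨q (i + 1), hq.mem _, hq.trans i, ?_⟩, ?_⟩
    · obtain ⟨j, hj, h⟩ := hrec i
      rw [← h]
      exact hr hj
    · intro u hu huu
      obtain ⟨j, hj, hg⟩ := hq.untl i u hu huu
      refine ⟨q j, hq.mem _, hg, hr hj, ?_⟩
      obtain ⟨j', hj', h⟩ := hrec j
      rw [← h]
      exact hr hj'.le

end Ctx

end MultiAgent

namespace MultiAgent

/-! ### Computing the control flow graph -/

/-- The representation of an edge by numbers: `0` for an edge labelled `id`, and `j + 1` for
the block number `j`. -/
def Workflow.Edge.toNat (e : Workflow.Edge) : ℕ × ℕ × ℕ × ℕ :=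
  (e.src, e.dst, e.label.elim 0 fun l => l.1 + 1, e.label.elim 0 fun l => l.2.code)

/-- The state of the machine that computes the control flow graph: a stack of workflow codes
with their start and end nodes, the next node, the next block number, and the edges so far. -/
abbrev BuildState : Type := List (ℕ × ℕ × ℕ) × ℕ × ℕ × List (ℕ × ℕ × ℕ × ℕ)

/-- The machine processes the workflow with code `c` between the nodes `s` and `t`. -/
def buildTop (c s t : ℕ) (rest : List (ℕ × ℕ × ℕ)) (m j : ℕ) (out : List (ℕ × ℕ × ℕ × ℕ)) :
    BuildState :=
  if c.unpair.1 = 0 then (rest, m, j + 1, (s, t, j + 1, c.unpair.2) :: out)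
  else if c.unpair.1 = 1 then
    ((c.unpair.2.unpair.2, m, t) :: rest, m + 1, j + 1,
      (s, m, j + 1, c.unpair.2.unpair.1) :: out)
  else if c.unpair.1 = 2 then
    if s = t then ((c.unpair.2, m, m) :: rest, m + 1, j, (s, m, 0, 0) :: (m, s, 0, 0) :: out)
    else ((c.unpair.2, s, s) :: rest, m, j, (s, t, 0, 0) :: out)
  else ((c.unpair.2.unpair.1, m, t) :: (c.unpair.2.unpair.2, m + 1, t) :: rest, m + 2, j,
    (s, m, 0, 0) :: (s, m + 1, 0, 0) :: out)

def buildStep (x : BuildState) : BuildState :=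
  if x.1.length = 0 then x
  else buildTop (x.1.getD 0 (0, 0, 0)).1 (x.1.getD 0 (0, 0, 0)).2.1 (x.1.getD 0 (0, 0, 0)).2.2
    x.1.tail x.2.1 x.2.2.1 x.2.2.2

@[fun_prop] theorem primrec_tail {α β : Type} [Primcodable α] [Primcodable β] {f : α → List β}
    (hf : Primrec f) : Primrec fun a => (f a).tail :=
  Primrec.list_tail.comp hf

theorem primrec_buildStep : Primrec buildStep := by
  unfold buildStep buildTop
  fun_prop

theorem buildStep_cons (c s t : ℕ) (rest : List (ℕ × ℕ × ℕ)) (m j : ℕ)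
    (out : List (ℕ × ℕ × ℕ × ℕ)) :
    buildStep ((c, s, t) :: rest, m, j, out) = buildTop c s t rest m j out := by
  simp [buildStep]

/-- One machine step per constructor of the workflow. Stack remainder and output stay arbitrary so
that the induction applies to subworkflows. The number of steps is bounded by the code because
`Nat.pair` dominates the sum of its arguments, and the constructor tags pay for the extra steps. -/
theorem exists_iterate_buildStep (w : Workflow) :
    ∃ q ≤ w.code + 1, ∀ s t m j rest out, ∃ out',
      buildStep^[q] ((w.code, s, t) :: rest, m, j, out) =
        (rest, (w.build s t m j).2.1, (w.build s t m j).2.2, out') ∧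
      ∀ e, e ∈ out' ↔ e ∈ out ∨ ∃ e' ∈ (w.build s t m j).1, e'.toNat = e := by
  induction w with
  | block b =>
    refine ⟨1, by omega, fun s t m j rest out => ⟨(s, t, j + 1, b.code) :: out, ?_, ?_⟩⟩
    · rw [Function.iterate_one, buildStep_cons, Workflow.code, buildTop, if_pos (by simp)]
      simp [Workflow.build]
    · simp [Workflow.build, Workflow.Edge.toNat, or_comm, eq_comm]
  | seq b w ih =>
    obtain ⟨q, hq, h⟩ := ih
    have hle : w.code + 1 + 1 ≤ (Workflow.seq b w).code + 1 := by
      have h1 := Nat.add_le_pair 1 (Nat.pair b.code w.code)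
      have h2 := Nat.right_le_pair b.code w.code
      simp only [Workflow.code]
      omega
    refine ⟨q + 1, by omega, fun s t m j rest out => ?_⟩
    obtain ⟨out', h1, h2⟩ := h m t (m + 1) (j + 1) rest ((s, m, j + 1, b.code) :: out)
    refine ⟨out', ?_, ?_⟩
    · rw [Function.iterate_succ_apply, buildStep_cons, Workflow.code, buildTop,
        if_neg (by simp), if_pos (by simp)]
      simpa [Workflow.build] using h1
    · intro e
      rw [h2]
      simp only [Workflow.build, List.mem_cons, exists_eq_or_imp, Workflow.Edge.toNat,
        Option.elim_some, eq_comm (a := e)]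
      tauto
  | loop w ih =>
    obtain ⟨q, hq, h⟩ := ih
    have hle : w.code + 1 + 1 ≤ (Workflow.loop w).code + 1 := by
      have h1 := Nat.add_le_pair 2 w.code
      simp only [Workflow.code]
      omega
    refine ⟨q + 1, by omega, fun s t m j rest out => ?_⟩
    by_cases hst : s = t
    · obtain ⟨out', h1, h2⟩ := h m m (m + 1) j rest ((s, m, 0, 0) :: (m, s, 0, 0) :: out)
      refine ⟨out', ?_, ?_⟩
      · rw [Function.iterate_succ_apply, buildStep_cons, Workflow.code, buildTop,
          if_neg (by simp), if_neg (by simp), if_pos (by simp), if_pos hst]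
        simpa [Workflow.build, hst] using h1
      · intro e
        rw [h2]
        simp only [Workflow.build, hst, if_true, List.mem_cons, exists_eq_or_imp,
          Workflow.Edge.toNat, Option.elim_none, eq_comm (a := e)]
        tauto
    · obtain ⟨out', h1, h2⟩ := h s s m j rest ((s, t, 0, 0) :: out)
      refine ⟨out', ?_, ?_⟩
      · rw [Function.iterate_succ_apply, buildStep_cons, Workflow.code, buildTop,
          if_neg (by simp), if_neg (by simp), if_pos (by simp), if_neg hst]
        simpa [Workflow.build, hst] using h1
      · intro e
        rw [h2]
        simp only [Workflow.build, hst, if_false, List.mem_cons, exists_eq_or_imp,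
          Workflow.Edge.toNat, Option.elim_none, eq_comm (a := e)]
        tauto
  | choice w w' ih ih' =>
    obtain ⟨q, hq, h⟩ := ih
    obtain ⟨q', hq', h'⟩ := ih'
    have hle : w.code + 1 + (w'.code + 1) + 1 ≤ (Workflow.choice w w').code + 1 := by
      have h1 := Nat.add_le_pair 3 (Nat.pair w.code w'.code)
      have h2 := Nat.add_le_pair w.code w'.code
      simp only [Workflow.code]
      omega
    refine ⟨q' + q + 1, by omega, fun s t m j rest out => ?_⟩
    obtain ⟨out₁, h1, h2⟩ := h m t (m + 2) j ((w'.code, m + 1, t) :: rest)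
      ((s, m, 0, 0) :: (s, m + 1, 0, 0) :: out)
    obtain ⟨out₂, h3, h4⟩ := h' (m + 1) t (w.build m t (m + 2) j).2.1
      (w.build m t (m + 2) j).2.2 rest out₁
    refine ⟨out₂, ?_, ?_⟩
    · rw [Function.iterate_succ_apply, buildStep_cons, Workflow.code, buildTop,
        if_neg (by simp), if_neg (by simp), if_neg (by simp), Function.iterate_add_apply]
      simp only [Nat.unpair_pair]
      rw [h1, h3]
      rfl
    · intro e
      rw [h4, h2]
      simp only [Workflow.build, List.mem_cons, exists_eq_or_imp, Workflow.Edge.toNat,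
        Option.elim_none, eq_comm (a := e), List.mem_append]
      simp only [or_and_right, exists_or]
      simp only [or_assoc, or_comm, or_left_comm]

/-- The edges of the control flow graph of the workflow with code `n`. -/
def edgesOf (n : ℕ) : List (ℕ × ℕ × ℕ × ℕ) :=
  (Workflow.final, Workflow.final, 0, 0) ::
    (buildStep^[n + 1] ([(n, Workflow.entry, Workflow.final)], 2, 0, [])).2.2.2

@[fun_prop] theorem primrec_edgesOf {α : Type} [Primcodable α] {f : α → ℕ} (hf : Primrec f) :
    Primrec fun a => edgesOf (f a) := by
  have := primrec_buildStep
  unfold edgesOf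
  fun_prop

/-- The machine is run for a fixed number of steps; surplus steps are harmless, since an empty stack
is a fixed point. The order of the edges may differ, only membership is needed. -/
theorem mem_edgesOf {w : Workflow} {e : ℕ × ℕ × ℕ × ℕ} :
    e ∈ edgesOf w.code ↔ ∃ e' ∈ w.edges, e'.toNat = e := by
  obtain ⟨q, hq, h⟩ := exists_iterate_buildStep w
  obtain ⟨out, h1, h2⟩ := h Workflow.entry Workflow.final 2 0 [] []
  obtain ⟨k, hk⟩ := Nat.exists_eq_add_of_le hq
  have hfix : ∀ k (x : BuildState), x.1 = [] → buildStep^[k] x = x := by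
    intro k x hx
    exact Function.iterate_fixed (by simp [buildStep, hx]) k
  rw [edgesOf, hk, add_comm, Function.iterate_add_apply, h1, hfix _ _ rfl]
  simp only [Workflow.edges, List.mem_cons, exists_eq_or_imp, h2, List.not_mem_nil, false_or,
    Workflow.Edge.toNat, Option.elim_none, eq_comm (a := e)]

/-- Block numbers on edges are positions in the linearisation, so an edge and the arity of its low
input refer to the same block. -/
theorem Workflow.build_labels (w : Workflow) (s t m j : ℕ) :
    (w.build s t m j).2.2 = j + w.blocks.length ∧
    ∀ e ∈ (w.build s t m j).1, ∀ i b, e.label = some (i, b) →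
      j ≤ i ∧ w.blocks[i - j]? = some b := by
  induction w generalizing s t m j with
  | block b =>
    simp only [Workflow.build, Workflow.blocks, List.mem_singleton]
    refine ⟨rfl, ?_⟩
    rintro e rfl i b' h
    simp only [Option.some.injEq, Prod.mk.injEq] at h
    obtain ⟨rfl, rfl⟩ := h
    simp
  | seq b w ih =>
    obtain ⟨h1, h2⟩ := ih m t (m + 1) (j + 1)
    simp only [Workflow.build, Workflow.blocks, List.mem_cons, List.length_cons]
    refine ⟨by omega, ?_⟩
    rintro e (rfl | he) i b' h
    · simp only [Option.some.injEq, Prod.mk.injEq] at h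
      obtain ⟨rfl, rfl⟩ := h
      simp
    · obtain ⟨h3, h4⟩ := h2 e he i b' h
      refine ⟨by omega, ?_⟩
      rw [show i - j = (i - (j + 1)) + 1 by omega, List.getElem?_cons_succ, h4]
  | loop w ih =>
    by_cases hst : s = t
    · obtain ⟨h1, h2⟩ := ih m m (m + 1) j
      simp only [Workflow.build, hst, if_true, Workflow.blocks, List.mem_cons]
      refine ⟨h1, ?_⟩
      rintro e (rfl | rfl | he) i b' h
      · simp at h
      · simp at h
      · exact h2 e he i b' h
    · obtain ⟨h1, h2⟩ := ih s s m j
      simp only [Workflow.build, hst, if_false, Workflow.blocks, List.mem_cons]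
      refine ⟨h1, ?_⟩
      rintro e (rfl | he) i b' h
      · simp at h
      · exact h2 e he i b' h
  | choice w w' ih ih' =>
    obtain ⟨h1, h2⟩ := ih m t (m + 2) j
    obtain ⟨h3, h4⟩ := ih' (m + 1) t (w.build m t (m + 2) j).2.1 (w.build m t (m + 2) j).2.2
    simp only [Workflow.build, Workflow.blocks, List.mem_cons, List.mem_append,
      List.length_append]
    refine ⟨by omega, ?_⟩
    rintro e (rfl | rfl | he | he) i b' h
    · simp at h
    · simp at h
    · obtain ⟨h5, h6⟩ := h2 e he i b' h
      exact ⟨h5, by rw [List.getElem?_append_left (List.getElem?_eq_some_iff.mp h6).1, h6]⟩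
    · obtain ⟨h5, h6⟩ := h4 e he i b' h
      refine ⟨by omega, ?_⟩
      rw [List.getElem?_append_right (by omega), ← h6]
      congr 1
      omega

theorem Workflow.blocks_getElem?_of_mem_edges {w : Workflow} {e : Workflow.Edge}
    (he : e ∈ w.edges) {j : ℕ} {b : Block} (h : e.label = some (j, b)) :
    w.blocks[j]? = some b := by
  rcases List.mem_cons.mp he with rfl | he
  · simp at h
  · simpa using ((w.build_labels _ _ _ _).2 e he j b h).2

end MultiAgent

namespace MultiAgent

/-! ### Substructures -/

variable {S : Signature} {w : Workflow}

theorem Carrier.val_congr {K : Carrier S} {ν ν' : K.Valuation} {t : Term}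
    (h : ∀ v ∈ t.fv, ν v = ν' v) : K.val ν t = K.val ν' t := by
  cases t with
  | var v => simp [Carrier.val, h v (by simp [Term.fv])]
  | const c => rfl

theorem Trace.sat_congr {K : Carrier S} (π : Trace w K) {φ : Formula} {i : ℕ}
    {ν ν' : K.Valuation} (h : ∀ v ∈ φ.fv, ν v = ν' v) : π.sat φ i ν ↔ π.sat φ i ν' := by
  induction φ generalizing i ν ν' with
  | eq t t' =>
    simp only [Trace.sat]
    rw [K.val_congr fun v hv => h v (Or.inl hv), K.val_congr fun v hv => h v (Or.inr hv)]
  | rel P ts =>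
    simp only [Trace.sat]
    rw [List.map_congr_left fun t ht => K.val_congr fun v hv => h v ⟨t, ht, hv⟩]
  | not φ ih => exact not_congr (ih h)
  | or φ ψ ih ih' =>
    exact or_congr (ih fun v hv => h v (Or.inl hv)) (ih' fun v hv => h v (Or.inr hv))
  | ex v φ ih =>
    refine exists_congr fun d => ih fun u hu => ?_
    by_cases huv : u = v
    · subst huv
      simp
    · simp [huv, h u ⟨hu, huv⟩]
  | next φ ih => exact ih h
  | untl φ ψ ih ih' =>
    refine exists_congr fun j => and_congr_right fun _ => and_congr
      (ih' fun v hv => h v (Or.inr hv)) ?_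
    exact forall₃_congr fun _ _ _ => ih fun v hv => h v (Or.inl hv)

/-- A counterexample to non-interference. -/
structure Trace.Violates {K : Carrier S} (φ : Declassification) (k : ℕ) (π π' : Trace w K)
    (c : Fin k → K.Agent) (a : K.Agent) : Prop where
  exec : π.IsExecution
  exec' : π'.IsExecution
  causal : ∀ i, Causal π π' (c i).1
  stubborn : ∀ b : K.Agent, (∀ i, b ≠ c i) → Stubborn π π' b.1
  sameCfg : SameCfg π π'
  low : ∀ i, LowInputs π π' a.1 i
  high : HighInputs φ π π' a.1
  obs : ∃ i, ¬ LowOutputs π π' a.1 i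

theorem not_nonInterference_iff {φ : Declassification} {k : ℕ} :
    ¬ NonInterference S w φ k ↔ ∃ (K : Carrier S) (π π' : Trace w K) (c : Fin k → K.Agent)
      (a : K.Agent), Trace.Violates φ k π π' c a := by
  constructor
  · intro h
    simp only [NonInterference] at h
    push Not at h
    obtain ⟨K, π, π', h1, h2, ⟨c, h3, h4⟩, h5, a, h6, h7, h8⟩ := h
    exact ⟨K, π, π', c, a, h1, h2, h3, h4, h5, h6, h7, h8⟩
  · rintro ⟨K, π, π', c, a, h⟩ hN
    obtain ⟨i, hi⟩ := h.obs
    exact hi (hN K π π' h.exec h.exec' ⟨c, h.causal, h.stubborn⟩ h.sameCfg a h.low h.high i)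

/-- Embeddings of carriers. -/
structure Carrier.Emb (K' K : Carrier S) where
  toFun : ∀ s, K'.U s → K.U s
  inj : ∀ s, Function.Injective (toFun s)
  const : ∀ c s, S.constSorts[c]? = some s →
    (⟨(K'.const c).1, toFun _ (K'.const c).2⟩ : K.Elem) = K.const c

namespace Carrier.Emb

variable {K' K : Carrier S} (H : K'.Emb K)

def elem (e : K'.Elem) : K.Elem := ⟨e.1, H.toFun e.1 e.2⟩

theorem elem_injective : Function.Injective H.elem := by
  rintro ⟨s, x⟩ ⟨s', x'⟩ h
  obtain ⟨rfl, h⟩ := Sigma.mk.inj h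
  exact congrArg (Sigma.mk s) (H.inj s (eq_of_heq h))

def valuation (ν : K'.Valuation) : K.Valuation := fun v => H.toFun v.sort (ν v)

theorem valuation_update (ν : K'.Valuation) (v : Var) (d : K'.U v.sort) :
    H.valuation (Function.update ν v d) =
      Function.update (H.valuation ν) v (H.toFun v.sort d) := by
  ext u
  by_cases h : u = v
  · subst h
    simp [valuation]
  · simp [valuation, h]

theorem elem_val {ν : K'.Valuation} {t : Term} {s : ℕ} (h : S.termSort t = some s) :
    H.elem (K'.val ν t) = K.val (H.valuation ν) t := by
  cases t with
  | var v => rfl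
  | const c => exact H.const c s h

theorem map_elem_val {ν : K'.Valuation} {ts : List Term} {l : List ℕ}
    (h : ts.map S.termSort = l.map some) :
    (ts.map (K'.val ν)).map H.elem = ts.map (K.val (H.valuation ν)) := by
  rw [List.map_map]
  refine List.map_congr_left fun t ht => ?_
  have h1 : S.termSort t ∈ l.map some := h ▸ List.mem_map_of_mem ht
  obtain ⟨s, -, hs⟩ := List.mem_map.mp h1
  exact H.elem_val hs.symm

/-- The restriction of a trace to a substructure. -/
def pull (π : Trace w K) : Trace w K' where
  rel i P := {x | x.map H.elem ∈ π.rel i P}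
  sorted i P x hx := by
    rw [π.sorted i P _ hx, List.map_map]
    rfl

theorem mem_pull {π : Trace w K} {i : ℕ} {P : Pred} {x : List K'.Elem} :
    x ∈ (H.pull π).rel i P ↔ x.map H.elem ∈ π.rel i P := Iff.rfl

/-- Restriction changes the universes but not the time points, so atoms and temporal operators are
absolute. -/
theorem sat_pull_of_quantifierFree {ar : Pred → Option (List ℕ)} (π : Trace w K) {φ : Formula}
    (hs : φ.WellSorted S ar) (hq : φ.QuantifierFree) {i : ℕ} {ν : K'.Valuation} :
    (H.pull π).sat φ i ν ↔ π.sat φ i (H.valuation ν) := by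
  induction φ generalizing i with
  | eq t t' =>
    obtain ⟨s, h, h'⟩ := hs
    simp only [Trace.sat]
    rw [← H.elem_val h, ← H.elem_val h', H.elem_injective.eq_iff]
  | rel P ts =>
    obtain ⟨l, -, h⟩ := hs
    simp only [Trace.sat, mem_pull, H.map_elem_val h]
  | not φ ih => exact not_congr (ih hs hq)
  | or φ ψ ih ih' => exact or_congr (ih hs.1 hq.1) (ih' hs.2 hq.2)
  | ex v φ => exact hq.elim
  | next φ ih => exact ih hs hq
  | untl φ ψ ih ih' =>
    exact exists_congr fun j => and_congr_right fun _ => and_congr (ih' hs.2 hq.2)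
      (forall₃_congr fun _ _ _ => ih hs.1 hq.1)

/-- Universal formulas pass down to substructures. The polarity `p` tracks negations: for `p =
false` it is the negation that is universal, so truth of the formula passes up. -/
theorem sat_pull_of_noExists {ar : Pred → Option (List ℕ)} (π : Trace w K) {φ : Formula}
    (hs : φ.WellSorted S ar) {p : Bool} (hq : (φ.nnf p).NoExists) {i : ℕ} {ν : K'.Valuation} :
    if p = true then π.sat φ i (H.valuation ν) → (H.pull π).sat φ i ν
    else (H.pull π).sat φ i ν → π.sat φ i (H.valuation ν) := by
  induction φ generalizing i p ν with
  | eq t t' =>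
    have := H.sat_pull_of_quantifierFree π (φ := .eq t t') hs trivial (i := i) (ν := ν)
    split
    · exact this.mpr
    · exact this.mp
  | rel P ts =>
    have := H.sat_pull_of_quantifierFree π (φ := .rel P ts) hs trivial (i := i) (ν := ν)
    split
    · exact this.mpr
    · exact this.mp
  | not φ ih =>
    have := @ih hs (!p) hq i ν
    cases p <;> simp only [Trace.sat, Bool.not_true, Bool.not_false, Bool.false_eq_true,
      if_true, if_false] at this ⊢ <;> exact mt this
  | or φ ψ ih ih' =>
    cases p
    · exact Or.imp (@ih hs.1 false hq.1 i ν) (@ih' hs.2 false hq.2 i ν)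
    · exact Or.imp (@ih hs.1 true hq.1 i ν) (@ih' hs.2 true hq.2 i ν)
  | ex v φ ih =>
    cases p
    · rintro ⟨d, hd⟩
      have := @ih hs.2 false hq i (Function.update ν v d) hd
      rw [valuation_update] at this
      exact ⟨_, this⟩
    · exact hq.elim
  | next φ ih =>
    cases p
    · exact @ih hs false hq (i + 1) ν
    · exact @ih hs true hq (i + 1) ν
  | untl φ ψ ih ih' =>
    cases p
    · rintro ⟨j, hj, h, h'⟩
      exact ⟨j, hj, @ih' hs.2 false hq.2 j ν h,
        fun l hl hlj => @ih hs.1 false hq.1 l ν (h' l hl hlj)⟩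
    · rintro ⟨j, hj, h, h'⟩
      exact ⟨j, hj, @ih' hs.2 true hq.2 j ν h,
        fun l hl hlj => @ih hs.1 true hq.1 l ν (h' l hl hlj)⟩

/-- The point where non-omission is needed: an updated tuple of the substructure determines the
values of all variables of the block, so no update depends on elements that were dropped. -/
theorem mem_updates_pull (π : Trace w K) {b : Block} (hb : b.WellFormed S) {st : Stmt}
    (hst : st ∈ b.stmts) (hno : st.argVars = b.varSet) (hqf : st.guard.QuantifierFree)
    {i j : ℕ} {y : List K'.Elem} :
    y ∈ (H.pull π).updates i j b st ↔ y.map H.elem ∈ π.updates i j b st := by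
  classical
  have hwf := hb.stmts st hst
  obtain ⟨l, -, hl⟩ := hwf.args_sorted
  have key : ∀ ν : K'.Valuation,
      (b.vars.map fun v => (⟨v.sort, ν v⟩ : K'.Elem)).map H.elem =
        b.vars.map fun v => (⟨v.sort, H.valuation ν v⟩ : K.Elem) := by
    intro ν
    simp [elem, valuation]
  constructor
  · rintro ⟨ν, hg, hm, rfl⟩
    refine ⟨H.valuation ν, (H.sat_pull_of_quantifierFree π hwf.guard_sorted hqf).mp hg,
      fun hmay => ?_, H.map_elem_val hl⟩
    rw [← key]
    exact hm hmay
  · rintro ⟨ν, hg, hm, hy⟩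
    -- Each block variable occurs among the arguments, so its value is an entry of `y.map H.elem`
    -- and has a preimage; all other variables get an arbitrary value.
    have hex : ∀ v : Var, ∃ d : K'.U v.sort, v ∈ b.varSet → H.toFun v.sort d = ν v := by
      intro v
      by_cases hv : v ∈ b.varSet
      · rw [← hno] at hv
        obtain ⟨t, ht, hvt⟩ := hv
        cases t with
        | const c => exact hvt.elim
        | var u =>
          obtain rfl : v = u := hvt
          have : K.val ν (.var v) ∈ y.map H.elem := hy ▸ List.mem_map_of_mem ht
          obtain ⟨⟨s, e⟩, -, he⟩ := List.mem_map.mp this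
          obtain ⟨rfl, he⟩ := Sigma.mk.inj he
          exact ⟨e, fun _ => eq_of_heq he⟩
      · exact ⟨(K'.nonempty _).some, fun h => (hv h).elim⟩
    choose ν' hν' using hex
    have hagree : ∀ v ∈ b.varSet, H.valuation ν' v = ν v := hν'
    refine ⟨ν', (H.sat_pull_of_quantifierFree π hwf.guard_sorted hqf).mpr
      ((π.sat_congr fun v hv => (hagree v (hwf.guard_fv hv)).symm).mp hg), fun hmay => ?_, ?_⟩
    · rw [mem_pull, key, List.map_congr_left (g := fun v => (⟨v.sort, ν v⟩ : K.Elem))]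
      · exact hm hmay
      · intro v hv
        rw [hagree v hv]
    · refine (List.map_injective_iff.mpr H.elem_injective) ?_
      rw [hy, H.map_elem_val hl]
      refine List.map_congr_left fun t ht => K.val_congr fun v hv => ?_
      exact (hagree v (hno ▸ ⟨t, ht, hv⟩)).symm

/-- Sequential updates act on each tuple separately, so the restriction commutes with the whole
fold. -/
theorem mem_post_pull (π : Trace w K) (hw : w.WellFormed S) (hno : w.NonOmitting)
    {e : Workflow.Edge} (he : e ∈ w.edges) {i R : ℕ} {y : List K'.Elem} :
    y ∈ (H.pull π).post i e.label R ↔ y.map H.elem ∈ π.post i e.label R := by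
  rcases hlab : e.label with _ | ⟨j, b⟩
  · rfl
  · have hbm : b ∈ w.blocks :=
      List.mem_of_getElem? (Workflow.blocks_getElem?_of_mem_edges he hlab)
    simp only [Trace.post]
    have : ∀ (l : List Stmt), (∀ st ∈ l, st ∈ b.stmts) → ∀ (X : Set (List K'.Elem))
        (Y : Set (List K.Elem)), (y ∈ X ↔ y.map H.elem ∈ Y) →
        (y ∈ l.foldl (fun X st => if st.rel = R then if st.add = true then
            X ∪ (H.pull π).updates i j b st else X \ (H.pull π).updates i j b st else X) X ↔
          y.map H.elem ∈ l.foldl (fun X st => if st.rel = R then if st.add = true then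
            X ∪ π.updates i j b st else X \ π.updates i j b st else X) Y) := by
      intro l
      induction l with
      | nil => exact fun _ _ _ h => h
      | cons st l ih =>
        intro hl X Y hXY
        have hst := hl st List.mem_cons_self
        have hu := H.mem_updates_pull π (hw b hbm) hst (hno b hbm st hst).1 (hno b hbm st hst).2
          (i := i) (j := j) (y := y)
        refine ih (fun st' h => hl st' (List.mem_cons_of_mem _ h)) _ _ ?_
        dsimp only
        split_ifs
        · exact or_congr hXY hu
        · exact and_congr hXY (not_congr hu)
        · exact hXY
    exact this b.stmts (fun _ h => h) _ _ Iff.rfl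

theorem isExecution_pull {π : Trace w K} (hw : w.WellFormed S) (hno : w.NonOmitting)
    (h : π.IsExecution) : (H.pull π).IsExecution where
  -- Nodes are nullary, and the empty tuple is its own image.
  cfg := h.cfg
  sanity := h.sanity
  init_node := h.init_node
  init_rel R := by
    ext x
    simp [mem_pull, h.init_rel R]
  exec i e he h1 h2 R hR := by
    ext y
    rw [H.mem_post_pull π hw hno he, mem_pull, h.exec i e he h1 h2 R hR]

theorem lowInputs_pull {π π' : Trace w K} {a : K'.Elem} {i : ℕ}
    (h : Trace.LowInputs π π' (H.elem a) i) : Trace.LowInputs (H.pull π) (H.pull π') a i :=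
  fun j x => h j (x.map H.elem)

theorem exists_map_elem {x : List K.Elem} (h : ∀ e ∈ x, ∃ e', H.elem e' = e) :
    ∃ x' : List K'.Elem, x'.map H.elem = x := by
  induction x with
  | nil => exact ⟨[], rfl⟩
  | cons e x ih =>
    obtain ⟨x', rfl⟩ := ih fun e he => h e (List.mem_cons_of_mem _ he)
    obtain ⟨e', rfl⟩ := h e List.mem_cons_self
    exact ⟨e' :: x', rfl⟩

theorem not_lowOutputs_pull {π π' : Trace w K} {a : K'.Elem} {i R : ℕ} {x : List K.Elem}
    (hx : ∀ e ∈ x, ∃ e', H.elem e' = e)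
    (h : ¬ (H.elem a :: x ∈ π.rel i (.wf R) ↔ H.elem a :: x ∈ π'.rel i (.wf R))) :
    ¬ Trace.LowOutputs (H.pull π) (H.pull π') a i := by
  obtain ⟨x', rfl⟩ := H.exists_map_elem hx
  exact fun hl => h (hl R x')

/-- The universal parts of a counterexample are inherited by any substructure. Existential are only
the differences seen by the observer and by the released causal agents; `hcw` and `haw` demand that
witnesses for these were kept. -/
theorem violates_pull {φ : Declassification} {k : ℕ} {π π' : Trace w K} {c : Fin k → K.Agent}
    {a : K.Agent} (hw : w.WellFormed S) (hno : w.NonOmitting) (hφ : φ.WellFormed S w)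
    (hu : φ.NegationsUniversal) (h : Trace.Violates φ k π π' c a) {c' : Fin k → K'.Agent}
    {a' : K'.Agent} (hc : ∀ i, H.elem (c' i).1 = (c i).1) (ha : H.elem a'.1 = a.1)
    (hcw : ∀ m, (∀ i, Trace.LowInputs π π' (c m).1 i) ∨ ∃ j R x, (∀ e ∈ x, ∃ e', H.elem e' = e) ∧
      ¬ ((c m).1 :: x ∈ π.rel j (.wf R) ↔ (c m).1 :: x ∈ π'.rel j (.wf R)) ∧
      ∀ i < j, Trace.LowInputs π π' (c m).1 i)
    (haw : ∃ j R x, (∀ e ∈ x, ∃ e', H.elem e' = e) ∧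
      ¬ (a.1 :: x ∈ π.rel j (.wf R) ↔ a.1 :: x ∈ π'.rel j (.wf R))) :
    Trace.Violates φ k (H.pull π) (H.pull π') c' a' where
  exec := H.isExecution_pull hw hno h.exec
  exec' := H.isExecution_pull hw hno h.exec'
  causal m := by
    rcases hcw m with hl | ⟨j, R, x, hx, hd, hl⟩
    · exact Or.inr fun i => H.lowInputs_pull (by rw [hc]; exact hl i)
    · refine Or.inl ⟨j, H.not_lowOutputs_pull hx (R := R) (by rw [hc]; exact hd), fun i hi => ?_⟩
      exact H.lowInputs_pull (by rw [hc]; exact hl i hi)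
  -- An agent of the substructure that is no `c' m` is sent by the injective embedding to an agent
  -- that is no `c m`.
  stubborn b hb i := by
    refine H.lowInputs_pull (h.stubborn ⟨H.elem b.1, b.2⟩ (fun m hm => hb m ?_) i)
    have : H.elem b.1 = H.elem (c' m).1 := by
      rw [hc, ← hm]
    exact Subtype.ext (H.elem_injective this)
  sameCfg := h.sameCfg
  low i := H.lowInputs_pull (by rw [ha]; exact h.low i)
  high := by
    intro i O l ψ hO hψ ν hν hsat
    have hsort : a'.1.1 = a.1.1 := congrArg Sigma.fst ha
    have hws := hφ.sorted O _ ψ hψ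
    have hun := hu O _ ψ hψ
    have hmap : ((Declassification.tupleVars l).map fun v => (⟨v.sort, ν v⟩ : K'.Elem)).map H.elem
        = (Declassification.tupleVars l).map fun v => (⟨v.sort, H.valuation ν v⟩ : K.Elem) := by
      simp [elem, valuation]
    rw [mem_pull, mem_pull, hmap]
    -- A condition that holds after restriction held before it, so the large traces had to agree on
    -- this tuple.
    have hsat' := Or.imp (H.sat_pull_of_noExists π hws (p := false) hun (i := i) (ν := ν))
      (H.sat_pull_of_noExists π' hws (p := false) hun (i := i) (ν := ν)) hsat
    obtain ⟨a, hag⟩ := a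
    obtain ⟨a', hag'⟩ := a'
    dsimp only at ha hsort hψ hν hsat'
    subst ha
    refine h.high i O l ψ hO hψ (H.valuation ν) ?_ hsat'
    simp [valuation, elem, Declassification.agentVar] at hν ⊢
    rw [hν]
  obs := by
    obtain ⟨j, R, x, hx, hd⟩ := haw
    exact ⟨j, H.not_lowOutputs_pull hx (R := R) (by rw [ha]; exact hd)⟩

end Carrier.Emb

/-- A difference can only occur in a declared relation at a tuple of its arity, because traces are
sorted; this bounds the length of the witness. -/
theorem Trace.exists_of_not_lowOutputs {K : Carrier S} {π π' : Trace w K} {a : K.Elem} {i : ℕ}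
    (h : ¬ LowOutputs π π' a i) :
    ∃ R x l, S.wfRels[R]? = some l ∧ l = (a :: x).map Sigma.fst ∧
      ¬ (a :: x ∈ π.rel i (.wf R) ↔ a :: x ∈ π'.rel i (.wf R)) := by
  simp only [LowOutputs, not_forall] at h
  obtain ⟨R, x, h⟩ := h
  have : w.arity S (.wf R) = some ((a :: x).map Sigma.fst) := by
    by_contra hcon
    exact h ⟨fun h' => (hcon (π.sorted _ _ _ h')).elim, fun h' => (hcon (π'.sorted _ _ _ h')).elim⟩
  exact ⟨R, x, _, this, rfl, h⟩

/-- A counterexample only needs a bounded number of elements. -/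
theorem Trace.Violates.exists_witnesses (hS : S.WellFormed) {K : Carrier S} {φ : Declassification}
    {k : ℕ} {π π' : Trace w K} {c : Fin k → K.Agent} {a : K.Agent} (h : Violates φ k π π' c a)
    {L : ℕ} (hL : ∀ l ∈ S.wfRels, l.length ≤ L) :
    ∃ W : List K.Elem, W.length ≤ S.constSorts.length + 1 + k + L + k * L ∧
      (∀ e ∈ W, e.1 < S.numSorts) ∧ (∀ i < S.constSorts.length, K.const i ∈ W) ∧
      (∀ i, (c i).1 ∈ W) ∧ a.1 ∈ W ∧
      (∀ m, (∀ i, LowInputs π π' (c m).1 i) ∨ ∃ j R x, (∀ e ∈ x, e ∈ W) ∧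
        ¬ ((c m).1 :: x ∈ π.rel j (.wf R) ↔ (c m).1 :: x ∈ π'.rel j (.wf R)) ∧
        ∀ i < j, LowInputs π π' (c m).1 i) ∧
      ∃ j R x, (∀ e ∈ x, e ∈ W) ∧
        ¬ (a.1 :: x ∈ π.rel j (.wf R) ↔ a.1 :: x ∈ π'.rel j (.wf R)) := by
  have hsub : ∀ {b : K.Elem} {x : List K.Elem} {R : ℕ} {l : List ℕ}, S.wfRels[R]? = some l →
      l = (b :: x).map Sigma.fst → x.length ≤ L ∧ ∀ e ∈ x, e.1 < S.numSorts := by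
    rintro b x R l hR rfl
    have hm := List.mem_of_getElem? hR
    have := hL _ hm
    simp only [List.map_cons, List.length_cons, List.length_map] at this
    refine ⟨by omega, fun e he => (hS.wfRels _ hm).1 _ ?_⟩
    exact List.mem_map_of_mem (List.mem_cons_of_mem _ he)
  have hc : ∀ m, ∃ x : List K.Elem, x.length ≤ L ∧ (∀ e ∈ x, e.1 < S.numSorts) ∧
      ((∀ i, LowInputs π π' (c m).1 i) ∨ ∃ j R,
        ¬ ((c m).1 :: x ∈ π.rel j (.wf R) ↔ (c m).1 :: x ∈ π'.rel j (.wf R)) ∧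
        ∀ i < j, LowInputs π π' (c m).1 i) := by
    intro m
    rcases h.causal m with ⟨j, hj, hl⟩ | hl
    · obtain ⟨R, x, l, hR, hlx, hd⟩ := exists_of_not_lowOutputs hj
      exact ⟨x, (hsub hR hlx).1, (hsub hR hlx).2, Or.inr ⟨j, R, hd, hl⟩⟩
    · exact ⟨[], by simp, by simp, Or.inl hl⟩
  choose xs hxs1 hxs2 hxs3 using hc
  obtain ⟨j, hj⟩ := h.obs
  obtain ⟨R, x, l, hR, hlx, hd⟩ := exists_of_not_lowOutputs hj
  -- Constants, observer, causal agents, the tuple seen by the observer, and one tuple for each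
  -- causal agent (empty if its low inputs always agree).
  refine ⟨(List.range S.constSorts.length).map K.const ++ [a.1] ++ List.ofFn (fun i => (c i).1) ++
    x ++ (List.ofFn xs).flatten, ?_, ?_, ?_, ?_, ?_, ?_, ?_⟩
  · have h1 : ((List.ofFn xs).map List.length).sum ≤ k * L := by
      have := List.sum_le_card_nsmul ((List.ofFn xs).map List.length) L (by
        intro n hn
        obtain ⟨y, hy, rfl⟩ := List.mem_map.mp hn
        obtain ⟨i, rfl⟩ := (List.mem_ofFn' _ _).mp hy
        exact hxs1 i)
      simpa using this
    have h2 := (hsub hR hlx).1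
    simp only [List.length_append, List.length_map, List.length_range, List.length_singleton,
      List.length_ofFn, List.length_flatten]
    omega
  · intro e he
    simp only [List.mem_append, List.mem_map, List.mem_range, List.mem_singleton,
      List.mem_flatten, List.mem_ofFn] at he
    have hag : ∀ b : K.Agent, b.1.1 < S.numSorts := fun b =>
      b.2.trans_le (Nat.le_add_right _ _)
    rcases he with (((⟨i, hi, rfl⟩ | rfl) | ⟨i, rfl⟩) | he) | ⟨y, ⟨i, rfl⟩, he⟩
    · rw [K.const_sort i _ (List.getElem?_eq_getElem hi)]
      exact hS.consts _ (List.getElem_mem hi)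
    · exact hag a
    · exact hag _
    · exact (hsub hR hlx).2 e he
    · exact hxs2 i e he
  · intro i hi
    simp only [List.mem_append, List.mem_map, List.mem_range]
    exact Or.inl (Or.inl (Or.inl (Or.inl ⟨i, hi, rfl⟩)))
  · intro i
    simp only [List.mem_append, List.mem_ofFn]
    exact Or.inl (Or.inl (Or.inr ⟨i, rfl⟩))
  · simp
  · intro m
    refine (hxs3 m).imp_right ?_
    rintro ⟨j, R, h1, h2⟩
    refine ⟨j, R, xs m, fun e he => ?_, h1, h2⟩
    simp only [List.mem_append, List.mem_flatten, List.mem_ofFn]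
    exact Or.inr ⟨_, ⟨m, rfl⟩, he⟩
  · refine ⟨j, R, x, fun e he => ?_, hd⟩
    simp only [List.mem_append]
    exact Or.inl (Or.inr he)

end MultiAgent

namespace MultiAgent

/-! ### Finite carriers -/

/-- The universe of sort `s` of the finite carrier given by a list of elements. -/
abbrev FinUniv (E : List ℕ) (s : ℕ) : Type := {d : ℕ // d = 0 ∨ Nat.pair s d ∈ E}

-- Numbers outside the universe are sent to `0`, which belongs to the universe of every sort.
open Classical in
noncomputable def FinUniv.mk (E : List ℕ) (s d : ℕ) : FinUniv E s :=
  if h : d = 0 ∨ Nat.pair s d ∈ E then ⟨d, h⟩ else ⟨0, Or.inl rfl⟩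

theorem FinUniv.val_mk {E : List ℕ} {s d : ℕ} (h : d = 0 ∨ Nat.pair s d ∈ E) :
    (FinUniv.mk E s d).1 = d := by
  simp [FinUniv.mk, h]

theorem FinUniv.mk_val {E : List ℕ} {s : ℕ} (x : FinUniv E s) : FinUniv.mk E s x.1 = x :=
  Subtype.ext (FinUniv.val_mk x.2)

/-- The number of an element. -/
def elemCode {E : List ℕ} (x : Σ s, FinUniv E s) : ℕ := Nat.pair x.1 x.2.1

noncomputable def toElem (E : List ℕ) (e : ℕ) : Σ s, FinUniv E s :=
  ⟨e.unpair.1, FinUniv.mk E _ e.unpair.2⟩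

variable {E : List ℕ}

theorem elemCode_toElem {e : ℕ} (h : e ∈ E) : elemCode (toElem E e) = e := by
  rw [elemCode, toElem, FinUniv.val_mk (Or.inr (by simpa using h)), Nat.pair_unpair]

@[simp] theorem toElem_elemCode (x : Σ s, FinUniv E s) : toElem E (elemCode x) = x := by
  obtain ⟨s, x⟩ := x
  have h1 : (elemCode (⟨s, x⟩ : Σ s, FinUniv E s)).unpair = (s, x.1) := by
    simp [elemCode]
  rw [toElem, h1, FinUniv.mk_val]

theorem elemCode_injective : Function.Injective (elemCode (E := E)) :=
  Function.LeftInverse.injective toElem_elemCode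

theorem map_elemCode_injective : Function.Injective (List.map (elemCode (E := E))) :=
  List.map_injective_iff.mpr elemCode_injective

theorem map_elemCode_toElem {l : List ℕ} (h : ∀ e ∈ l, e ∈ E) :
    (l.map (toElem E)).map elemCode = l := by
  rw [List.map_map]
  conv_rhs => rw [← List.map_id l]
  exact List.map_congr_left fun e he => elemCode_toElem (h e he)

@[simp] theorem unpair_elemCode_fst (x : Σ s, FinUniv E s) : (elemCode x).unpair.1 = x.1 := by
  simp [elemCode]

@[simp] theorem Var.mk_unpair_code (v : Var) :
    (⟨v.code.unpair.1, v.code.unpair.2⟩ : Var) = v := by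
  simp [Var.code]

namespace Ctx

variable {c : Ctx}

theorem mem_lists {l : List ℕ} : l ∈ c.lists ↔ l.length ≤ c.M ∧ ∀ e ∈ l, e ∈ c.elems :=
  mem_listsOver

theorem mem_facts {u : Fact} : u ∈ c.facts ↔ u.1 < 5 ∧ u.2.1 < c.M ∧ u.2.2 ∈ c.lists := by
  obtain ⟨i, f, l⟩ := u
  simp [facts]

theorem mem_facts_of_mem {t : State} (ht : t ∈ c.states) {u : Fact} (hu : u ∈ t) : u ∈ c.facts :=
  (mem_sublistsOf.mp ht).subset hu

end Ctx

/-- The numeric data `c` represent the given signature, workflow and declassification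
conditions, and its bounds are large enough. -/
structure Rep (S : Signature) (w : Workflow) (φ : Declassification) (k : ℕ) (c : Ctx) : Prop where
  hS : S.WellFormed
  hw : w.WellFormed S
  hφ : φ.WellFormed S w
  numAgent : c.numAgent = S.numAgentSorts
  consts : c.consts = S.constSorts
  wf : c.wf = S.wfRels
  high : c.high = S.highRels
  edges : c.edges = edgesOf w.code
  cond : c.cond = List.map (List.map Formula.code) φ
  card : c.k = k
  sorts : S.numSorts ≤ c.M
  pred : ∀ P l, w.arity S P = some l → P.code < c.M ∧ l.length ≤ c.M
  vars : ∀ b ∈ w.blocks, ∀ v ∈ b.vars, v.code < c.M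
  tuple : ∀ l ∈ S.highRels, ∀ v ∈ Declassification.tupleVars l, v.code < c.M
  agentVar : ∀ s < S.numAgentSorts, (Declassification.agentVar s).code < c.M
  forms : ∀ f ∈ c.forms, f < c.M
  good : c.Good

theorem Workflow.arity_eq_of_arity {S : Signature} {w : Workflow} {P : Pred} {l : List ℕ}
    (h : S.arity P = some l) : w.arity S P = some l := by
  cases P with
  | wf i => exact h
  | high i => exact h
  | low j => cases h
  | node n => cases h

theorem Workflow.lt_numSorts_of_arity {S : Signature} (hS : S.WellFormed) {w : Workflow}
    (hw : w.WellFormed S) {P : Pred} {l : List ℕ} (h : w.arity S P = some l) :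
    ∀ s ∈ l, s < S.numSorts := by
  cases P with
  | wf i => exact (hS.wfRels l (List.mem_of_getElem? h)).1
  | high i => exact (hS.highRels l (List.mem_of_getElem? h)).1
  | low j =>
    obtain ⟨b, hb, hl⟩ := Option.bind_eq_some_iff.mp h
    split_ifs at hl
    obtain rfl := Option.some.inj hl
    intro s hs
    obtain ⟨v, hv, rfl⟩ := List.mem_map.mp hs
    exact (hw b (List.mem_of_getElem? hb)).vars_sorted v hv
  | node n =>
    simp only [Workflow.arity] at h
    split_ifs at h
    obtain rfl := Option.some.inj h
    simp

theorem Formula.WellSorted.mono {S : Signature} {ar ar' : Pred → Option (List ℕ)}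
    (har : ∀ P l, ar P = some l → ar' P = some l) {φ : Formula} (h : φ.WellSorted S ar) :
    φ.WellSorted S ar' := by
  induction φ with
  | eq t t' => exact h
  | rel P ts =>
    obtain ⟨l, h1, h2⟩ := h
    exact ⟨l, har P l h1, h2⟩
  | not φ ih => exact ih h
  | or φ ψ ih ih' => exact ⟨ih h.1, ih' h.2⟩
  | ex v φ ih => exact ⟨h.1, ih h.2⟩
  | next φ ih => exact ih h
  | untl φ ψ ih ih' => exact ⟨ih h.1, ih' h.2⟩

theorem encode_lt_of_mem {α : Type} [Encodable α] {l : List α} {a : α} (h : a ∈ l) :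
    Encodable.encode a < Encodable.encode l := by
  induction l with
  | nil => simp at h
  | cons b l ih =>
    simp only [Encodable.encode_list_cons]
    have h1 := Nat.right_le_pair (Encodable.encode b) (Encodable.encode l)
    have h2 := Nat.left_le_pair (Encodable.encode b) (Encodable.encode l)
    rcases List.mem_cons.mp h with rfl | h
    · omega
    · have := ih h
      omega

theorem Term.code_le_of_mem_fv {t : Term} {v : Var} (h : v ∈ t.fv) : v.code ≤ t.code := by
  cases t with
  | var u =>
    obtain rfl : v = u := h
    exact Nat.right_le_pair _ _
  | const c => exact h.elim

/-- Hence a formula with code below `M` has all its free variables among the positions of a list of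
length `M`. -/
theorem Formula.code_le_of_mem_fv {φ : Formula} {v : Var} (h : v ∈ φ.fv) : v.code ≤ φ.code := by
  induction φ with
  | eq t t' =>
    have h1 := Nat.right_le_pair 0 (Nat.pair t.code t'.code)
    rcases h with h | h
    · exact (Term.code_le_of_mem_fv h).trans ((Nat.left_le_pair _ _).trans h1)
    · exact (Term.code_le_of_mem_fv h).trans ((Nat.right_le_pair _ _).trans h1)
  | rel P ts =>
    obtain ⟨t, ht, hv⟩ := h
    have h1 := encode_lt_of_mem (α := ℕ) (List.mem_map_of_mem (f := Term.code) ht)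
    exact (Term.code_le_of_mem_fv hv).trans (h1.le.trans ((Nat.right_le_pair _ _).trans
      (Nat.right_le_pair _ _)))
  | not φ ih => exact (ih h).trans (Nat.right_le_pair _ _)
  | or φ ψ ih ih' =>
    rcases h with h | h
    · exact (ih h).trans ((Nat.left_le_pair _ _).trans (Nat.right_le_pair _ _))
    · exact (ih' h).trans ((Nat.right_le_pair _ _).trans (Nat.right_le_pair _ _))
  | ex v φ ih => exact (ih h.1).trans ((Nat.right_le_pair _ _).trans (Nat.right_le_pair _ _))
  | next φ ih => exact (ih h).trans (Nat.right_le_pair _ _)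
  | untl φ ψ ih ih' =>
    rcases h with h | h
    · exact (ih h).trans ((Nat.left_le_pair _ _).trans (Nat.right_le_pair _ _))
    · exact (ih' h).trans ((Nat.right_le_pair _ _).trans (Nat.right_le_pair _ _))

/-! ### Coding of elements and valuations of the finite carrier -/

namespace Rep

variable {S : Signature} {w : Workflow} {φ : Declassification} {k : ℕ} {c : Ctx}

/-- The finite carrier given by `c`. -/
noncomputable abbrev carrier (h : Rep S w φ k c) : Carrier S where
  U := FinUniv c.elems
  nonempty s := ⟨⟨0, Or.inl rfl⟩⟩
  const i := toElem c.elems (c.cs.getD i 0)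
  const_sort i s hs := by
    obtain ⟨hi, rfl⟩ := List.getElem?_eq_some_iff.mp hs
    have := (h.good.2.2.2.2.1 i (by rw [h.consts]; exact hi)).2
    rw [h.consts, List.getD_eq_getElem _ _ hi] at this
    exact this

variable (h : Rep S w φ k c)
include h

theorem zero_mem {s : ℕ} (hs : s < c.M) : Nat.pair s 0 ∈ c.elems := h.good.1 s hs

theorem elemCode_mem {x : h.carrier.Elem} (hx : x.1 < c.M) : elemCode x ∈ c.elems := by
  obtain ⟨s, d, hd⟩ := x
  rcases hd with rfl | hd
  · exact h.zero_mem hx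
  · exact hd

theorem map_elemCode_mem {x : List h.carrier.Elem} (hx : x.length ≤ c.M)
    (hs : ∀ e ∈ x, e.1 < c.M) : x.map elemCode ∈ c.lists := by
  refine Ctx.mem_lists.mpr ⟨by simpa using hx, fun e he => ?_⟩
  obtain ⟨e', he', rfl⟩ := List.mem_map.mp he
  exact h.elemCode_mem (hs e' he')

theorem map_elemCode_mem_of_arity {P : Pred} {x : List h.carrier.Elem}
    (hx : w.arity S P = some (x.map Sigma.fst)) : x.map elemCode ∈ c.lists := by
  refine h.map_elemCode_mem (by simpa using (h.pred _ _ hx).2) fun e he => ?_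
  exact (Workflow.lt_numSorts_of_arity h.hS h.hw hx _ (List.mem_map_of_mem he)).trans_le h.sorts

/-- The number of the value of the variable with code `n`. -/
def entry (ν : h.carrier.Valuation) (n : ℕ) : ℕ :=
  Nat.pair n.unpair.1 (ν ⟨n.unpair.1, n.unpair.2⟩).1

theorem entry_code (ν : h.carrier.Valuation) (v : Var) :
    h.entry ν v.code = elemCode (E := c.elems) ⟨v.sort, ν v⟩ := by
  have : ∀ u : Var, u = v → Nat.pair u.sort (ν u).1 = Nat.pair v.sort (ν v).1 := by
    rintro u rfl
    rfl
  exact this _ v.mk_unpair_code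

/-- The list that represents a valuation. -/
def code (ν : h.carrier.Valuation) : List ℕ := (List.range c.M).map (h.entry ν)

/-- The valuation represented by a list. -/
noncomputable def decode (l : List ℕ) : h.carrier.Valuation :=
  fun v => FinUniv.mk c.elems v.sort (l.getD v.code 0).unpair.2

theorem length_code (ν : h.carrier.Valuation) : (h.code ν).length = c.M := by
  simp [code]

theorem getD_code' {ν : h.carrier.Valuation} {n : ℕ} (hn : n < c.M) :
    (h.code ν).getD n 0 = h.entry ν n := by
  rw [List.getD_eq_getElem _ _ (by simpa [code] using hn)]
  simp [code]

theorem getD_code {ν : h.carrier.Valuation} {v : Var} (hv : v.code < c.M) :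
    (h.code ν).getD v.code 0 = elemCode (E := c.elems) ⟨v.sort, ν v⟩ := by
  rw [h.getD_code' hv, h.entry_code]

theorem valid_code (ν : h.carrier.Valuation) : c.Valid (h.code ν) := by
  refine ⟨h.length_code ν, fun v hv => ?_⟩
  rw [h.getD_code' hv, entry, Nat.unpair_pair]

theorem code_mem (ν : h.carrier.Valuation) : h.code ν ∈ c.lists := by
  refine Ctx.mem_lists.mpr ⟨(h.length_code ν).le, fun e he => ?_⟩
  obtain ⟨v, hv, rfl⟩ := List.mem_map.mp he
  exact h.elemCode_mem (x := ⟨v.unpair.1, ν ⟨v.unpair.1, v.unpair.2⟩⟩)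
    ((Nat.unpair_left_le v).trans_lt (List.mem_range.mp hv))

theorem code_update {ν : h.carrier.Valuation} {v : Var} (d : h.carrier.U v.sort) :
    h.code (Function.update ν v d) =
      (h.code ν).set v.code (elemCode (E := c.elems) ⟨v.sort, d⟩) := by
  refine List.ext_getElem (by simp [code]) fun n h1 h2 => ?_
  simp only [code, List.getElem_map, List.getElem_range, List.getElem_set]
  split_ifs with hn
  · rw [← hn, h.entry_code]
    simp
  · rw [entry, entry, Function.update_of_ne]
    rintro rfl
    exact hn (by simp [Var.code])

theorem code_decode {l : List ℕ} (hl : l ∈ c.lists) (hv : c.Valid l) :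
    h.code (h.decode l) = l := by
  refine List.ext_getElem (by simp [code, hv.1]) fun n h1 h2 => ?_
  have hn : n < c.M := hv.1 ▸ h2
  have h3 := hv.2 n hn
  have h4 := (Ctx.mem_lists.mp hl).2 _ (List.getElem_mem h2)
  have h5 : l.getD n 0 = l[n] := List.getD_eq_getElem _ _ h2
  rw [h5] at h3
  have h6 : h.entry (h.decode l) n = l[n] := by
    simp only [entry, decode, Var.code, Nat.pair_unpair, h5]
    rw [FinUniv.val_mk (Or.inr (by rwa [← h3, Nat.pair_unpair])), ← h3, Nat.pair_unpair]
  simp [code, h6]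

/-- The converse of `code_decode` holds only on variables with code below `M`, which is enough for
the formulas considered. -/
theorem decode_code {ν : h.carrier.Valuation} {v : Var} (hv : v.code < c.M) :
    h.decode (h.code ν) v = ν v := by
  rw [decode, h.getD_code hv]
  simp only [elemCode, Nat.unpair_pair]
  exact FinUniv.mk_val _

theorem sat_decode_code (π : Trace w h.carrier) {F : Formula} (hF : F.code < c.M) {i : ℕ}
    {ν : h.carrier.Valuation} : π.sat F i (h.decode (h.code ν)) ↔ π.sat F i ν :=
  π.sat_congr fun _ hv => h.decode_code ((Formula.code_le_of_mem_fv hv).trans_lt hF)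

theorem termVal_code {ν : h.carrier.Valuation} {t : Term} {s : ℕ}
    (ht : S.termSort t = some s) (hv : ∀ v ∈ t.fv, v.code < c.M) :
    c.termVal (h.code ν) t.code = elemCode (E := c.elems) (h.carrier.val ν t) := by
  cases t with
  | var v =>
    rw [Ctx.termVal, Term.code, Nat.unpair_pair, if_pos rfl, h.getD_code (hv v rfl)]
    rfl
  | const i =>
    rw [Ctx.termVal, Term.code, Nat.unpair_pair, if_neg one_ne_zero]
    obtain ⟨hi, -⟩ := List.getElem?_eq_some_iff.mp ht
    exact (elemCode_toElem (h.good.2.2.2.2.1 i (by rw [h.consts]; exact hi)).1).symm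

theorem map_termVal_code {ν : h.carrier.Valuation} {ts : List Term} {l : List ℕ}
    (hts : ts.map S.termSort = l.map some) (hv : ∀ t ∈ ts, ∀ v ∈ t.fv, v.code < c.M) :
    (ts.map Term.code).map (fun t => c.termVal (h.code ν) t) =
      (ts.map (h.carrier.val ν)).map elemCode := by
  rw [List.map_map, List.map_map]
  refine List.map_congr_left fun t ht => ?_
  have h1 : S.termSort t ∈ l.map some := hts ▸ List.mem_map_of_mem ht
  obtain ⟨s, -, hs⟩ := List.mem_map.mp h1
  exact h.termVal_code hs.symm (hv t ht)

theorem map_fst_val {ν : h.carrier.Valuation} {ts : List Term} {l : List ℕ}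
    (hts : ts.map S.termSort = l.map some) : (ts.map (h.carrier.val ν)).map Sigma.fst = l := by
  have key : ∀ t s, S.termSort t = some s → (h.carrier.val ν t).1 = s := by
    intro t s ht
    cases t with
    | var v =>
      simp only [Signature.termSort] at ht
      split_ifs at ht
      exact Option.some.inj ht
    | const i => exact h.carrier.const_sort i s ht
  induction ts generalizing l with
  | nil =>
    cases l with
    | nil => rfl
    | cons => simp at hts
  | cons t ts ih =>
    cases l with
    | nil => simp at hts
    | cons s l =>
      simp only [List.map_cons, List.cons.injEq] at hts ⊢
      exact ⟨key t s hts.1, ih hts.2⟩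

theorem mem_nodes {n : ℕ} : n ∈ c.nodes ↔ n ∈ w.nodes := by
  simp only [Ctx.nodes, h.edges, List.mem_flatMap, mem_edgesOf, Workflow.nodes, Set.mem_ofPred_eq,
    List.mem_cons, List.not_mem_nil, or_false]
  constructor
  · rintro ⟨_, ⟨e, he, rfl⟩, hn⟩
    exact ⟨e, he, hn⟩
  · rintro ⟨e, he, hn⟩
    exact ⟨_, ⟨e, he, rfl⟩, hn⟩

end Rep

end MultiAgent

namespace MultiAgent

/-! ### States and pairs of traces -/

-- The search tests one tuple at a time by a Boolean fold, while the semantics folds sets; the two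
-- folds agree at each point.
open Classical in
theorem foldl_stmtCode_iff {α : Type} {x : α} {R : ℕ} {u : Stmt → Set α}
    {v : Ctx.StmtCode → Prop} {l : List Stmt}
    (hl : ∀ st ∈ l, v (st.guard.code, st.rel, st.add, st.args.map Term.code) ↔ x ∈ u st)
    {p : Bool} {X : Set α} (hp : p = true ↔ x ∈ X) :
    (l.map Stmt.code).foldl (fun acc s =>
        if (decodeD Ctx.StmtCode s).2.1 = R then
          if (decodeD Ctx.StmtCode s).2.2.1 = true then
            decide (acc = true ∨ v (decodeD Ctx.StmtCode s))
          else decide (acc = true ∧ ¬ v (decodeD Ctx.StmtCode s))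
        else acc) p = true ↔
      x ∈ l.foldl (fun X st => if st.rel = R then if st.add = true then X ∪ u st else X \ u st
        else X) X := by
  induction l generalizing p X with
  | nil => exact hp
  | cons st l ih =>
    have hu := hl st List.mem_cons_self
    have hd : decodeD Ctx.StmtCode st.code =
        (st.guard.code, st.rel, st.add, st.args.map Term.code) := decodeD_encode _
    rw [List.map_cons, List.foldl_cons, List.foldl_cons]
    refine ih (fun st' h => hl st' (List.mem_cons_of_mem _ h)) ?_
    rw [hd]
    dsimp only
    by_cases h1 : st.rel = R
    · by_cases h2 : st.add = true
      · rw [if_pos h1, if_pos h1, if_pos h2, if_pos h2, decide_eq_true_eq, hp, hu]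
        rfl
      · rw [if_pos h1, if_pos h1, if_neg h2, if_neg h2, decide_eq_true_eq, hp, hu]
        rfl
    · rwa [if_neg h1, if_neg h1]

namespace Rep

variable {S : Signature} {w : Workflow} {φ : Declassification} {k : ℕ} {c : Ctx}

/-- The states `q i` describe the traces `π 0` and `π 1`. -/
structure Agrees (h : Rep S w φ k c) (π : ℕ → Trace w h.carrier) (q : ℕ → State) : Prop where
  states : ∀ i, q i ∈ c.states
  of_rel : ∀ σ < 2, ∀ i P x, x ∈ (π σ).rel i P → (σ + 2, P.code, x.map elemCode) ∈ q i
  rel_of : ∀ σ < 2, ∀ i P (x : List h.carrier.Elem), w.arity S P = some (x.map Sigma.fst) →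
    (σ + 2, P.code, x.map elemCode) ∈ q i → x ∈ (π σ).rel i P
  wf : ∀ σ < 2, ∀ i R l, (σ + 2, Nat.pair 0 R, l) ∈ q i →
    ∃ x ∈ (π σ).rel i (.wf R), x.map elemCode = l
  sat : ∀ σ < 2, ∀ F : Formula, F.code ∈ c.forms → F.WellSorted S (w.arity S) →
    ∀ i ν, (π σ).sat F i ν ↔ (σ, F.code, h.code ν) ∈ q i

namespace Agrees

variable {h : Rep S w φ k c} {π : ℕ → Trace w h.carrier} {q : ℕ → State} (A : h.Agrees π q)
include A

theorem mem_facts {i : ℕ} {u : Fact} (hu : u ∈ q i) : u.2.1 < c.M ∧ u.2.2 ∈ c.lists :=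
  (Ctx.mem_facts.mp (Ctx.mem_facts_of_mem (A.states i) hu)).2

theorem at_iff {σ : ℕ} (hσ : σ < 2) {i n : ℕ} (hn : n ∈ w.nodes) :
    Ctx.At σ n (q i) ↔ (π σ).AtNode i n :=
  ⟨A.rel_of σ hσ i (.node n) [] (by simp [Workflow.arity, hn]), A.of_rel σ hσ i (.node n) []⟩

theorem wf_iff {σ : ℕ} (hσ : σ < 2) {i R : ℕ} {x : List h.carrier.Elem} :
    (σ + 2, Nat.pair 0 R, x.map elemCode) ∈ q i ↔ x ∈ (π σ).rel i (.wf R) := by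
  constructor
  · intro hx
    obtain ⟨y, hy, hyx⟩ := A.wf σ hσ i R _ hx
    rwa [← map_elemCode_injective hyx]
  · exact A.of_rel σ hσ i (.wf R) x

/-- Facts of a state stay below the bounds of `Low`, so nothing is missed. The converse is not
available from `Agrees`, which permits ill-sorted low facts; it is `low_stateSeq` for states built
from traces. -/
theorem lowInputs_of_low {i : ℕ} {a : h.carrier.Elem} (hl : c.Low (q i) (elemCode a)) :
    Trace.LowInputs (π 0) (π 1) a i := by
  have key : ∀ σ < 2, ∀ j x, a :: x ∈ (π σ).rel i (.low j) →
      j < c.M ∧ x.map elemCode ∈ c.lists := by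
    intro σ hσ j x hx
    obtain ⟨h1, h2⟩ := A.mem_facts (A.of_rel σ hσ i _ _ hx)
    refine ⟨(Nat.right_le_pair 2 j).trans_lt h1, Ctx.mem_lists.mpr ?_⟩
    obtain ⟨h3, h4⟩ := Ctx.mem_lists.mp h2
    exact ⟨by simp only [List.map_cons, List.length_cons] at h3; omega,
      fun e he => h4 e (List.mem_cons_of_mem _ he)⟩
  intro j x
  constructor
  · intro hx
    obtain ⟨h1, h2⟩ := key 0 (by omega) j x hx
    exact A.rel_of 1 (by omega) i (.low j) (a :: x) ((π 0).sorted _ _ _ hx)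
      ((hl j h1 _ h2).mp (A.of_rel 0 (by omega) i (.low j) _ hx))
  · intro hx
    obtain ⟨h1, h2⟩ := key 1 (by omega) j x hx
    exact A.rel_of 0 (by omega) i (.low j) (a :: x) ((π 1).sorted _ _ _ hx)
      ((hl j h1 _ h2).mpr (A.of_rel 1 (by omega) i (.low j) _ hx))

/-- An equivalence is possible here, since by `Agrees.wf` every workflow fact comes from a tuple of
the trace. -/
theorem obs_iff {i : ℕ} {a : h.carrier.Elem} :
    c.Obs (q i) (elemCode a) ↔ Trace.LowOutputs (π 0) (π 1) a i := by
  constructor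
  · intro ho R x
    by_cases hx : R < c.M ∧ x.map elemCode ∈ c.lists
    · have := ho R hx.1 _ hx.2
      rwa [← List.map_cons, A.wf_iff (σ := 0) (by omega), A.wf_iff (σ := 1) (by omega)] at this
    · have key : ∀ σ < 2, ¬ a :: x ∈ (π σ).rel i (.wf R) := by
        intro σ hσ hax
        obtain ⟨h1, h2⟩ := A.mem_facts (A.of_rel σ hσ i _ _ hax)
        obtain ⟨h3, h4⟩ := Ctx.mem_lists.mp h2
        exact hx ⟨(Nat.right_le_pair 0 R).trans_lt h1, Ctx.mem_lists.mpr
          ⟨by simp only [List.map_cons, List.length_cons] at h3; omega,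
            fun e he => h4 e (List.mem_cons_of_mem _ he)⟩⟩
      exact iff_of_false (key 0 (by omega)) (key 1 (by omega))
  · intro ho R _ x hx
    have : x = (x.map (toElem c.elems)).map elemCode :=
      (map_elemCode_toElem (Ctx.mem_lists.mp hx).2).symm
    rw [this, ← List.map_cons, A.wf_iff (σ := 0) (by omega), A.wf_iff (σ := 1) (by omega)]
    exact ho R _

/-- Valuations are replaced by their lists: guard, low input and arguments read only variables with
code below `M`. -/
theorem upd_iff {σ : ℕ} (hσ : σ < 2) {e : Workflow.Edge} (he : e ∈ w.edges) {j : ℕ} {b : Block}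
    (hb : e.label = some (j, b)) {st : Stmt} (hst : st ∈ b.stmts) {i : ℕ}
    {x : List h.carrier.Elem} :
    c.Upd (q i) σ j (b.may, b.vars.map Var.code, b.stmts.map Stmt.code)
      (st.guard.code, st.rel, st.add, st.args.map Term.code) (x.map elemCode) ↔
      x ∈ (π σ).updates i j b st := by
  have hbj := Workflow.blocks_getElem?_of_mem_edges he hb
  have hbm := List.mem_of_getElem? hbj
  have hwf := (h.hw b hbm).stmts st hst
  obtain ⟨l, -, hl⟩ := hwf.args_sorted
  have hguard : st.guard.code ∈ c.forms := by
    have := h.good.2.2.1 e.toNat (by rw [h.edges, mem_edgesOf]; exact ⟨e, he, rfl⟩)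
      (by simp [Workflow.Edge.toNat, hb]) st.code
      (by
        simp only [Workflow.Edge.toNat, hb, Option.elim_some]
        rw [Block.code, decodeD_encode]
        exact List.mem_map_of_mem hst)
    rwa [Stmt.code, decodeD_encode] at this
  have hsat := A.sat σ hσ st.guard hguard
    (hwf.guard_sorted.mono fun _ _ => Workflow.arity_eq_of_arity) i
  have hvars : ∀ v ∈ b.vars, v.code < c.M := h.vars b hbm
  have hargs : ∀ t ∈ st.args, ∀ v ∈ t.fv, v.code < c.M :=
    fun t ht v hv => hvars v (hwf.args_fv ⟨t, ht, hv⟩)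
  have hlow : ∀ ν : h.carrier.Valuation, (b.may = true → (σ + 2, Nat.pair 2 j,
      (b.vars.map Var.code).map fun v => (h.code ν).getD v 0) ∈ q i) ↔
      (b.may = true → (b.vars.map fun v => (⟨v.sort, ν v⟩ : h.carrier.Elem)) ∈
        (π σ).rel i (.low j)) := by
    intro ν
    refine forall_congr' fun hmay => ?_
    have : ((b.vars.map Var.code).map fun v => (h.code ν).getD v 0) =
        (b.vars.map fun v => (⟨v.sort, ν v⟩ : h.carrier.Elem)).map elemCode := by
      rw [List.map_map, List.map_map]
      exact List.map_congr_left fun v hv => h.getD_code (hvars v hv)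
    rw [this]
    refine ⟨A.rel_of σ hσ i (.low j) _ ?_, A.of_rel σ hσ i (.low j) _⟩
    simp [Workflow.arity, hbj, hmay, Function.comp_def]
  constructor
  · rintro ⟨l, hl1, hl2, hg, hm, hx⟩
    rw [← h.code_decode hl1 hl2] at hg hm hx
    refine ⟨h.decode l, (hsat _).mpr hg, (hlow _).mp hm, ?_⟩
    exact map_elemCode_injective (hx.trans (h.map_termVal_code hl hargs))
  · rintro ⟨ν, hg, hm, rfl⟩
    exact ⟨h.code ν, h.code_mem ν, h.valid_code ν, (hsat ν).mp hg, (hlow ν).mpr hm,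
      (h.map_termVal_code hl hargs).symm⟩

theorem post_iff {σ : ℕ} (hσ : σ < 2) {e : Workflow.Edge} (he : e ∈ w.edges) {i R : ℕ}
    {x : List h.carrier.Elem} :
    c.postB (q i) σ e.toNat R (x.map elemCode) = true ↔ x ∈ (π σ).post i e.label R := by
  have h0 := A.wf_iff hσ (i := i) (R := R) (x := x)
  obtain ⟨src, dst, _ | ⟨j, b⟩⟩ := e
  · exact decide_eq_true_iff.trans h0
  · have hd : decodeD Ctx.BlockCode b.code =
        (b.may, b.vars.map Var.code, b.stmts.map Stmt.code) := decodeD_encode _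
    have he' : Workflow.Edge.toNat ⟨src, dst, some (j, b)⟩ = (src, dst, j + 1, b.code) := rfl
    rw [he', Ctx.postB, if_neg (Nat.succ_ne_zero j), hd]
    exact foldl_stmtCode_iff (R := R) (l := b.stmts) (v := fun st => c.Upd (q i) σ j
        (b.may, b.vars.map Var.code, b.stmts.map Stmt.code) st (x.map elemCode))
      (fun st hst => A.upd_iff hσ he rfl hst) (decide_eq_true_iff.trans h0)

-- `Ctx.Trans` compares relations on tuples of `lists` only; no update leads outside these, because
-- the arguments of statements are well-sorted.
omit A in
theorem mem_lists_of_mem_post (π : Trace w h.carrier) {e : Workflow.Edge} (he : e ∈ w.edges)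
    {i R : ℕ} {x : List h.carrier.Elem} (hx : x ∈ π.post i e.label R) :
    x.map elemCode ∈ c.lists := by
  have hrel : x ∈ π.rel i (.wf R) → x.map elemCode ∈ c.lists :=
    fun hx => h.map_elemCode_mem_of_arity (π.sorted _ _ _ hx)
  rcases hlab : e.label with _ | ⟨j, b⟩
  · rw [hlab] at hx
    exact hrel hx
  · have hbm := List.mem_of_getElem? (Workflow.blocks_getElem?_of_mem_edges he hlab)
    have : ∀ (l : List Stmt), (∀ st ∈ l, st ∈ b.stmts) → ∀ (X : Set (List h.carrier.Elem)),
        (x ∈ X → x.map elemCode ∈ c.lists) →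
        x ∈ l.foldl (fun X st => if st.rel = R then if st.add = true then
          X ∪ π.updates i j b st else X \ π.updates i j b st else X) X →
        x.map elemCode ∈ c.lists := by
      intro l
      induction l with
      | nil => exact fun _ _ hX => hX
      | cons st l ih =>
        intro hl X hX
        refine ih (fun st' h => hl st' (List.mem_cons_of_mem _ h)) _ ?_
        dsimp only
        split_ifs
        · rintro (hx | ⟨ν, -, -, rfl⟩)
          · exact hX hx
          · obtain ⟨l, hl1, hl2⟩ := ((h.hw b hbm).stmts st (hl st List.mem_cons_self)).args_sorted
            refine h.map_elemCode_mem_of_arity (P := .wf st.rel) ?_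
            rw [h.map_fst_val hl2]
            exact hl1
        · exact fun hx => hX hx.1
        · exact hX
    rw [hlab] at hx
    exact this b.stmts (fun _ h => h) _ hrel hx

theorem exec_iff {σ : ℕ} (hσ : σ < 2) {e : Workflow.Edge} (he : e ∈ w.edges) {i R : ℕ} :
    (∀ y ∈ c.lists, (σ + 2, Nat.pair 0 R, y) ∈ q (i + 1) ↔
      c.postB (q i) σ e.toNat R y = true) ↔
    (π σ).rel (i + 1) (.wf R) = (π σ).post i e.label R := by
  constructor
  · intro hy
    ext x
    have key : x.map elemCode ∈ c.lists →
        (x ∈ (π σ).rel (i + 1) (.wf R) ↔ x ∈ (π σ).post i e.label R) := by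
      intro hx
      rw [← A.wf_iff hσ, hy _ hx, A.post_iff hσ he]
    constructor
    · intro hx
      exact (key (h.map_elemCode_mem_of_arity ((π σ).sorted _ _ _ hx))).mp hx
    · intro hx
      exact (key (mem_lists_of_mem_post (π σ) he hx)).mpr hx
  · intro heq y hy
    rw [← map_elemCode_toElem (Ctx.mem_lists.mp hy).2, A.wf_iff hσ, heq, A.post_iff hσ he]

end Agrees

theorem tupleVars_eq (l : List ℕ) :
    Declassification.tupleVars l = (List.range l.length).map fun i => ⟨l.getD i 0, i + 1⟩ := by
  refine List.ext_getElem (by simp [Declassification.tupleVars]) fun n h1 h2 => ?_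
  have : n < l.length := by simpa using h2
  simp [Declassification.tupleVars, this]

theorem map_sort_tupleVars (l : List ℕ) : (Declassification.tupleVars l).map Var.sort = l := by
  refine List.ext_getElem (by simp [Declassification.tupleVars]) fun n h1 h2 => ?_
  simp [Declassification.tupleVars]

theorem cond_iff (h : Rep S w φ k c) {O s : ℕ} (hO : O < c.high.length) (hs : s < c.numAgent) :
    ∃ ψ, φ.Cond O s ψ ∧ (c.cond.getD O []).getD s 0 = ψ.code ∧ ψ.code ∈ c.forms := by
  have hO' : O < φ.length := by rw [h.hφ.rows, ← h.high]; exact hO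
  have hs' : s < φ[O].length := by
    rw [h.hφ.cols _ (List.getElem_mem hO'), ← h.numAgent]
    exact hs
  refine ⟨φ[O][s], ⟨φ[O], List.getElem?_eq_getElem hO', List.getElem?_eq_getElem hs'⟩, ?_, ?_⟩
  · rw [h.cond]
    simp [hO', hs']
  · refine h.good.2.2.2.1 (φ[O].map Formula.code) ?_ _ (List.mem_map_of_mem (List.getElem_mem hs'))
    rw [h.cond]
    exact List.mem_map_of_mem (List.getElem_mem hO')

theorem Cond.unique {φ : Declassification} {O s : ℕ} {ψ ψ' : Formula} (h : φ.Cond O s ψ)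
    (h' : φ.Cond O s ψ') : ψ = ψ' := by
  obtain ⟨r, h1, h2⟩ := h
  obtain ⟨r', h1', h2'⟩ := h'
  obtain rfl := Option.some.inj (h1.symm.trans h1')
  exact Option.some.inj (h2.symm.trans h2')

/-- The valuation in the semantics and its code carry the same agent and tuple, since the codes of
`a` and of `ȳ` are below `M`. -/
theorem Agrees.high_iff {h : Rep S w φ k c} {π : ℕ → Trace w h.carrier} {q : ℕ → State}
    (A : h.Agrees π q) : (∀ i, c.HighOK (q i)) ↔
      Trace.HighInputs φ (π 0) (π 1) (toElem c.elems c.ag) := by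
  obtain ⟨hag, hags⟩ := h.good.2.2.2.2.2.2
  have hag' : elemCode (toElem c.elems c.ag) = c.ag := elemCode_toElem hag
  have hsS : c.ag.unpair.1 < S.numAgentSorts := by rw [← h.numAgent]; exact hags
  have hν : ∀ ν : h.carrier.Valuation, (h.code ν).getD (Nat.pair c.ag.unpair.1 0) 0 = c.ag ↔
      ν (Declassification.agentVar c.ag.unpair.1) = (toElem c.elems c.ag).2 := by
    intro ν
    have := h.getD_code (ν := ν) (h.agentVar _ hsS)
    have h2 : (Declassification.agentVar c.ag.unpair.1).code = Nat.pair c.ag.unpair.1 0 := rfl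
    rw [h2] at this
    rw [this]
    conv_lhs => rhs; rw [← hag']
    rw [elemCode_injective.eq_iff]
    constructor
    · intro heq
      exact eq_of_heq (Sigma.mk.inj heq).2
    · intro heq
      exact congrArg (Sigma.mk c.ag.unpair.1) heq
  have htup : ∀ O l, S.highRels[O]? = some l → ∀ ν : h.carrier.Valuation,
      ((List.range (c.high.getD O []).length).map fun i =>
        (h.code ν).getD (Nat.pair ((c.high.getD O []).getD i 0) (i + 1)) 0) =
      ((Declassification.tupleVars l).map
        fun v => (⟨v.sort, ν v⟩ : h.carrier.Elem)).map elemCode := by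
    intro O l hO ν
    have hl : c.high.getD O [] = l := by
      rw [h.high, List.getD_eq_getElem?_getD, hO]
      rfl
    have hb := h.tuple l (List.mem_of_getElem? hO)
    rw [hl, tupleVars_eq] at *
    rw [List.map_map, List.map_map]
    refine List.map_congr_left fun i hi => ?_
    exact h.getD_code (hb _ (List.mem_map_of_mem hi))
  have hrel : ∀ σ < 2, ∀ i O l, S.highRels[O]? = some l → ∀ ν : h.carrier.Valuation,
      ((σ + 2, Nat.pair 1 O, (List.range (c.high.getD O []).length).map fun i =>
        (h.code ν).getD (Nat.pair ((c.high.getD O []).getD i 0) (i + 1)) 0) ∈ q i ↔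
      ((Declassification.tupleVars l).map fun v => (⟨v.sort, ν v⟩ : h.carrier.Elem)) ∈
        (π σ).rel i (.high O)) := by
    intro σ hσ i O l hO ν
    rw [htup O l hO ν]
    refine ⟨A.rel_of σ hσ i (.high O) _ ?_, A.of_rel σ hσ i (.high O) _⟩
    simp only [List.map_map, Function.comp_def, map_sort_tupleVars]
    exact hO
  constructor
  · intro hq i O l ψ hO hψ ν hνa hsat
    have hOlt : O < c.high.length := by
      rw [h.high]
      exact (List.getElem?_eq_some_iff.mp hO).1
    obtain ⟨ψ', hψ', hcode, hforms⟩ := h.cond_iff hOlt hags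
    obtain rfl := Cond.unique hψ hψ'
    have := hq i O hOlt (h.code ν) (h.code_mem ν) (h.valid_code ν) ((hν ν).mpr hνa)
    rw [hrel 0 (by omega) i O l hO, hrel 1 (by omega) i O l hO, hcode] at this
    have hws := h.hφ.sorted O _ ψ hψ
    rw [A.sat 0 (by omega) ψ hforms hws, A.sat 1 (by omega) ψ hforms hws] at hsat
    exact this hsat
  · intro hh i O hO ν hν1 hν2 hνa hsat
    obtain ⟨ψ, hψ, hcode, hforms⟩ := h.cond_iff hO hags
    have hO' : S.highRels[O]? = some (S.highRels[O]'(by rw [← h.high]; exact hO)) :=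
      List.getElem?_eq_getElem _
    rw [← h.code_decode hν1 hν2] at hνa hsat ⊢
    rw [hrel 0 (by omega) i O _ hO', hrel 1 (by omega) i O _ hO']
    have hws := h.hφ.sorted O _ ψ hψ
    rw [hcode, ← A.sat 0 (by omega) ψ hforms hws, ← A.sat 1 (by omega) ψ hforms hws] at hsat
    exact hh i O _ ψ hO' hψ _ ((hν _).mp hνa) hsat

end Rep

end MultiAgent

/-! ### From runs of the search problem to counterexamples -/

namespace MultiAgent
namespace Rep

variable {S : Signature} {w : Workflow} {φ : Declassification} {k : ℕ} {c : Ctx}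

theorem getD_ca_mem (h : Rep S w φ k c) (i : Fin k) : c.ca.getD i 0 ∈ c.ca := by
  have hi : (i : ℕ) < c.ca.length := by
    rw [h.good.2.2.2.2.2.1.1, h.card]
    exact i.2
  rw [List.getD_eq_getElem _ _ hi]
  exact List.getElem_mem hi

/-- The causal agents. -/
noncomputable def causalAgent (h : Rep S w φ k c) (i : Fin k) : h.carrier.Agent :=
  ⟨toElem c.elems (c.ca.getD i 0), by
    have := (h.good.2.2.2.2.2.1.2 _ (h.getD_ca_mem i)).2
    rw [h.numAgent] at this
    exact this⟩

/-- The observing agent. -/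
noncomputable def agent (h : Rep S w φ k c) : h.carrier.Agent :=
  ⟨toElem c.elems c.ag, by
    have := h.good.2.2.2.2.2.2.2
    rw [h.numAgent] at this
    exact this⟩

theorem elemCode_agent (h : Rep S w φ k c) : elemCode (E := c.elems) h.agent.1 = c.ag :=
  elemCode_toElem h.good.2.2.2.2.2.2.1

theorem elemCode_causalAgent (h : Rep S w φ k c) (i : Fin k) :
    elemCode (E := c.elems) (h.causalAgent i).1 = c.ca.getD i 0 :=
  elemCode_toElem (h.good.2.2.2.2.2.1.2 _ (h.getD_ca_mem i)).1

theorem exists_causalAgent (h : Rep S w φ k c) {e : ℕ} (he : e ∈ c.ca) :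
    ∃ i, (h.causalAgent i).1 = toElem c.elems e := by
  obtain ⟨i, hi, rfl⟩ := List.getElem_of_mem he
  have hk : i < k := by
    rw [← h.card, ← h.good.2.2.2.2.2.1.1]
    exact hi
  refine ⟨⟨i, hk⟩, ?_⟩
  simp only [causalAgent, List.getD_eq_getElem _ _ hi]

theorem agent_elemCode_mem (h : Rep S w φ k c) (b : h.carrier.Agent) :
    elemCode (E := c.elems) b.1 ∈ c.elems :=
  h.elemCode_mem (b.2.trans_le ((Nat.le_add_right _ _).trans h.sorts))

theorem term_var_lt (h : Rep S w φ k c) {F : Formula} (hF : F.code ∈ c.forms) {v : Var}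
    (hv : v ∈ F.fv) : v.code < c.M :=
  (Formula.code_le_of_mem_fv hv).trans_lt (h.forms _ hF)

/-- The traces described by a sequence of states. -/
def runTrace (h : Rep S w φ k c) (q : ℕ → State) (σ : ℕ) : Trace w h.carrier where
  rel i P := {x | w.arity S P = some (x.map Sigma.fst) ∧
    (σ + 2, P.code, x.map elemCode) ∈ q i}
  sorted _ _ _ hx := hx.1

/-- Truth lemma of the tableau. Local consistency settles all connectives except until, for which
fulfilment of the promises is needed as well. -/
theorem sat_runTrace (h : Rep S w φ k c) {q : ℕ → State} (hq : c.IsRun q) {σ : ℕ} (hσ : σ < 2)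
    (F : Formula) (hF : F.code ∈ c.forms) (hs : F.WellSorted S (w.arity S)) (i : ℕ)
    (ν : h.carrier.Valuation) :
    (h.runTrace q σ).sat F i ν ↔ (σ, F.code, h.code ν) ∈ q i := by
  have hclosed := h.good.2.1
  have step : ∀ {F : Formula}, F.code ∈ c.forms → ∀ i ν,
      c.FormOK (q i) (q (i + 1)) σ F.code (h.code ν) := fun hF i ν =>
    (hq.trans i).2.1 σ hσ _ hF _ (h.code_mem ν) (h.valid_code ν)
  induction F generalizing i ν with
  | eq t t' =>
    have hf := (step hF i ν).1 (by simp [Formula.code])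
    obtain ⟨s, h1, h2⟩ := hs
    have e1 := h.termVal_code (ν := ν) h1 fun v hv => h.term_var_lt hF (Or.inl hv)
    have e2 := h.termVal_code (ν := ν) h2 fun v hv => h.term_var_lt hF (Or.inr hv)
    rw [hf]
    simp only [Formula.code, Nat.unpair_pair, e1, e2, elemCode_injective.eq_iff]
    rfl
  | rel P ts =>
    have hf := (step hF i ν).2.1 (by simp [Formula.code])
    obtain ⟨l, h1, h2⟩ := hs
    have e1 := h.map_termVal_code (ν := ν) h2 fun t ht v hv => h.term_var_lt hF ⟨t, ht, hv⟩
    rw [hf]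
    simp only [Formula.code, Nat.unpair_pair, decodeD_encode, e1]
    refine and_iff_right ?_
    rw [h.map_fst_val h2]
    exact h1
  | not F ih =>
    have hf := (step hF i ν).2.2.1 (by simp [Formula.code])
    have hc := (hclosed _ hF).1
    simp only [Formula.code, Nat.unpair_pair, true_or, forall_const] at hf hc
    exact (not_congr (ih hc hs i ν)).trans hf.symm
  | or F G ih ih' =>
    have hf := (step hF i ν).2.2.2.1 (by simp [Formula.code])
    have hc := (hclosed _ hF).2.1
    simp only [Formula.code, Nat.unpair_pair, true_or, forall_const] at hf hc
    exact (or_congr (ih hc.1 hs.1 i ν) (ih' hc.2 hs.2 i ν)).trans hf.symm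
  | ex v F ih =>
    have hf := (step hF i ν).2.2.2.2.1 (by simp [Formula.code])
    have hc := (hclosed _ hF).2.2
    simp only [Formula.code, Nat.unpair_pair, forall_const] at hf hc
    refine Iff.trans ?_ hf.symm
    have hvs : v.code.unpair.1 = v.sort := by simp [Var.code]
    rw [hvs]
    constructor
    · rintro ⟨d, hd⟩
      have hd := (ih hc hs.2 _ _).mp hd
      rw [h.code_update] at hd
      exact ⟨_, h.elemCode_mem (x := ⟨v.sort, d⟩) (hs.1.trans_le h.sorts), by simp, hd⟩
    · rintro ⟨e, he, hes, hd⟩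
      have h1 := elemCode_toElem he
      have h2 : (toElem c.elems e).1 = v.sort := hes
      generalize toElem c.elems e = x at h1 h2
      obtain ⟨s, d⟩ := x
      obtain rfl : s = v.sort := h2
      refine ⟨d, (ih hc hs.2 _ _).mpr ?_⟩
      rw [h.code_update]
      rwa [← h1] at hd
  | next F ih =>
    have hf := (step hF i ν).2.2.2.2.2.1 (by simp [Formula.code])
    have hc := (hclosed _ hF).1
    simp only [Formula.code, Nat.unpair_pair, or_true, forall_const] at hf hc
    exact (ih hc hs (i + 1) ν).trans hf.symm
  | untl F G ih ih' =>
    have hf := fun i => (step hF i ν).2.2.2.2.2.2 (by simp [Formula.code])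
    have hc := (hclosed _ hF).2.1
    have hu : ∀ i, (σ, (Formula.untl F G).code, h.code ν) ∈ q i →
        ∃ j ≥ i, (σ, G.code, h.code ν) ∈ q j := by
      intro i hi
      have := hq.untl i _ hi ⟨hσ, hF, by simp [Formula.code], h.code_mem ν, h.valid_code ν⟩
      simpa [Ctx.goal, Formula.code] using this
    simp only [Formula.code, Nat.unpair_pair, or_true, forall_const] at hf hc hu
    have e1 := fun i => ih hc.1 hs.1 i ν
    have e2 := fun i => ih' hc.2 hs.2 i ν
    simp only [Formula.code, Trace.sat, e1, e2]
    constructor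
    · rintro ⟨j, hj, hG, hlt⟩
      -- Truth of the until is propagated backwards from the time of fulfilment by the unfolding
      -- law.
      induction hj using Nat.decreasingInduction with
      | self => exact (hf _).mpr (Or.inl hG)
      | of_succ l hl ihl =>
        exact (hf l).mpr (Or.inr ⟨hlt l le_rfl hl,
          ihl fun m hm => hlt m ((Nat.le_succ l).trans hm)⟩)
    · intro hi
      classical
      -- At the first time of fulfilment the goal holds; before it the until is pending, so the
      -- unfolding law yields the left argument.
      have hex := hu i hi
      have hspec := Nat.find_spec hex
      have hmin : ∀ l, i ≤ l → l < Nat.find hex → (σ, G.code, h.code ν) ∉ q l :=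
        fun l hl hlt hG => Nat.find_min hex hlt ⟨hl, hG⟩
      refine ⟨Nat.find hex, hspec.1, hspec.2, ?_⟩
      have hpend : ∀ l, i ≤ l → l < Nat.find hex →
          (σ, Nat.pair 6 (Nat.pair F.code G.code), h.code ν) ∈ q l := by
        intro l hl
        induction l, hl using Nat.le_induction with
        | base => exact fun _ => hi
        | succ l hl ihl =>
          intro hlt
          have hl' : l < Nat.find hex := (Nat.lt_succ_self l).trans hlt
          exact (((hf l).mp (ihl hl')).resolve_left (hmin l hl hl')).2
      intro l hl hlt
      exact (((hf l).mp (hpend l hl hlt)).resolve_left (hmin l hl hlt)).1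

theorem agrees_runTrace (h : Rep S w φ k c) {q : ℕ → State} (hq : c.IsRun q) :
    h.Agrees (h.runTrace q) q where
  states := hq.mem
  of_rel _ _ _ _ _ hx := hx.2
  rel_of _ _ _ _ _ hx hx' := ⟨hx, hx'⟩
  wf σ hσ i R l hl := by
    have h1 := (Ctx.mem_facts.mp (Ctx.mem_facts_of_mem (hq.mem i) hl)).2
    have h2 := (hq.trans i).1.1 σ hσ R ((Nat.right_le_pair 0 R).trans_lt h1.1) l h1.2 hl
    dsimp only at h1
    have h3 := map_elemCode_toElem (Ctx.mem_lists.mp h1.2).2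
    rw [← h3] at hl
    refine ⟨l.map (toElem c.elems), ⟨?_, hl⟩, h3⟩
    have h4 : S.wfRels[R]? = some (l.map fun e => e.unpair.1) := by
      rw [← h.wf, ← h2.2, List.getD_eq_getElem _ _ h2.1, List.getElem?_eq_getElem h2.1]
    simpa [Workflow.arity, Signature.arity, toElem, Function.comp_def] using h4
  sat _ hσ F hF hs i ν := h.sat_runTrace hq hσ F hF hs i ν

theorem Agrees.isExecution {h : Rep S w φ k c} {q : ℕ → State} (hq : c.IsRun q)
    {π : ℕ → Trace w h.carrier} (A : h.Agrees π q) {σ : ℕ} (hσ : σ < 2) :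
    (π σ).IsExecution where
  cfg i n hn hat := by
    obtain ⟨e, he, rfl, hat'⟩ :=
      (hq.trans i).2.2.1 σ hσ n (h.mem_nodes.mpr hn) ((A.at_iff hσ hn).mpr hat)
    rw [h.edges, mem_edgesOf] at he
    obtain ⟨e', he', rfl⟩ := he
    exact ⟨e', he', rfl, (A.at_iff hσ ⟨e', he', Or.inr rfl⟩).mp hat'⟩
  sanity i n hn n' hn' hne := by
    rw [← A.at_iff hσ hn, ← A.at_iff hσ hn']
    exact (hq.trans i).1.2.1 σ hσ n (h.mem_nodes.mpr hn) n' (h.mem_nodes.mpr hn') hne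
  init_node := by
    have h0 := hq.init.1 σ hσ
    refine ⟨A.rel_of σ hσ 0 (.node Workflow.entry) [] ?_ h0.1, fun n hn hne => ?_⟩
    · have : Workflow.entry ∈ w.nodes := by
        cases w with
        | block b => exact ⟨⟨0, 1, some (0, b)⟩, by simp [Workflow.edges, Workflow.build,
            Workflow.entry, Workflow.final], Or.inl rfl⟩
        | seq b w => exact ⟨⟨0, 2, some (0, b)⟩, by simp [Workflow.edges, Workflow.build,
            Workflow.entry], Or.inl rfl⟩
        | loop w => exact ⟨⟨0, 1, none⟩, by simp [Workflow.edges, Workflow.build,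
            Workflow.entry, Workflow.final], Or.inl rfl⟩
        | choice w w' => exact ⟨⟨0, 2, none⟩, by simp [Workflow.edges, Workflow.build,
            Workflow.entry], Or.inl rfl⟩
      simp [Workflow.arity, this]
    · rw [← A.at_iff hσ hn]
      exact h0.2 n (h.mem_nodes.mpr hn) hne
  init_rel R := by
    ext x
    refine iff_of_false (fun hx => ?_) id
    have ha : S.wfRels[R]? = some (x.map Sigma.fst) := (π σ).sorted _ _ _ hx
    refine hq.init.2.1 σ hσ R ?_ _ (h.map_elemCode_mem_of_arity (P := .wf R) ha)
      (A.of_rel σ hσ 0 (.wf R) x hx)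
    rw [h.wf]
    exact (List.getElem?_eq_some_iff.mp ha).1
  exec i e he h1 h2 R hR := by
    refine (A.exec_iff hσ he).mp ((hq.trans i).2.2.2.1 σ hσ e.toNat ?_ ?_ ?_ R ?_)
    · rw [h.edges, mem_edgesOf]
      exact ⟨e, he, rfl⟩
    · exact (A.at_iff hσ ⟨e, he, Or.inl rfl⟩).mpr h1
    · exact (A.at_iff hσ ⟨e, he, Or.inr rfl⟩).mpr h2
    · rw [h.wf]
      exact hR

/-- A flag can be traced back to an earlier or simultaneous difference. So before the first
difference no flag is set, and the low inputs must agree. -/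
theorem Agrees.causal {h : Rep S w φ k c} {q : ℕ → State} (hq : c.IsRun q)
    {π : ℕ → Trace w h.carrier} (A : h.Agrees π q) {e : ℕ} (he : e ∈ c.ca) :
    Trace.Causal (π 0) (π 1) (toElem c.elems e) := by
  classical
  have hec : elemCode (toElem c.elems e) = e :=
    elemCode_toElem (h.good.2.2.2.2.2.1.2 e he).1
  have hflag : ∀ i, (4, 0, [e]) ∈ q i →
      ∃ j ≤ i, ¬ Trace.LowOutputs (π 0) (π 1) (toElem c.elems e) j := by
    intro i
    induction i with
    | zero => exact fun hi => (hq.init.2.2 e he hi).elim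
    | succ i ih =>
      intro hi
      rcases (hq.trans i).2.2.2.2 e he hi with hi' | hi'
      · obtain ⟨j, hj, hj'⟩ := ih hi'
        exact ⟨j, hj.trans (Nat.le_succ i), hj'⟩
      · refine ⟨i + 1, le_rfl, ?_⟩
        rwa [← A.obs_iff, hec]
  have hlow : ∀ i, (∀ j ≤ i, Trace.LowOutputs (π 0) (π 1) (toElem c.elems e) j) →
      Trace.LowInputs (π 0) (π 1) (toElem c.elems e) i := by
    intro i hi
    refine A.lowInputs_of_low ?_
    rw [hec]
    refine ((hq.trans i).1.2.2.2.2.1 e he).resolve_left fun hf => ?_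
    obtain ⟨j, hj, hj'⟩ := hflag i hf
    exact hj' (hi j hj)
  by_cases hex : ∃ j, ¬ Trace.LowOutputs (π 0) (π 1) (toElem c.elems e) j
  · refine Or.inl ⟨Nat.find hex, Nat.find_spec hex, fun i hi => hlow i fun j hj => ?_⟩
    exact not_not.mp (Nat.find_min hex (hj.trans_lt hi))
  · push Not at hex
    exact Or.inr fun i => hlow i fun j _ => hex j

theorem violates_of_isRun (h : Rep S w φ k c) {q : ℕ → State} (hq : c.IsRun q) :
    Trace.Violates φ k (h.runTrace q 0) (h.runTrace q 1) h.causalAgent h.agent := by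
  have A := h.agrees_runTrace hq
  refine ⟨A.isExecution hq (by omega), A.isExecution hq (by omega),
    fun i => A.causal hq (h.getD_ca_mem i), fun b hb i => ?_, fun i n hn => ?_, fun i => ?_,
    A.high_iff.mp fun i => (hq.trans i).1.2.2.2.2.2.1, ?_⟩
  · refine A.lowInputs_of_low ((hq.trans i).1.2.2.2.1 _ (h.agent_elemCode_mem b) ?_ ?_)
    · rw [unpair_elemCode_fst, h.numAgent]
      exact b.2
    · intro hmem
      obtain ⟨m, hm⟩ := h.exists_causalAgent hmem
      refine hb m (Subtype.ext ?_)
      rw [hm, toElem_elemCode]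
  · rw [← A.at_iff (σ := 0) (by omega) hn, ← A.at_iff (σ := 1) (by omega) hn]
    exact (hq.trans i).1.2.2.1 n (h.mem_nodes.mpr hn)
  · refine A.lowInputs_of_low ?_
    rw [h.elemCode_agent]
    exact (hq.trans i).1.2.2.2.2.2.2
  · obtain ⟨i, hi⟩ := hq.obs
    refine ⟨i, ?_⟩
    rwa [← A.obs_iff, h.elemCode_agent]

end Rep
end MultiAgent

/-! ### From counterexamples over finite carriers to runs -/

namespace MultiAgent
namespace Rep

variable {S : Signature} {w : Workflow} {φ : Declassification} {k : ℕ} {c : Ctx}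

/-- The facts about the pair of traces `π 0` and `π 1`. -/
def TrueFact (h : Rep S w φ k c) (π : ℕ → Trace w h.carrier) (i : ℕ) (u : Fact) : Prop :=
  (u.1 < 2 ∧ ∃ F : Formula, F.code = u.2.1 ∧ (π u.1).sat F i (h.decode u.2.2)) ∨
  (∃ σ < 2, u.1 = σ + 2 ∧ ∃ P, Pred.code P = u.2.1 ∧ ∃ x ∈ (π σ).rel i P, x.map elemCode = u.2.2) ∨
  (u.1 = 4 ∧ ∃ e, u.2.2 = [e] ∧ ∃ j ≤ i, ¬ Trace.LowOutputs (π 0) (π 1) (toElem c.elems e) j)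

open Classical in
/-- The sequence of states that describes the traces `π 0` and `π 1`. -/
noncomputable def stateSeq (h : Rep S w φ k c) (π : ℕ → Trace w h.carrier) (i : ℕ) : State :=
  c.facts.filter fun u => h.TrueFact π i u

section

variable (h : Rep S w φ k c) (π : ℕ → Trace w h.carrier)

theorem mem_stateSeq {i : ℕ} {u : Fact} : u ∈ h.stateSeq π i ↔ u ∈ c.facts ∧ h.TrueFact π i u := by
  simp [stateSeq]

/-- The three kinds of facts have disjoint tags, and a formula is determined by its code. -/
theorem mem_stateSeq_sat {σ : ℕ} (hσ : σ < 2) {F : Formula} (hF : F.code < c.M) {i : ℕ}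
    {ν : h.carrier.Valuation} : (σ, F.code, h.code ν) ∈ h.stateSeq π i ↔ (π σ).sat F i ν := by
  rw [mem_stateSeq, Ctx.mem_facts]
  constructor
  · rintro ⟨-, ⟨-, F', hF', hs⟩ | ⟨σ', -, h', -⟩ | ⟨h', -⟩⟩
    · obtain rfl := Formula.code_injective hF'
      exact (h.sat_decode_code _ hF).mp hs
    · dsimp only at h'
      omega
    · dsimp only at h'
      omega
  · intro hs
    exact ⟨⟨by dsimp only; omega, hF, h.code_mem ν⟩,
      Or.inl ⟨hσ, F, rfl, (h.sat_decode_code _ hF).mpr hs⟩⟩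

theorem mem_stateSeq_rel {σ : ℕ} (hσ : σ < 2) {P : Pred} {i : ℕ} {l : List ℕ} :
    (σ + 2, P.code, l) ∈ h.stateSeq π i ↔ ∃ x ∈ (π σ).rel i P, x.map elemCode = l := by
  rw [mem_stateSeq, Ctx.mem_facts]
  constructor
  · rintro ⟨-, ⟨h', -⟩ | ⟨σ', -, h', P', hP, hx⟩ | ⟨h', -⟩⟩
    · dsimp only at h'
      omega
    · obtain rfl : σ = σ' := by
        dsimp only at h'
        omega
      obtain rfl := Pred.code_injective hP
      exact hx
    · dsimp only at h'
      omega
  · rintro ⟨x, hx, rfl⟩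
    have ha := (π σ).sorted _ _ _ hx
    exact ⟨⟨by dsimp only; omega, (h.pred _ _ ha).1, h.map_elemCode_mem_of_arity ha⟩,
      Or.inr (Or.inl ⟨σ, hσ, rfl, P, rfl, x, hx, rfl⟩)⟩

theorem mem_stateSeq_flag {i e : ℕ} (he : e ∈ c.elems) : (4, 0, [e]) ∈ h.stateSeq π i ↔
    ∃ j ≤ i, ¬ Trace.LowOutputs (π 0) (π 1) (toElem c.elems e) j := by
  rw [mem_stateSeq, Ctx.mem_facts]
  constructor
  · rintro ⟨-, ⟨h', -⟩ | ⟨σ', _, h', -⟩ | ⟨-, e', he', hj⟩⟩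
    · dsimp only at h'
      omega
    · dsimp only at h'
      omega
    · obtain rfl := List.singleton_inj.mp he'
      exact hj
  · intro hj
    have hM : 0 < c.M := h.hS.sorts.trans_le h.sorts
    exact ⟨⟨by simp, hM, Ctx.mem_lists.mpr ⟨hM, by simpa using he⟩⟩,
      Or.inr (Or.inr ⟨rfl, e, rfl, hj⟩)⟩

theorem agrees_stateSeq : h.Agrees π (h.stateSeq π) where
  states i := mem_sublistsOf.mpr List.filter_sublist
  of_rel σ hσ i P x hx := (h.mem_stateSeq_rel π hσ).mpr ⟨x, hx, rfl⟩
  rel_of σ hσ i P x _ hx := by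
    obtain ⟨y, hy, hyx⟩ := (h.mem_stateSeq_rel π hσ).mp hx
    rwa [← map_elemCode_injective hyx]
  wf σ hσ i R l hl := (h.mem_stateSeq_rel π hσ (P := .wf R)).mp hl
  sat σ hσ F hF _ i ν := (h.mem_stateSeq_sat π hσ (h.forms _ hF)).symm

theorem low_stateSeq {i : ℕ} {a : h.carrier.Elem} (hl : Trace.LowInputs (π 0) (π 1) a i) :
    c.Low (h.stateSeq π i) (elemCode a) := by
  have key : ∀ σ < 2, ∀ j x, (σ + 2, Nat.pair 2 j, elemCode a :: x) ∈ h.stateSeq π i ↔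
      ∃ y, a :: y ∈ (π σ).rel i (.low j) ∧ y.map elemCode = x := by
    intro σ hσ j x
    refine (h.mem_stateSeq_rel π hσ (P := .low j)).trans ⟨?_, ?_⟩
    · rintro ⟨_ | ⟨b, y⟩, hy, hyx⟩
      · simp at hyx
      · obtain ⟨hb, rfl⟩ := List.cons.inj hyx
        obtain rfl := elemCode_injective hb
        exact ⟨y, hy, rfl⟩
    · rintro ⟨y, hy, rfl⟩
      exact ⟨_, hy, rfl⟩
  intro j _ x _
  rw [key 0 (by omega), key 1 (by omega)]
  exact exists_congr fun y => and_congr_left fun _ => hl j y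

/-- True facts satisfy the semantic clauses and the unfolding law. Well-sortedness matters: declared
constants and quantified sorts are those that the finite data represent. -/
theorem formOK_stateSeq {σ : ℕ} (hσ : σ < 2) {F : Formula} (hF : F.code ∈ c.forms)
    (hs : F.WellSorted S (w.arity S)) (i : ℕ) (ν : h.carrier.Valuation) :
    c.FormOK (h.stateSeq π i) (h.stateSeq π (i + 1)) σ F.code (h.code ν) := by
  have hclosed := h.good.2.1 _ hF
  have hM := h.forms _ hF
  have hsat := h.mem_stateSeq_sat π hσ hM (i := i) (ν := ν)
  have hsat' := h.mem_stateSeq_sat π hσ hM (i := i + 1) (ν := ν)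
  have hsub : ∀ {G : Formula}, G.code ∈ c.forms → ∀ {j ν},
      ((σ, G.code, h.code ν) ∈ h.stateSeq π j ↔ (π σ).sat G j ν) :=
    fun hG => h.mem_stateSeq_sat π hσ (h.forms _ hG)
  have hvar : ∀ v ∈ F.fv, v.code < c.M := fun v hv => h.term_var_lt hF hv
  unfold Ctx.FormOK
  cases F with
  | eq t t' =>
    obtain ⟨s, h1, h2⟩ := hs
    simp only [Formula.code, Nat.unpair_pair] at hsat ⊢
    simp only [forall_const, IsEmpty.forall_iff, and_true, OfNat.zero_ne_ofNat,
      zero_ne_one]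
    rw [hsat, h.termVal_code h1 fun v hv => hvar v (Or.inl hv),
      h.termVal_code h2 fun v hv => hvar v (Or.inr hv), elemCode_injective.eq_iff]
    rfl
  | rel P ts =>
    obtain ⟨l, h1, h2⟩ := hs
    have hd : decodeD (List ℕ) (Encodable.encode (ts.map Term.code)) = ts.map Term.code :=
      decodeD_encode _
    simp only [Formula.code, Nat.unpair_pair, hd] at hsat ⊢
    simp only [forall_const, IsEmpty.forall_iff, and_true, true_and,
      OfNat.one_ne_ofNat, one_ne_zero]
    rw [hsat, h.map_termVal_code h2 fun t ht v hv => hvar v ⟨t, ht, hv⟩, h.mem_stateSeq_rel π hσ]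
    constructor
    · intro hx
      exact ⟨_, hx, rfl⟩
    · rintro ⟨y, hy, hyx⟩
      rw [map_elemCode_injective hyx] at hy
      exact hy
  | not G =>
    have hc := hclosed.1
    simp only [Formula.code, Nat.unpair_pair, true_or, forall_const] at hsat hc ⊢
    simp only [Nat.reduceEqDiff, IsEmpty.forall_iff, and_true, true_and,
      OfNat.ofNat_ne_zero, OfNat.ofNat_ne_one]
    rw [hsat, hsub hc]
    rfl
  | or G G' =>
    have hc := hclosed.2.1
    simp only [Formula.code, Nat.unpair_pair, true_or, forall_const] at hsat hc ⊢
    simp only [Nat.reduceEqDiff, IsEmpty.forall_iff, and_true, true_and,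
      OfNat.ofNat_ne_zero, OfNat.ofNat_ne_one]
    rw [hsat, hsub hc.1, hsub hc.2]
    rfl
  | ex v G =>
    have hc := hclosed.2.2
    simp only [Formula.code, Nat.unpair_pair, forall_const] at hsat hc ⊢
    simp only [Nat.reduceEqDiff, IsEmpty.forall_iff, and_true, true_and,
      OfNat.ofNat_ne_zero, OfNat.ofNat_ne_one]
    rw [hsat]
    have hvs : v.code.unpair.1 = v.sort := by simp [Var.code]
    rw [hvs]
    constructor
    · rintro ⟨d, hd⟩
      refine ⟨_, h.elemCode_mem (x := ⟨v.sort, d⟩) (hs.1.trans_le h.sorts), by simp, ?_⟩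
      rw [← h.code_update]
      exact (hsub hc).mpr hd
    · rintro ⟨e, he, hes, hd⟩
      have h1 := elemCode_toElem he
      have h2 : (toElem c.elems e).1 = v.sort := hes
      generalize toElem c.elems e = x at h1 h2
      obtain ⟨s, d⟩ := x
      obtain rfl : s = v.sort := h2
      refine ⟨d, (hsub hc).mp ?_⟩
      rw [h.code_update]
      rwa [← h1] at hd
  | next G =>
    have hc := hclosed.1
    simp only [Formula.code, Nat.unpair_pair, or_true, forall_const] at hsat hc ⊢
    simp only [Nat.reduceEqDiff, IsEmpty.forall_iff, and_true, true_and,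
      OfNat.ofNat_ne_zero, OfNat.ofNat_ne_one]
    rw [hsat, hsub hc]
    rfl
  | untl G G' =>
    have hc := hclosed.2.1
    simp only [Formula.code, Nat.unpair_pair, or_true, forall_const] at hsat hsat' hc ⊢
    simp only [Nat.reduceEqDiff, IsEmpty.forall_iff, true_and,
      OfNat.ofNat_ne_zero, OfNat.ofNat_ne_one]
    rw [hsat, hsat', hsub hc.1, hsub hc.2]
    constructor
    · rintro ⟨j, hj, h1, h2⟩
      rcases hj.eq_or_lt with rfl | hj
      · exact Or.inl h1
      · exact Or.inr ⟨h2 i le_rfl hj, j, hj, h1, fun l hl => h2 l (by omega)⟩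
    · rintro (h1 | ⟨h1, j, hj, h2, h3⟩)
      · exact ⟨i, le_rfl, h1, fun l hl hl' => absurd hl (by omega)⟩
      · refine ⟨j, by omega, h2, fun l hl hlj => ?_⟩
        rcases hl.eq_or_lt with rfl | hl
        · exact h1
        · exact h3 l hl hlj

end

/-- All conditions on runs hold for the true facts; flags are set exactly from the first difference
on. By `hforms` no junk code in `forms` can break local consistency. -/
theorem isRun_stateSeq (h : Rep S w φ k c)
    (hforms : ∀ f ∈ c.forms, ∃ F : Formula, F.code = f ∧ F.WellSorted S (w.arity S))
    {π : ℕ → Trace w h.carrier}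
    (hv : Trace.Violates φ k (π 0) (π 1) h.causalAgent h.agent) : c.IsRun (h.stateSeq π) := by
  have A := h.agrees_stateSeq π
  have hex : ∀ σ < 2, (π σ).IsExecution := by
    intro σ hσ
    interval_cases σ
    · exact hv.exec
    · exact hv.exec'
  have hca : ∀ e ∈ c.ca, e ∈ c.elems := fun e he => (h.good.2.2.2.2.2.1.2 e he).1
  have hstate : ∀ i, c.StateOK (h.stateSeq π i) := by
    intro i
    refine ⟨fun σ hσ R _ x _ hx => ?_, fun σ hσ n hn n' hn' hne => ?_, fun n hn => ?_,
      fun e he hag hec => ?_, fun e he => ?_, A.high_iff.mpr hv.high i, ?_⟩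
    · obtain ⟨y, hy, rfl⟩ := A.wf σ hσ i R x hx
      have ha : S.wfRels[R]? = some (y.map Sigma.fst) := (π σ).sorted _ _ _ hy
      obtain ⟨h1, h2⟩ := List.getElem?_eq_some_iff.mp ha
      rw [h.wf, List.getD_eq_getElem _ _ h1, h2]
      exact ⟨h1, by simp [Function.comp_def]⟩
    · rw [h.mem_nodes] at hn hn'
      rw [A.at_iff hσ hn, A.at_iff hσ hn']
      exact (hex σ hσ).sanity i n hn n' hn' hne
    · rw [h.mem_nodes] at hn
      rw [A.at_iff (by omega) hn, A.at_iff (by omega) hn]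
      exact hv.sameCfg i n hn
    · rw [h.numAgent] at hag
      have := h.low_stateSeq π (hv.stubborn ⟨toElem c.elems e, hag⟩ (fun m hm => hec ?_) i)
      · rwa [elemCode_toElem he] at this
      · have h1 := h.getD_ca_mem m
        rwa [← h.elemCode_causalAgent, ← hm, elemCode_toElem he] at h1
    · obtain ⟨m, hm⟩ := h.exists_causalAgent he
      have hlow : Trace.LowInputs (π 0) (π 1) (toElem c.elems e) i →
          c.Low (h.stateSeq π i) e := by
        intro hl
        have := h.low_stateSeq π hl
        rwa [elemCode_toElem (hca e he)] at this
      have hc := hv.causal m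
      rw [hm] at hc
      rcases hc with ⟨j, hj, hl⟩ | hl
      · by_cases hij : i < j
        · exact Or.inr (hlow (hl i hij))
        · exact Or.inl ((h.mem_stateSeq_flag π (hca e he)).mpr ⟨j, not_lt.mp hij, hj⟩)
      · exact Or.inr (hlow (hl i))
    · have := h.low_stateSeq π (hv.low i)
      rwa [h.elemCode_agent] at this
  refine ⟨A.states, ⟨fun σ hσ => ?_, fun σ hσ R _ x _ hx => ?_, fun e he hf => ?_⟩,
    fun i => ⟨hstate i, fun σ hσ f hf ν hν hν' => ?_, fun σ hσ n hn hat => ?_,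
      fun σ hσ e he h1 h2 R hR => ?_, fun e he hf => ?_⟩, ?_, fun i u hu hun => ?_⟩
  · obtain ⟨h1, h2⟩ := (hex σ hσ).init_node
    refine ⟨(h.mem_stateSeq_rel π hσ (P := .node _)).mpr ⟨[], h1, rfl⟩, fun n hn hne => ?_⟩
    rw [h.mem_nodes] at hn
    rw [A.at_iff hσ hn]
    exact h2 n hn hne
  · obtain ⟨y, hy, -⟩ := A.wf σ hσ 0 R x hx
    rw [(hex σ hσ).init_rel R] at hy
    exact hy
  · obtain ⟨j, hj, hj'⟩ := (h.mem_stateSeq_flag π (hca e he)).mp hf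
    obtain rfl : j = 0 := by omega
    refine hj' fun R x => ?_
    rw [hv.exec.init_rel R, hv.exec'.init_rel R]
  · obtain ⟨F, rfl, hF⟩ := hforms f hf
    rw [← h.code_decode hν hν']
    exact h.formOK_stateSeq π hσ hf hF i _
  · rw [h.mem_nodes] at hn
    obtain ⟨e, he, hsrc, hdst⟩ := (hex σ hσ).cfg i n hn ((A.at_iff hσ hn).mp hat)
    refine ⟨e.toNat, by rw [h.edges, mem_edgesOf]; exact ⟨e, he, rfl⟩, hsrc, ?_⟩
    exact (A.at_iff hσ ⟨e, he, Or.inr rfl⟩).mpr hdst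
  · rw [h.edges, mem_edgesOf] at he
    obtain ⟨e, he, rfl⟩ := he
    rw [h.wf] at hR
    exact (A.exec_iff hσ he).mpr ((hex σ hσ).exec i e he
      ((A.at_iff hσ ⟨e, he, Or.inl rfl⟩).mp h1) ((A.at_iff hσ ⟨e, he, Or.inr rfl⟩).mp h2) R hR)
  · obtain ⟨j, hj, hj'⟩ := (h.mem_stateSeq_flag π (hca e he)).mp hf
    rcases Nat.le_succ_iff.mp hj with hj | rfl
    · exact Or.inl ((h.mem_stateSeq_flag π (hca e he)).mpr ⟨j, hj, hj'⟩)
    · refine Or.inr fun ho => hj' ?_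
      rw [← A.obs_iff, elemCode_toElem (hca e he)]
      exact ho
  · obtain ⟨i, hi⟩ := hv.obs
    refine ⟨i, ?_⟩
    rwa [← h.elemCode_agent, A.obs_iff]
  · obtain ⟨σ, f, ν⟩ := u
    obtain ⟨hσ, hf, h6, hν, hν'⟩ := hun
    dsimp only at hσ hf h6 hν hν'
    obtain ⟨F, rfl, hF⟩ := hforms f hf
    have hc := (h.good.2.1 _ hf).2.1
    cases F with
    | untl G G' =>
      rw [← h.code_decode hν hν', h.mem_stateSeq_sat π hσ (h.forms _ hf)] at hu
      obtain ⟨j, hj, h1, -⟩ := hu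
      refine ⟨j, hj, ?_⟩
      simp only [Formula.code, Nat.unpair_pair, or_true, forall_const] at hc
      have := (h.mem_stateSeq_sat π hσ (h.forms _ hc.2)).mpr h1
      rw [h.code_decode hν hν'] at this
      simpa [Ctx.goal, Formula.code] using this
    | _ => simp [Formula.code] at h6

end Rep
end MultiAgent

namespace MultiAgent

/-! ### Numbering finite substructures -/

open Classical in
/-- An enumeration of the elements of sort `s` in a list. -/
noncomputable def enumElem {U : ℕ → Type} [∀ s, Nonempty (U s)] (W : List (Σ s, U s)) (s d : ℕ) :
    U s :=
  -- Index `d` stands for position `d - 1` of `W`; index `0`, and positions of another sort or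
  -- outside the list, give a default element.
  if h : ∃ x : U s, 0 < d ∧ W[d - 1]? = some ⟨s, x⟩ then h.choose else Classical.arbitrary _

theorem exists_enumElem_eq {U : ℕ → Type} [∀ s, Nonempty (U s)] {W : List (Σ s, U s)}
    {e : Σ s, U s} (he : e ∈ W) : ∃ d ≤ W.length, enumElem W e.1 d = e.2 := by
  obtain ⟨i, hi, rfl⟩ := List.getElem_of_mem he
  have h : ∃ x : U (W[i]).1, 0 < i + 1 ∧ W[i + 1 - 1]? = some ⟨(W[i]).1, x⟩ :=
    ⟨(W[i]).2, by omega, List.getElem?_eq_getElem hi⟩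
  refine ⟨i + 1, hi, ?_⟩
  rw [enumElem, dif_pos h]
  have h1 := h.choose_spec.2.symm.trans (List.getElem?_eq_getElem hi)
  exact (eq_of_heq (Sigma.mk.inj (Option.some.inj h1)).2)

-- Keeping only the least index of each enumerated element makes the numbering injective. Index `0`
-- always survives, which supplies the nonempty universes.
open Classical in
theorem exists_numbering {U : ℕ → Type} [∀ s, Nonempty (U s)] {W : List (Σ s, U s)} {M D : ℕ}
    (hW : ∀ e ∈ W, e.1 < M) (hD : W.length ≤ D) :
    ∃ (E : List ℕ) (g : ∀ s, ℕ → U s), E.Sublist (List.range (Nat.pair M D)) ∧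
      (∀ s < M, Nat.pair s 0 ∈ E) ∧
      (∀ s, Function.Injective fun x : FinUniv E s => g s x.1) ∧
      ∀ e ∈ W, ∃ n ∈ E, (⟨n.unpair.1, g _ n.unpair.2⟩ : Σ s, U s) = e := by
  let p : ℕ → ℕ → Prop := fun s d => s < M ∧ d ≤ W.length ∧
    ∀ d' < d, enumElem W s d' ≠ enumElem W s d
  have hmem : ∀ s d, Nat.pair s d ∈ (List.range (Nat.pair M D)).filter
      (fun n => p n.unpair.1 n.unpair.2) ↔ p s d := by
    intro s d
    simp only [List.mem_filter, List.mem_range, decide_eq_true_eq, Nat.unpair_pair]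
    -- Monotonicity of `Nat.pair` in both arguments gives the bound for the codes of elements.
    refine ⟨fun h => h.2, fun h => ⟨(Nat.pair_lt_pair_left d h.1).trans_le ?_, h⟩⟩
    rcases (h.2.1.trans hD).eq_or_lt with rfl | hd
    · exact le_rfl
    · exact (Nat.pair_lt_pair_right M hd).le
  refine ⟨(List.range (Nat.pair M D)).filter (fun n => p n.unpair.1 n.unpair.2), enumElem W, List.filter_sublist,
    fun s hs => (hmem s 0).mpr ⟨hs, Nat.zero_le _, by simp⟩, ?_, fun e he => ?_⟩
  · have hmin : ∀ s d, (d = 0 ∨ Nat.pair s d ∈ (List.range (Nat.pair M D)).filter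
        (fun n => p n.unpair.1 n.unpair.2)) →
        ∀ d' < d, enumElem W s d' ≠ enumElem W s d := by
      rintro s d (rfl | hd)
      · simp
      · exact ((hmem s d).mp hd).2.2
    rintro s ⟨d, hd⟩ ⟨d', hd'⟩ heq
    dsimp only at heq
    rcases lt_trichotomy d d' with hlt | rfl | hlt
    · exact (hmin s d' hd' d hlt heq).elim
    · rfl
    · exact (hmin s d hd d' hlt heq.symm).elim
  · have hex : ∃ d, d ≤ W.length ∧ enumElem W e.1 d = e.2 := exists_enumElem_eq he
    refine ⟨Nat.pair e.1 (Nat.find hex), (hmem _ _).mpr ⟨hW e he, (Nat.find_spec hex).1,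
      fun d hd heq => Nat.find_min hex hd ⟨hd.le.trans (Nat.find_spec hex).1, ?_⟩⟩, ?_⟩
    · rw [heq]
      exact (Nat.find_spec hex).2
    · have h1 := (Nat.find_spec hex).2
      have h2 : ∀ n : ℕ × ℕ, n = (e.1, Nat.find hex) →
          (⟨n.1, enumElem W _ n.2⟩ : Σ s, U s) = e := by
        rintro _ rfl
        exact Sigma.ext rfl (heq_of_eq h1)
      exact h2 _ (Nat.unpair_pair _ _)

/-! ### Bounds for codes -/

theorem Workflow.length_blocks_le (w : Workflow) : w.blocks.length ≤ w.code + 1 := by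
  induction w with
  | block b => simp [Workflow.blocks]
  | seq b w ih =>
    have h1 := Nat.add_le_pair 1 (Nat.pair b.code w.code)
    have h2 := Nat.add_le_pair b.code w.code
    simp only [Workflow.blocks, Workflow.code, List.length_cons]
    omega
  | loop w ih =>
    have h1 := Nat.add_le_pair 2 w.code
    simp only [Workflow.blocks, Workflow.code]
    omega
  | choice w w' ih ih' =>
    have h1 := Nat.add_le_pair 3 (Nat.pair w.code w'.code)
    have h2 := Nat.add_le_pair w.code w'.code
    simp only [Workflow.blocks, Workflow.code, List.length_append]
    omega

theorem Workflow.code_le_of_mem_blocks {w : Workflow} {b : Block} (hb : b ∈ w.blocks) :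
    b.code ≤ w.code := by
  induction w with
  | block b' =>
    obtain rfl := List.mem_singleton.mp hb
    exact Nat.right_le_pair _ _
  | seq b' w ih =>
    rcases List.mem_cons.mp hb with rfl | hb
    · exact (Nat.left_le_pair _ _).trans (Nat.right_le_pair _ _)
    · exact (ih hb).trans ((Nat.right_le_pair _ _).trans (Nat.right_le_pair _ _))
  | loop w ih => exact (ih hb).trans (Nat.right_le_pair _ _)
  | choice w w' ih ih' =>
    rcases List.mem_append.mp hb with hb | hb
    · exact (ih hb).trans ((Nat.left_le_pair _ _).trans (Nat.right_le_pair _ _))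
    · exact (ih' hb).trans ((Nat.right_le_pair _ _).trans (Nat.right_le_pair _ _))

theorem length_le_encode {α : Type} [Encodable α] (l : List α) :
    l.length ≤ Encodable.encode l := by
  induction l with
  | nil => simp
  | cons a l ih =>
    simp only [List.length_cons, Encodable.encode_list_cons]
    have := Nat.right_le_pair (Encodable.encode a) (Encodable.encode l)
    omega

theorem encode_fst_le {α β : Type} [Encodable α] [Encodable β] (x : α × β) :
    Encodable.encode x.1 ≤ Encodable.encode x := by
  obtain ⟨a, b⟩ := x
  exact Nat.left_le_pair _ _

theorem encode_snd_le {α β : Type} [Encodable α] [Encodable β] (x : α × β) :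
    Encodable.encode x.2 ≤ Encodable.encode x := by
  obtain ⟨a, b⟩ := x
  exact Nat.right_le_pair _ _

/-- A bound for the codes of symbols, variables and formulas. -/
def codeBound (n : ℕ) (edges : List (ℕ × ℕ × ℕ × ℕ)) : ℕ :=
  edges.foldr (fun e r => r + (Nat.pair 3 e.1 + Nat.pair 3 e.2.1))
    (Nat.pair (2 * n + 5) (2 * n + 5))

/-- A bound for the numbers of elements that are needed of each sort. -/
def sizeBound (n M : ℕ) : ℕ := n + 1 + n + M + n * M

theorem pair_le_codeBound (n : ℕ) (l : List (ℕ × ℕ × ℕ × ℕ)) :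
    Nat.pair (2 * n + 5) (2 * n + 5) ≤ codeBound n l := by
  induction l with
  | nil => exact le_rfl
  | cons e l ih => exact ih.trans (Nat.le_add_right _ _)

theorem pair_lt_codeBound {n a b : ℕ} (l : List (ℕ × ℕ × ℕ × ℕ)) (ha : a < 2 * n + 5)
    (hb : b < 2 * n + 5) : Nat.pair a b < codeBound n l :=
  ((Nat.pair_lt_pair_left b ha).trans (Nat.pair_lt_pair_right _ hb)).trans_le
    (pair_le_codeBound n l)

theorem lt_codeBound {n a : ℕ} (l : List (ℕ × ℕ × ℕ × ℕ)) (ha : a ≤ 2 * n) : a < codeBound n l :=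
  (Nat.left_le_pair a 0).trans_lt (pair_lt_codeBound l (by omega) (by omega))

/-- Summing over the edges bounds the codes of node propositions without an estimate of node numbers
in terms of the input. -/
theorem pair_node_lt_codeBound {n : ℕ} {l : List (ℕ × ℕ × ℕ × ℕ)} {e : ℕ × ℕ × ℕ × ℕ}
    (he : e ∈ l) : Nat.pair 3 e.1 < codeBound n l ∧ Nat.pair 3 e.2.1 < codeBound n l := by
  induction l with
  | nil => simp at he
  | cons e' l ih =>
    have h1 := lt_codeBound (n := n) l (Nat.zero_le _)
    have h2 : codeBound n (e' :: l) =
      codeBound n l + (Nat.pair 3 e'.1 + Nat.pair 3 e'.2.1) := rfl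
    rcases List.mem_cons.mp he with rfl | he
    · omega
    · have := ih he
      omega

/-! ### The algorithm -/

/-- The parts of an input. -/
def inputParts (n : ℕ) : (ℕ × ℕ × List ℕ × List (List ℕ) × List (List ℕ)) ×
    List (ℕ × ℕ × ℕ × ℕ) × List (List ℕ) × ℕ :=
  let x := decodeD (ℕ × ℕ × ℕ × ℕ) n
  (decodeD (ℕ × ℕ × List ℕ × List (List ℕ) × List (List ℕ)) x.1, edgesOf x.2.1,
    decodeD (List (List ℕ)) x.2.2.1, x.2.2.2)

@[fun_prop] theorem primrec_inputParts {α : Type} [Primcodable α] {f : α → ℕ} (hf : Primrec f) :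
    Primrec fun a => inputParts (f a) := by
  unfold inputParts
  fun_prop

theorem inputParts_inputCode (S : Signature) (w : Workflow) (φ : Declassification) (k : ℕ) :
    inputParts (inputCode S w φ k) =
      ((S.numAgentSorts, S.numDataSorts, S.constSorts, S.wfRels, S.highRels), edgesOf w.code,
        List.map (List.map Formula.code) φ, k) := by
  rw [inputParts, inputCode, decodeD_encode]
  dsimp only
  rw [Signature.code, decodeD_encode, Declassification.code, decodeD_encode]

/-- The bound for the codes that occur in an input. -/
def inputBound (n : ℕ) : ℕ := codeBound n (inputParts n).2.1

@[fun_prop] theorem primrec_inputBound {α : Type} [Primcodable α] {f : α → ℕ} (hf : Primrec f) :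
    Primrec fun a => inputBound (f a) := by
  unfold inputBound codeBound
  fun_prop

@[fun_prop] theorem Ctx.primrec_mk {α : Type} [Primcodable α] {numAgent k M ag : α → ℕ}
    {consts elems forms cs ca : α → List ℕ} {wf high cond : α → List (List ℕ)}
    {edges : α → List (ℕ × ℕ × ℕ × ℕ)} (h₁ : Primrec numAgent) (h₂ : Primrec consts)
    (h₃ : Primrec wf) (h₄ : Primrec high) (h₅ : Primrec edges) (h₆ : Primrec cond)
    (h₇ : Primrec k) (h₈ : Primrec M) (h₉ : Primrec elems) (h₁₀ : Primrec forms)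
    (h₁₁ : Primrec cs) (h₁₂ : Primrec ca) (h₁₃ : Primrec ag) :
    Primrec fun a => Ctx.mk (numAgent a) (consts a) (wf a) (high a) (edges a) (cond a) (k a) (M a)
      (elems a) (forms a) (cs a) (ca a) (ag a) := by
  have h : Primrec fun a => (numAgent a, consts a, wf a, high a, edges a, cond a, k a, M a,
    elems a, forms a, cs a, ca a, ag a) := by fun_prop
  exact ((Primrec.of_equiv_symm (e := Ctx.equiv)).comp h).of_eq fun _ => rfl

/-- The search problem for an input and a choice of a carrier, formulas, constants and agents. -/
def mkCtx (n : ℕ) (E C cs ca : List ℕ) (ag : ℕ) : Ctx where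
  numAgent := (inputParts n).1.1
  consts := (inputParts n).1.2.2.1
  wf := (inputParts n).1.2.2.2.1
  high := (inputParts n).1.2.2.2.2
  edges := (inputParts n).2.1
  cond := (inputParts n).2.2.1
  k := (inputParts n).2.2.2
  M := inputBound n
  elems := E
  forms := C
  cs := cs
  ca := ca
  ag := ag

@[fun_prop] theorem primrec_mkCtx {α : Type} [Primcodable α] {n ag : α → ℕ}
    {E C cs ca : α → List ℕ} (hn : Primrec n) (hE : Primrec E) (hC : Primrec C)
    (hcs : Primrec cs) (hca : Primrec ca) (hag : Primrec ag) :
    Primrec fun a => mkCtx (n a) (E a) (C a) (cs a) (ca a) (ag a) := by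
  unfold mkCtx
  fun_prop

/-- There is a counterexample of bounded size. -/
def HasViolation (n : ℕ) : Prop :=
  ∃ E ∈ sublistsOf (List.range (Nat.pair (inputBound n) (sizeBound n (inputBound n)))),
    ∃ C ∈ sublistsOf (List.range (inputBound n)), ∃ cs ∈ listsOver E (inputBound n),
      ∃ ca ∈ listsOver E (inputBound n), ∃ ag ∈ E,
        (mkCtx n E C cs ca ag).Good ∧ (mkCtx n E C cs ca ag).Violation

/-- Every quantifier ranges over a list computed from the input. Guessing the formula codes avoids
deciding well-sortedness: `Good` asks only for closure and for the presence of guards and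
conditions. -/
theorem primrecPred_hasViolation : PrimrecPred HasViolation := by
  unfold HasViolation sizeBound
  fun_prop

end MultiAgent

/-! ### Correctness of the algorithm -/

namespace MultiAgent

variable {S : Signature} {w : Workflow} {φ : Declassification} {k : ℕ}

theorem signature_code_le : S.code ≤ inputCode S w φ k :=
  encode_fst_le (S.code, w.code, φ.code, k)

theorem workflow_code_le : w.code ≤ inputCode S w φ k :=
  (encode_fst_le (w.code, φ.code, k)).trans (encode_snd_le (S.code, w.code, φ.code, k))

theorem declassification_code_le : φ.code ≤ inputCode S w φ k :=
  (encode_fst_le (φ.code, k)).trans ((encode_snd_le (w.code, φ.code, k)).trans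
    (encode_snd_le (S.code, w.code, φ.code, k)))

theorem numCausal_le : k ≤ inputCode S w φ k :=
  (encode_snd_le (φ.code, k)).trans ((encode_snd_le (w.code, φ.code, k)).trans
    (encode_snd_le (S.code, w.code, φ.code, k)))

namespace Signature

theorem numAgentSorts_le_code (S : Signature) : S.numAgentSorts ≤ S.code :=
  encode_fst_le (S.numAgentSorts, S.numDataSorts, S.constSorts, S.wfRels, S.highRels)

theorem numDataSorts_le_code (S : Signature) : S.numDataSorts ≤ S.code :=
  (encode_fst_le (S.numDataSorts, S.constSorts, S.wfRels, S.highRels)).trans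
    (encode_snd_le (S.numAgentSorts, _, _, _, _))

theorem encode_constSorts_le_code (S : Signature) : Encodable.encode S.constSorts ≤ S.code :=
  (encode_fst_le (_, _, _)).trans ((encode_snd_le (S.numDataSorts, _, _, _)).trans
    (encode_snd_le (S.numAgentSorts, _, _, _, _)))

theorem encode_wfRels_le_code (S : Signature) : Encodable.encode S.wfRels ≤ S.code :=
  (encode_fst_le (_, _)).trans ((encode_snd_le (S.constSorts, _, _)).trans
    ((encode_snd_le (S.numDataSorts, _, _, _)).trans
      (encode_snd_le (S.numAgentSorts, _, _, _, _))))

theorem encode_highRels_le_code (S : Signature) : Encodable.encode S.highRels ≤ S.code :=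
  (encode_snd_le (S.wfRels, _)).trans ((encode_snd_le (S.constSorts, _, _)).trans
    ((encode_snd_le (S.numDataSorts, _, _, _)).trans
      (encode_snd_le (S.numAgentSorts, _, _, _, _))))

end Signature

theorem Block.encode_vars_le_code (b : Block) :
    Encodable.encode (b.vars.map Var.code) ≤ b.code :=
  (encode_fst_le (_, _)).trans (encode_snd_le (b.may, _, _))

theorem Block.guard_code_lt_code {b : Block} {st : Stmt} (hst : st ∈ b.stmts) :
    st.guard.code < b.code := by
  have h1 : Encodable.encode st.code < Encodable.encode (b.stmts.map Stmt.code) :=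
    encode_lt_of_mem (List.mem_map_of_mem hst)
  have h2 : Encodable.encode (b.stmts.map Stmt.code) ≤ b.code :=
    (encode_snd_le (b.vars.map Var.code, _)).trans (encode_snd_le (b.may, _, _))
  have h3 : st.guard.code ≤ st.code :=
    encode_fst_le (st.guard.code, st.rel, st.add, st.args.map Term.code)
  exact (h3.trans_lt h1).trans_le h2

theorem Declassification.code_lt_code {row : List Formula} (hrow : row ∈ φ) {ψ : Formula}
    (hψ : ψ ∈ row) : ψ.code < φ.code := by
  have h1 : Encodable.encode ψ.code < Encodable.encode (row.map Formula.code) :=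
    encode_lt_of_mem (List.mem_map_of_mem hψ)
  exact h1.trans (encode_lt_of_mem (List.mem_map_of_mem hrow))

theorem inputBound_inputCode :
    inputBound (inputCode S w φ k) = codeBound (inputCode S w φ k) (edgesOf w.code) := by
  rw [inputBound, inputParts_inputCode]

theorem lt_inputBound {a : ℕ} (h : a ≤ 2 * inputCode S w φ k) :
    a < inputBound (inputCode S w φ k) := by
  rw [inputBound_inputCode]
  exact lt_codeBound _ h

theorem pair_lt_inputBound {a b : ℕ} (ha : a < 2 * inputCode S w φ k + 5)
    (hb : b < 2 * inputCode S w φ k + 5) : Nat.pair a b < inputBound (inputCode S w φ k) := by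
  rw [inputBound_inputCode]
  exact pair_lt_codeBound _ ha hb

theorem length_le_of_mem {l : List ℕ} (hl : l ∈ S.wfRels ∨ l ∈ S.highRels) :
    l.length ≤ S.code ∧ ∀ s ∈ l, s ≤ S.code := by
  have h1 : Encodable.encode l ≤ S.code := by
    rcases hl with hl | hl
    · exact (encode_lt_of_mem hl).le.trans S.encode_wfRels_le_code
    · exact (encode_lt_of_mem hl).le.trans S.encode_highRels_le_code
  exact ⟨(length_le_encode l).trans h1,
    fun s hs => (encode_lt_of_mem (α := ℕ) hs).le.trans h1⟩

theorem rep_mkCtx (hS : S.WellFormed) (hw : w.WellFormed S) (hφ : φ.WellFormed S w)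
    {E C cs ca : List ℕ} {ag : ℕ} (hC : ∀ f ∈ C, f < inputBound (inputCode S w φ k))
    (hg : (mkCtx (inputCode S w φ k) E C cs ca ag).Good) :
    Rep S w φ k (mkCtx (inputCode S w φ k) E C cs ca ag) where
  hS := hS
  hw := hw
  hφ := hφ
  numAgent := by rw [mkCtx, inputParts_inputCode]
  consts := by rw [mkCtx, inputParts_inputCode]
  wf := by rw [mkCtx, inputParts_inputCode]
  high := by rw [mkCtx, inputParts_inputCode]
  edges := by rw [mkCtx, inputParts_inputCode]
  cond := by rw [mkCtx, inputParts_inputCode]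
  card := by rw [mkCtx, inputParts_inputCode]
  sorts := by
    have h1 := S.numAgentSorts_le_code
    have h2 := S.numDataSorts_le_code
    have h3 := signature_code_le (S := S) (w := w) (φ := φ) (k := k)
    refine (lt_inputBound ?_).le
    simp only [Signature.numSorts]
    omega
  pred := by
    have hn := signature_code_le (S := S) (w := w) (φ := φ) (k := k)
    have hn' := workflow_code_le (S := S) (w := w) (φ := φ) (k := k)
    intro P l hl
    cases P with
    | wf i =>
      obtain ⟨hi, hil⟩ := List.getElem?_eq_some_iff.mp (show S.wfRels[i]? = some l from hl)
      have h1 := length_le_of_mem (Or.inl (hil ▸ List.getElem_mem hi))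
      have h2 := (length_le_encode S.wfRels).trans S.encode_wfRels_le_code
      exact ⟨pair_lt_inputBound (by omega) (by omega), (lt_inputBound (by omega)).le⟩
    | high i =>
      obtain ⟨hi, hil⟩ := List.getElem?_eq_some_iff.mp (show S.highRels[i]? = some l from hl)
      have h1 := length_le_of_mem (Or.inr (hil ▸ List.getElem_mem hi))
      have h2 := (length_le_encode S.highRels).trans S.encode_highRels_le_code
      exact ⟨pair_lt_inputBound (by omega) (by omega), (lt_inputBound (by omega)).le⟩
    | low j =>
      obtain ⟨b, hb, hl⟩ := Option.bind_eq_some_iff.mp hl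
      split_ifs at hl
      obtain rfl := Option.some.inj hl
      obtain ⟨hj, -⟩ := List.getElem?_eq_some_iff.mp hb
      have h1 := w.length_blocks_le
      have h2 := Workflow.code_le_of_mem_blocks (List.mem_of_getElem? hb)
      have h3 := (length_le_encode (b.vars.map Var.code)).trans b.encode_vars_le_code
      rw [List.length_map] at h3 ⊢
      exact ⟨pair_lt_inputBound (by omega) (by omega), (lt_inputBound (by omega)).le⟩
    | node m =>
      simp only [Workflow.arity] at hl
      split_ifs at hl with hm
      obtain rfl := Option.some.inj hl
      refine ⟨?_, Nat.zero_le _⟩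
      obtain ⟨e, he, hme⟩ := hm
      have h1 := pair_node_lt_codeBound (n := inputCode S w φ k)
        (mem_edgesOf.mpr ⟨e, he, rfl⟩)
      change Nat.pair 3 m < inputBound _
      rw [inputBound_inputCode]
      rcases hme with rfl | rfl
      · exact h1.1
      · exact h1.2
  vars b hb v hv := by
    have h1 := workflow_code_le (S := S) (w := w) (φ := φ) (k := k)
    have h2 := Workflow.code_le_of_mem_blocks hb
    have h3 : Encodable.encode v.code < Encodable.encode (b.vars.map Var.code) :=
      encode_lt_of_mem (List.mem_map_of_mem hv)
    have h4 := b.encode_vars_le_code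
    rw [Encodable.encode_nat] at h3
    exact lt_inputBound (by omega)
  tuple l hl v hv := by
    have hn := signature_code_le (S := S) (w := w) (φ := φ) (k := k)
    obtain ⟨h1, h2⟩ := length_le_of_mem (Or.inr hl)
    rw [Rep.tupleVars_eq] at hv
    obtain ⟨i, hi, rfl⟩ := List.mem_map.mp hv
    rw [List.mem_range] at hi
    have h3 := h2 _ (List.getElem_mem hi)
    rw [List.getD_eq_getElem _ _ hi]
    exact pair_lt_inputBound (by dsimp only; omega) (by dsimp only; omega)
  agentVar s hs := by
    have h1 := S.numAgentSorts_le_code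
    have h3 := signature_code_le (S := S) (w := w) (φ := φ) (k := k)
    exact pair_lt_inputBound (a := s) (b := 0) (by omega) (by omega)
  forms := hC
  good := hg

/-- A lasso gives a run, and a run gives traces over a finite carrier, which is an admissible
carrier in the definition. Additional codes in `C` only add constraints on the run. -/
theorem not_nonInterference_of_hasViolation (hS : S.WellFormed) (hw : w.WellFormed S)
    (hφ : φ.WellFormed S w) (h : HasViolation (inputCode S w φ k)) :
    ¬ NonInterference S w φ k := by
  obtain ⟨E, hE, C, hC, cs, hcs, ca, hca, ag, hag, hg, hv⟩ := h
  have hr := rep_mkCtx hS hw hφ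
    (fun f hf => List.mem_range.mp ((mem_sublistsOf.mp hC).subset hf)) hg
  obtain ⟨q, hq⟩ := Ctx.violation_iff_exists_isRun.mp hv
  exact not_nonInterference_iff.mpr ⟨_, _, _, _, _, hr.violates_of_isRun hq⟩

theorem Rep.violation_of_emb {c : Ctx} (h : Rep S w φ k c) (hno : w.NonOmitting)
    (hu : φ.NegationsUniversal)
    (hforms : ∀ f ∈ c.forms, ∃ F : Formula, F.code = f ∧ F.WellSorted S (w.arity S))
    {K : Carrier S} (H : h.carrier.Emb K) {π π' : Trace w K} {ca : Fin k → K.Agent} {a : K.Agent}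
    (hv : Trace.Violates φ k π π' ca a) (hca : ∀ i, H.elem (h.causalAgent i).1 = (ca i).1)
    (ha : H.elem h.agent.1 = a.1)
    (hcw : ∀ m, (∀ i, Trace.LowInputs π π' (ca m).1 i) ∨ ∃ j R x,
      (∀ e ∈ x, ∃ e', H.elem e' = e) ∧
      ¬ ((ca m).1 :: x ∈ π.rel j (.wf R) ↔ (ca m).1 :: x ∈ π'.rel j (.wf R)) ∧
      ∀ i < j, Trace.LowInputs π π' (ca m).1 i)
    (haw : ∃ j R x, (∀ e ∈ x, ∃ e', H.elem e' = e) ∧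
      ¬ (a.1 :: x ∈ π.rel j (.wf R) ↔ a.1 :: x ∈ π'.rel j (.wf R))) : c.Violation :=
  Ctx.violation_iff_exists_isRun.mpr ⟨_, h.isRun_stateSeq hforms
    (π := fun σ => if σ = 0 then H.pull π else H.pull π')
    (H.violates_pull h.hw hno h.hφ hu hv hca ha hcw haw)⟩

-- Witnesses of bounded number are renumbered within the search range; the resulting finite carrier
-- embeds into the given one, and the restricted counterexample is a run.
open Classical in
theorem hasViolation_of_not_nonInterference (hS : S.WellFormed) (hw : w.WellFormed S)
    (hφ : φ.WellFormed S w) (hno : w.NonOmitting) (hu : φ.NegationsUniversal)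
    (h : ¬ NonInterference S w φ k) : HasViolation (inputCode S w φ k) := by
  obtain ⟨K, π, π', c, a, hv⟩ := not_nonInterference_iff.mp h
  have hSn : S.code ≤ inputCode S w φ k := signature_code_le
  have hwn : w.code ≤ inputCode S w φ k := workflow_code_le
  have hφn : φ.code ≤ inputCode S w φ k := declassification_code_le
  have hkn : k ≤ inputCode S w φ k := numCausal_le
  have hlt : ∀ {m}, m ≤ 2 * inputCode S w φ k → m < inputBound (inputCode S w φ k) :=
    fun hm => lt_inputBound hm
  have hparts := inputParts_inputCode S w φ k
  have hrep := fun E C cs ca ag => rep_mkCtx (k := k) (E := E) (C := C) (cs := cs) (ca := ca)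
    (ag := ag) hS hw hφ
  unfold HasViolation
  -- From here on the code enters only through the inequalities, `hparts` and `hrep`.
  generalize inputCode S w φ k = n at *
  generalize hM : inputBound n = M at *
  have hsorts : S.numSorts ≤ M := by
    have h1 := S.numAgentSorts_le_code
    have h2 := S.numDataSorts_le_code
    refine (hlt ?_).le
    simp only [Signature.numSorts]
    omega
  have hconsts : S.constSorts.length ≤ n :=
    (length_le_encode _).trans (S.encode_constSorts_le_code.trans hSn)
  -- Arities have length at most `M`, and the numbers of constants and of causal agents are at most
  -- `n`; this gives the form of `sizeBound`.
  obtain ⟨W, hW, hWs, hWc, hWca, hWa, hWcw, hWaw⟩ := hv.exists_witnesses hS (L := M)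
    fun l hl => by
      have := (length_le_of_mem (Or.inl hl)).1
      exact (hlt (by omega)).le
  have := K.nonempty
  have hD : W.length ≤ sizeBound n M := by
    have := Nat.mul_le_mul_right M hkn
    unfold sizeBound
    omega
  obtain ⟨E, g, hE, hE0, hginj, hgW⟩ :=
    exists_numbering (fun e he => (hWs e he).trans_le hsorts) hD
  have hnum : ∀ e : K.Elem, ∃ u : ℕ, e ∈ W → u ∈ E ∧
      (⟨u.unpair.1, g _ u.unpair.2⟩ : K.Elem) = e := by
    intro e
    by_cases he : e ∈ W
    · obtain ⟨u, hu⟩ := hgW e he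
      exact ⟨u, fun _ => hu⟩
    · exact ⟨0, fun h => (he h).elim⟩
  choose num hnum using hnum
  have hnum1 : ∀ e ∈ W, (num e).unpair.1 = e.1 := fun e he => congrArg Sigma.fst (hnum e he).2
  -- All well-sorted formulas below the bound: closed under subformulas, and containing all guards
  -- and conditions.
  obtain ⟨C, hCs, hC⟩ : ∃ C : List ℕ, C.Sublist (List.range M) ∧ ∀ f, f ∈ C ↔
      f < M ∧ ∃ F : Formula, F.code = f ∧ F.WellSorted S (w.arity S) :=
    ⟨(List.range M).filter fun f => ∃ F : Formula, F.code = f ∧ F.WellSorted S (w.arity S),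
      List.filter_sublist, by simp⟩
  obtain ⟨cs, hcsl, hcss, hcsD⟩ : ∃ cs : List ℕ, cs.length = S.constSorts.length ∧
      (∀ e ∈ cs, ∃ i < S.constSorts.length, num (K.const i) = e) ∧
      ∀ i < S.constSorts.length, cs.getD i 0 = num (K.const i) :=
    ⟨(List.range S.constSorts.length).map fun i => num (K.const i), by simp, by simp,
      fun i hi => by simp [hi]⟩
  obtain ⟨ca, hcal, hcas, hcaD⟩ : ∃ ca : List ℕ, ca.length = k ∧
      (∀ e ∈ ca, ∃ i, num (c i).1 = e) ∧ ∀ i : Fin k, ca.getD i 0 = num (c i).1 :=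
    ⟨List.ofFn fun i => num (c i).1, by simp, by simp [List.mem_ofFn], by simp⟩
  have hcond : ∀ row ∈ φ, ∀ ψ ∈ row, ψ.code ∈ C := by
    intro row hrow ψ hψ
    have h1 := Declassification.code_lt_code hrow hψ
    refine (hC _).mpr ⟨hlt (by omega), ψ, rfl, ?_⟩
    obtain ⟨O, hO, rfl⟩ := List.getElem_of_mem hrow
    obtain ⟨s, hs, rfl⟩ := List.getElem_of_mem hψ
    exact hφ.sorted O s _ ⟨_, List.getElem?_eq_getElem hO, List.getElem?_eq_getElem hs⟩
  have hguard : ∀ b ∈ w.blocks, ∀ st ∈ b.stmts, st.guard.code ∈ C := by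
    intro b hb st hst
    have h1 := Workflow.code_le_of_mem_blocks hb
    have h2 := Block.guard_code_lt_code hst
    exact (hC _).mpr ⟨hlt (by omega), _, rfl,
      ((hw b hb).stmts st hst).guard_sorted.mono fun _ _ => Workflow.arity_eq_of_arity⟩
  have hgood : (mkCtx n E C cs ca (num a.1)).Good := by
    unfold Ctx.Good mkCtx
    dsimp only
    rw [hparts, hM]
    dsimp only
    refine ⟨hE0, fun f hf => ?_, fun e he he0 s hs => ?_, fun row hrow f hf => ?_, fun i hi => ?_,
      ⟨hcal, fun e he => ?_⟩, (hnum _ hWa).1, ?_⟩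
    · obtain ⟨hfM, F, rfl, hF⟩ := (hC f).mp hf
      have hsub : ∀ G : Formula, G.code ≤ F.code → G.WellSorted S (w.arity S) → G.code ∈ C :=
        fun G hG hGs => (hC _).mpr ⟨hG.trans_lt hfM, G, rfl, hGs⟩
      have hl := fun a b c => (Nat.left_le_pair a b).trans (Nat.right_le_pair c (Nat.pair a b))
      have hr := fun a b c => (Nat.right_le_pair a b).trans (Nat.right_le_pair c (Nat.pair a b))
      cases F with
      | eq t t' => simp [Formula.code]
      | rel P ts => simp [Formula.code]
      | not G => simpa [Formula.code] using hsub G (Nat.right_le_pair _ _) hF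
      | or G G' =>
        simpa [Formula.code] using And.intro (hsub G (hl _ _ _) hF.1) (hsub G' (hr _ _ _) hF.2)
      | ex v G => simpa [Formula.code] using hsub G (hr _ _ _) hF.2
      | next G => simpa [Formula.code] using hsub G (Nat.right_le_pair _ _) hF
      | untl G G' =>
        simpa [Formula.code] using And.intro (hsub G (hl _ _ _) hF.1) (hsub G' (hr _ _ _) hF.2)
    · obtain ⟨e, he', rfl⟩ := mem_edgesOf.mp he
      rcases hlab : e.label with _ | ⟨j, b⟩
      · simp [Workflow.Edge.toNat, hlab] at he0
      · simp only [Workflow.Edge.toNat, hlab, Option.elim_some] at hs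
        rw [Block.code, decodeD_encode] at hs
        obtain ⟨st, hst, rfl⟩ := List.mem_map.mp hs
        rw [Stmt.code, decodeD_encode]
        exact hguard b (List.mem_of_getElem? (Workflow.blocks_getElem?_of_mem_edges he' hlab))
          st hst
    · obtain ⟨row, hrow', rfl⟩ := List.mem_map.mp hrow
      obtain ⟨ψ, hψ, rfl⟩ := List.mem_map.mp hf
      exact hcond row hrow' ψ hψ
    · rw [hcsD i hi, hnum1 _ (hWc i hi), List.getD_eq_getElem _ _ hi]
      exact ⟨(hnum _ (hWc i hi)).1, K.const_sort i _ (List.getElem?_eq_getElem hi)⟩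
    · obtain ⟨i, rfl⟩ := hcas e he
      rw [hnum1 _ (hWca i)]
      exact ⟨(hnum _ (hWca i)).1, (c i).2⟩
    · rw [hnum1 _ hWa]
      exact a.2
  have hr : Rep S w φ k (mkCtx n E C cs ca (num a.1)) :=
    hrep _ _ _ _ _ (fun f hf => ((hC f).mp hf).1) hgood
  have hval : ∀ u ∈ E, (⟨(toElem E u).1, g _ (toElem E u).2.1⟩ : K.Elem) =
      ⟨u.unpair.1, g _ u.unpair.2⟩ := by
    intro u hu
    have h1 : (FinUniv.mk E u.unpair.1 u.unpair.2).1 = u.unpair.2 :=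
      FinUniv.val_mk (Or.inr (by rwa [Nat.pair_unpair]))
    exact congrArg (fun d => (⟨u.unpair.1, g _ d⟩ : K.Elem)) h1
  have hval' : ∀ e ∈ W, (⟨(toElem E (num e)).1, g _ (toElem E (num e)).2.1⟩ : K.Elem) = e :=
    fun e he => (hval _ (hnum e he).1).trans (hnum e he).2
  -- Each number is sent to the element it enumerates; all of `W` lies in the image.
  let H : hr.carrier.Emb K :=
    { toFun := fun s x => g s x.1
      inj := hginj
      const := by
        intro i s hi
        obtain ⟨hi', -⟩ := List.getElem?_eq_some_iff.mp hi
        have h1 := hval' _ (hWc i hi')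
        rw [← hcsD i hi'] at h1
        exact h1 }
  have hHW : ∀ e ∈ W, ∃ e', H.elem e' = e := fun e he => ⟨toElem E (num e), hval' e he⟩
  have hviol : (mkCtx n E C cs ca (num a.1)).Violation :=
    hr.violation_of_emb hno hu (fun f hf => ((hC f).mp hf).2) H hv
      (fun i => by
        have h1 := hval' _ (hWca i)
        rw [← hcaD i] at h1
        exact h1)
      (hval' _ hWa)
      (fun m => (hWcw m).imp_right
        fun ⟨j, R, x, hx, h⟩ => ⟨j, R, x, fun e he => hHW e (hx e he), h⟩)
      (by
        obtain ⟨j, R, x, hx, h⟩ := hWaw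
        exact ⟨j, R, x, fun e he => hHW e (hx e he), h⟩)
  refine ⟨E, mem_sublistsOf.mpr hE, C, mem_sublistsOf.mpr hCs, cs,
    mem_listsOver.mpr ⟨?_, fun e he => ?_⟩, ca, mem_listsOver.mpr ⟨?_, fun e he => ?_⟩, num a.1,
    (hnum _ hWa).1, hgood, hviol⟩
  · exact (hlt (by omega)).le
  · obtain ⟨i, hi, rfl⟩ := hcss e he
    exact (hnum _ (hWc i hi)).1
  · exact (hlt (by omega)).le
  · obtain ⟨i, rfl⟩ := hcas e he
    exact (hnum _ (hWca i)).1

end MultiAgent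

open Classical in
theorem mainTheorem1 :
    ∃ f : ℕ → Bool, Computable f ∧
      ∀ (S : MultiAgent.Signature) (w : MultiAgent.Workflow) (φ : MultiAgent.Declassification)
        (k : ℕ),
        S.WellFormed → w.WellFormed S → φ.WellFormed S w →
        w.NonOmitting → φ.NegationsUniversal →
        (f (MultiAgent.inputCode S w φ k) = true ↔ MultiAgent.NonInterference S w φ k) := by
  refine ⟨fun n => decide (¬ MultiAgent.HasViolation n),
    (MultiAgent.primrecPred_hasViolation.not.decide).to_comp, ?_⟩
  intro S w φ k hS hw hφ hno hu
  rw [decide_eq_true_iff, not_iff_comm]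
  exact ⟨MultiAgent.hasViolation_of_not_nonInterference hS hw hφ hno hu,
    MultiAgent.not_nonInterference_of_hasViolation hS hw hφ⟩
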